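/- Let $\mathbb S^3\subset\mathbb R^4\simeq\mathbb C^2$ be the unit sphere with its round metric $g$, and let $\mathbb T=\{(z_1,z_2)\in\mathbb C^2: |z_1|^2=|z_2|^2=\tfrac12\}$ be the Clifford torus. For $\theta,\phi\in\mathbb R$ and $t\in\mathbb R$ put $$\Phi(\theta,\phi,t)=\big(\sin(t+\tfrac\pi4)\,e^{i\sqrt2\,\theta},\ \cos(t+\tfrac\pi4)\,e^{i\sqrt2\,\phi}\big)\in\mathbb S^3,$$ and for $p=(z_1,z_2)\in\mathbb S^3$ put $t(p)=\arcsin|z_1|-\tfrac\pi4\in[-\tfrac\pi4,\tfrac\pi4]$. Then $|t(p)|$ is the spherical distance from $p$ to $\mathbb T$, $t(\Phi(\theta,\phi,t))=t$ for $|t|<\frac\pi4$, and $\Phi(\cdot,\cdot,0)$ is an immersion with image $\mathbb T$ that takes the same value at two points exactly when they differ by an element of $(\sqrt2\,\pi\mathbb Z)^2$; so it is an embedding of the torus $\mathbb R^2/(\sqrt2\,\pi\mathbb Z)^2$. Let $N=\frac{\partial\Phi}{\partial t}\big|_{t=0}$; it is a unit normal to $\mathbb T$, and $\mathbb T$ is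 minimal for $g$. For $r\in(0,\frac\pi8)$ call *profile* a smooth even function $\zeta:(-\frac\pi4,\frac\pi4)\to\mathbb R$ such that 1. $\zeta(0)=1$, $\zeta$ is (weakly) decreasing on $(0,r)$ and $\zeta(r)=0$; 2. $\zeta<0$ on $(r,2r)$; 3. $\zeta=0$ on $[2r,\frac\pi4)$; 4. $\int_0^{2r}\zeta(s)\,ds=0$. For every $r\in(0,\frac\pi8)$ such profiles exist, even with $\zeta$ strictly decreasing on $(0,r)$. Given a profile put $\varphi(t)=\int_0^t\int_0^s\zeta(x)\,dx\,ds$ for $|t|\le\frac\pi4$. There is $r_0>0$ such that for every $r\in(0,\frac\pi8)$ and every profile $\zeta$ for $r$ the following hold. (a) $\bar g=e^{2\varphi(t)}g$ is a smooth Riemannian metric on all of $\mathbb S^3$. (b) If $r<r_0$, then $\bar g$ has nonnegative Ricci curvature: $\overline{\mathrm{Ric}}(v,v)\ge0$ for every tangent vector $v$. Moreover $\overline{\mathrm{Ric}}(v,v)>0$ for every $v\neq0$ tangent to $\mathbb S^3$ at a point outside $\mathbb T$, and for $v$ tangent to $\mathbb S^3$ at a point of $\mathbb T$ one has $\overline{\mathrm{Ric}}(v,v)=0$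 if and only if $v$ is a multiple of $N$. (c) With respect to $\bar g$: $N$ is a unit normal to $\mathbb T$, the metric induced on $\mathbb T$ is $d\theta^2+d\phi^2$ (the same as the one induced by $g$), $\mathbb T$ is minimal, its second fundamental form satisfies $|\bar\sigma|^2=2$, $\overline{\mathrm{Ric}}(N,N)=0$, and the Jacobi operator $L=\Delta+|\bar\sigma|^2+\overline{\mathrm{Ric}}(N,N)$ of $\mathbb T$ is $L=\Delta+2$, where $\Delta$ is the Laplacian of $\mathbb T$. (d) $\mathbb T$ is a stable constant mean curvature surface for $\bar g$: $\int_{\mathbb T}|\nabla u|^2-(|\bar\sigma|^2+\overline{\mathrm{Ric}}(N,N))u^2\,dA\ge0$ for every $u\in C^\infty(\mathbb T)$ with $\int_{\mathbb T}u\,dA=0$. (e) $\mathbb T$ has index one as a minimal surface for $\bar g$: counted with multiplicity, there is exactly one negative $\mu$ for which $Lu+\mu u=0$ has a smooth solution $u\ne0$ on $\mathbb T$. In particular, for $0<r<r_0$ one gets metrics on $\mathbb S^3$, conformal to the round metric and of nonnegative Ricci curvature, which admit an embedded minimal torus that is stable as a CMC surface and has index one as a minimal surface. -/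

import Mathlib

open scoped Manifold ContDiff

noncomputable section

namespace StableTori

/-! ### Riemannian geometry in coordinates

A metric on an open part of `ℝⁿ` is given by its matrix of coefficients `G`. -/

/-- The model space `ℝⁿ`. -/
abbrev Eucl (n : ℕ) : Type := EuclideanSpace ℝ (Fin n)

/-- The `i`-th vector of the standard basis of `ℝⁿ`. -/
def stdVec {n : ℕ} (i : Fin n) : Eucl n := EuclideanSpace.single i 1

/-- The partial derivative `∂ᵢ f` at `y`. -/
def pderiv {n : ℕ} (i : Fin n) (f : Eucl n → ℝ) (y : Eucl n) : ℝ :=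
  fderiv ℝ f y (stdVec i)

/-- The Christoffel symbol `Γᵏᵢⱼ = ½ ∑ₗ Gᵏˡ (∂ᵢ Gⱼₗ + ∂ⱼ Gᵢₗ - ∂ₗ Gᵢⱼ)`. -/
def christoffel {n : ℕ} (G : Eucl n → Matrix (Fin n) (Fin n) ℝ) (k i j : Fin n)
    (y : Eucl n) : ℝ :=
  (1 / 2) * ∑ l, (G y)⁻¹ k l *
    (pderiv i (fun z => G z j l) y + pderiv j (fun z => G z i l) y
      - pderiv l (fun z => G z i j) y)

/-- The coefficient
`Ricᵢⱼ = ∑ₖ (∂ₖ Γᵏᵢⱼ - ∂ⱼ Γᵏᵢₖ) + ∑ₖₗ (Γᵏₖₗ Γˡᵢⱼ - Γᵏⱼₗ Γˡᵢₖ)` of the Ricci tensor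
(with the sign for which round spheres have positive Ricci curvature). -/
def ricciCoeff {n : ℕ} (G : Eucl n → Matrix (Fin n) (Fin n) ℝ) (i j : Fin n)
    (y : Eucl n) : ℝ :=
  (∑ k, (pderiv k (christoffel G k i j) y - pderiv j (christoffel G k i k) y))
    + ∑ k, ∑ l, (christoffel G k k l y * christoffel G l i j y
      - christoffel G k j l y * christoffel G l i k y)

/-- The pairing `⟨∇u, ∇v⟩ = ∑ᵢⱼ Gⁱʲ ∂ᵢu ∂ⱼv` of the gradients of two functions. -/
def gradInner {n : ℕ} (G : Eucl n → Matrix (Fin n) (Fin n) ℝ) (u v : Eucl n → ℝ)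
    (x : Eucl n) : ℝ :=
  ∑ i, ∑ j, (G x)⁻¹ i j * pderiv i u x * pderiv j v x

/-- The Laplace-Beltrami operator
`Δu = (det G)^(-1/2) ∑ᵢⱼ ∂ᵢ ((det G)^(1/2) Gⁱʲ ∂ⱼ u)`. -/
def laplaceBeltrami {n : ℕ} (G : Eucl n → Matrix (Fin n) (Fin n) ℝ) (u : Eucl n → ℝ)
    (x : Eucl n) : ℝ :=
  (Real.sqrt (G x).det)⁻¹ *
    ∑ i, ∑ j, pderiv i (fun z => Real.sqrt (G z).det * (G z)⁻¹ i j * pderiv j u z) x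

/-! ### Riemannian manifolds -/

/-- Smooth Riemannian metrics on an `n`-manifold `M`. -/
abbrev RiemMetric (n : ℕ) (M : Type*) [TopologicalSpace M] [ChartedSpace (Eucl n) M]
    [IsManifold (𝓡 n) ∞ M] :=
  Bundle.ContMDiffRiemannianMetric (𝓡 n) ∞ (Eucl n) (fun p : M => TangentSpace (𝓡 n) p)

section Manifold

variable {n : ℕ} {M : Type*} [TopologicalSpace M] [ChartedSpace (Eucl n) M]
  [IsManifold (𝓡 n) ∞ M]

/-- The matrix of the metric in the preferred chart at `p`, as a function on the chart's
target: `Gᵢⱼ(y) = g(∂ᵢ, ∂ⱼ)` at the point with coordinates `y`. -/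
def chartMetric (g : RiemMetric n M) (p : M) (y : Eucl n) : Matrix (Fin n) (Fin n) ℝ :=
  Matrix.of fun i j =>
    g.inner ((extChartAt (𝓡 n) p).symm y)
      (mfderiv 𝓘(ℝ, Eucl n) (𝓡 n) (extChartAt (𝓡 n) p).symm y (stdVec i))
      (mfderiv 𝓘(ℝ, Eucl n) (𝓡 n) (extChartAt (𝓡 n) p).symm y (stdVec j))

/-- The components, in the preferred chart at `p`, of a vector tangent to `M` at `p`. -/
def chartVec (p : M) (v : TangentSpace (𝓡 n) p) : Eucl n :=
  mfderiv (𝓡 n) 𝓘(ℝ, Eucl n) (extChartAt (𝓡 n) p) p v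

/-- The Ricci tensor `Ric(v, w)` of the metric `g` at `p`. -/
def ricci (g : RiemMetric n M) (p : M) (v w : TangentSpace (𝓡 n) p) : ℝ :=
  ∑ i, ∑ j, ricciCoeff (chartMetric g p) i j (extChartAt (𝓡 n) p p)
    * chartVec p v i * chartVec p w j

/-! ### Immersed tori

A torus in `M` is given by an immersion `X : ℝ² → M` which is periodic with period `P i`
in the `i`-th variable, so that it descends to the torus `ℝ² / (P₀ ℤ × P₁ ℤ)`. Smooth functions
on the torus are smooth periodic functions on `ℝ²`. -/

/-- Invariance under the lattice `P₀ ℤ × P₁ ℤ`. -/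
def IsDoublyPeriodic {α : Type*} (P : Fin 2 → ℝ) (u : Eucl 2 → α) : Prop :=
  ∀ (x : Eucl 2) (i : Fin 2), u (x + P i • stdVec i) = u x

/-- Smooth functions on the torus `ℝ² / (P₀ ℤ × P₁ ℤ)`. -/
def IsTorusFunction (P : Fin 2 → ℝ) (u : Eucl 2 → ℝ) : Prop :=
  ContDiff ℝ ∞ u ∧ IsDoublyPeriodic P u

/-- `X` induces an immersion of the torus `ℝ² / (P₀ ℤ × P₁ ℤ)` into `M`. -/
structure IsImmersedTorus (P : Fin 2 → ℝ) (X : Eucl 2 → M) : Prop where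
  periods_pos : ∀ i, 0 < P i
  smooth : ContMDiff 𝓘(ℝ, Eucl 2) (𝓡 n) ∞ X
  periodic : IsDoublyPeriodic P X
  immersion : ∀ x, Function.Injective (mfderiv 𝓘(ℝ, Eucl 2) (𝓡 n) X x)

/-- `N` is a smooth unit normal field along the immersed torus `X`. -/
structure IsUnitNormal (g : RiemMetric n M) (P : Fin 2 → ℝ) (X : Eucl 2 → M)
    (N : ∀ x, TangentSpace (𝓡 n) (X x)) : Prop where
  smooth : ContMDiff 𝓘(ℝ, Eucl 2) (𝓡 n).tangent ∞
    (fun x => (⟨X x, N x⟩ : TangentBundle (𝓡 n) M))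
  periodic : IsDoublyPeriodic P (fun x => (⟨X x, N x⟩ : TangentBundle (𝓡 n) M))
  unit : ∀ x, g.inner (X x) (N x) (N x) = 1
  normal : ∀ x v, g.inner (X x) (N x) (mfderiv 𝓘(ℝ, Eucl 2) (𝓡 n) X x v) = 0

/-- The matrix of the metric induced on the surface. -/
def inducedMetric (g : RiemMetric n M) (X : Eucl 2 → M) (x : Eucl 2) :
    Matrix (Fin 2) (Fin 2) ℝ :=
  Matrix.of fun i j =>
    g.inner (X x) (mfderiv 𝓘(ℝ, Eucl 2) (𝓡 n) X x (stdVec i))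
      (mfderiv 𝓘(ℝ, Eucl 2) (𝓡 n) X x (stdVec j))

/-- The second fundamental form `σᵢⱼ = ⟨∇_{∂ᵢ} (∂ⱼ X), N⟩`. With `ξ` the map `X` read in the
preferred chart at `X x`, the vector `∇_{∂ᵢ} (∂ⱼ X)` has components
`∂ᵢ ∂ⱼ ξᵏ + ∑ Γᵏ_ab ∂ᵢ ξᵃ ∂ⱼ ξᵇ`. -/
def secondFundamentalForm (g : RiemMetric n M) (X : Eucl 2 → M)
    (N : ∀ x, TangentSpace (𝓡 n) (X x)) (x : Eucl 2) : Matrix (Fin 2) (Fin 2) ℝ :=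
  let ξ : Fin n → Eucl 2 → ℝ := fun k z => extChartAt (𝓡 n) (X x) (X z) k
  let G := chartMetric g (X x)
  let y := extChartAt (𝓡 n) (X x) (X x)
  Matrix.of fun i j =>
    ∑ k, ∑ l, G y k l *
      (pderiv i (pderiv j (ξ k)) x
        + ∑ a, ∑ b, christoffel G k a b y * pderiv i (ξ a) x * pderiv j (ξ b) x)
      * chartVec (X x) (N x) l

/-- The mean curvature `H`, half the trace of the second fundamental form. -/
def meanCurvature (g : RiemMetric n M) (X : Eucl 2 → M)
    (N : ∀ x, TangentSpace (𝓡 n) (X x)) (x : Eucl 2) : ℝ :=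
  (1 / 2) * ∑ i, ∑ j,
    (inducedMetric g X x)⁻¹ i j * secondFundamentalForm g X N x i j

/-- The squared norm `|σ|²` of the second fundamental form. -/
def normSqSecondFF (g : RiemMetric n M) (X : Eucl 2 → M)
    (N : ∀ x, TangentSpace (𝓡 n) (X x)) (x : Eucl 2) : ℝ :=
  ∑ i, ∑ j, ∑ a, ∑ b, (inducedMetric g X x)⁻¹ i a * (inducedMetric g X x)⁻¹ j b
    * secondFundamentalForm g X N x i j * secondFundamentalForm g X N x a b

/-- The integral `∫ f dA` over the torus, with respect to the area element of the induced
metric: integrate over a period cell. -/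
def surfaceIntegral (g : RiemMetric n M) (P : Fin 2 → ℝ) (X : Eucl 2 → M)
    (f : Eucl 2 → ℝ) : ℝ :=
  ∫ x in {x : Eucl 2 | ∀ i, x i ∈ Set.Ico 0 (P i)}, f x * Real.sqrt (inducedMetric g X x).det

/-- The potential `|σ|² + Ric(N)`. -/
def jacobiPotential (g : RiemMetric n M) (X : Eucl 2 → M)
    (N : ∀ x, TangentSpace (𝓡 n) (X x)) (x : Eucl 2) : ℝ :=
  normSqSecondFF g X N x + ricci g (X x) (N x) (N x)

/-- The Jacobi operator `L u = Δu + (|σ|² + Ric(N)) u`. -/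
def jacobiOperator (g : RiemMetric n M) (X : Eucl 2 → M)
    (N : ∀ x, TangentSpace (𝓡 n) (X x)) (u : Eucl 2 → ℝ) (x : Eucl 2) : ℝ :=
  laplaceBeltrami (inducedMetric g X) u x + jacobiPotential g X N x * u x

/-- The quadratic form `Q(u, v) = ∫ ⟨∇u, ∇v⟩ - (|σ|² + Ric(N)) u v dA`. -/
def indexForm (g : RiemMetric n M) (P : Fin 2 → ℝ) (X : Eucl 2 → M)
    (N : ∀ x, TangentSpace (𝓡 n) (X x)) (u v : Eucl 2 → ℝ) : ℝ :=
  surfaceIntegral g P X fun x =>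
    gradInner (inducedMetric g X) u v x - jacobiPotential g X N x * u x * v x

/-- The surface is minimal. -/
def IsMinimal (g : RiemMetric n M) (X : Eucl 2 → M) (N : ∀ x, TangentSpace (𝓡 n) (X x)) : Prop :=
  ∀ x, meanCurvature g X N x = 0

/-- The surface is a stable CMC surface: its mean curvature is constant, and `Q(u, u) ≥ 0` for
every smooth function `u` on the surface with mean value zero. -/
def IsStableCMC (g : RiemMetric n M) (P : Fin 2 → ℝ) (X : Eucl 2 → M)
    (N : ∀ x, TangentSpace (𝓡 n) (X x)) : Prop :=
  (∃ H : ℝ, ∀ x, meanCurvature g X N x = H) ∧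
    ∀ u, IsTorusFunction P u → surfaceIntegral g P X u = 0 → 0 ≤ indexForm g P X N u u

/-- The index: the number of negative eigenvalues `μ` of the Jacobi operator, counted with
multiplicity, where `μ` is an eigenvalue when `L u + μ u = 0` for some smooth `u ≠ 0`. As
eigenspaces of distinct eigenvalues are independent, it is the dimension of their span. -/
def index (g : RiemMetric n M) (P : Fin 2 → ℝ) (X : Eucl 2 → M)
    (N : ∀ x, TangentSpace (𝓡 n) (X x)) : Cardinal :=
  Module.rank ℝ (Submodule.span ℝ {u : Eucl 2 → ℝ | IsTorusFunction P u ∧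
    ∃ μ : ℝ, μ < 0 ∧ ∀ x, jacobiOperator g X N u x + μ * u x = 0})

end Manifold

/-! ### The Clifford torus in the three-sphere -/

/-- The unit sphere of `ℝ⁴ = ℂ²`. -/
abbrev S3 : Type := Metric.sphere (0 : Eucl 4) 1

/-- `g` is the round metric, induced by the inclusion of the sphere in `ℝ⁴`. -/
def IsRound (g : RiemMetric 3 S3) : Prop :=
  ∀ (p : S3) (v w : TangentSpace (𝓡 3) p),
    g.inner p v w =
      @inner ℝ (Eucl 4) _ (mfderiv (𝓡 3) 𝓘(ℝ, Eucl 4) (fun q : S3 => (q : Eucl 4)) p v)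
        (mfderiv (𝓡 3) 𝓘(ℝ, Eucl 4) (fun q : S3 => (q : Eucl 4)) p w)

/-- The point `sin (t + π/4) (cos √2θ, sin √2θ, 0, 0) + cos (t + π/4) (0, 0, cos √2φ, sin √2φ)`
of the sphere, where `x = (θ, φ)`. -/
def torusCoord (x : Eucl 2) (t : ℝ) : S3 :=
  ⟨!₂[Real.sin (t + Real.pi / 4) * Real.cos (Real.sqrt 2 * x 0),
      Real.sin (t + Real.pi / 4) * Real.sin (Real.sqrt 2 * x 0),
      Real.cos (t + Real.pi / 4) * Real.cos (Real.sqrt 2 * x 1),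
      Real.cos (t + Real.pi / 4) * Real.sin (Real.sqrt 2 * x 1)], by
    rw [mem_sphere_zero_iff_norm, EuclideanSpace.norm_eq, Real.sqrt_eq_one]
    simp only [Fin.sum_univ_four, Real.norm_eq_abs, sq_abs]
    simp only [Fin.isValue, Matrix.cons_val]
    nlinarith [Real.sin_sq_add_cos_sq (t + Real.pi / 4),
      Real.sin_sq_add_cos_sq (Real.sqrt 2 * x 0), Real.sin_sq_add_cos_sq (Real.sqrt 2 * x 1)]⟩

/-- The Clifford torus `{|z₁|² = |z₂|² = 1/2}`. -/
def cliffordTorus : Set S3 :=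
  {p | (p : Eucl 4) 0 ^ 2 + (p : Eucl 4) 1 ^ 2 = 1 / 2 ∧
    (p : Eucl 4) 2 ^ 2 + (p : Eucl 4) 3 ^ 2 = 1 / 2}

/-- The parametrization of the Clifford torus. -/
def cliffordMap (x : Eucl 2) : S3 := torusCoord x 0

/-- The periods of `cliffordMap`. -/
def cliffordPeriods : Fin 2 → ℝ := fun _ => Real.sqrt 2 * Real.pi

/-- The normal field `∂/∂t` at `t = 0` along the Clifford torus. -/
def cliffordNormal (x : Eucl 2) : TangentSpace (𝓡 3) (cliffordMap x) :=
  mfderiv 𝓘(ℝ, ℝ) (𝓡 3) (torusCoord x) 0 (1 : ℝ)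

/-- The signed distance to the Clifford torus, `arcsin |z₁| - π/4`. -/
def signedDist (p : S3) : ℝ :=
  Real.arcsin (Real.sqrt ((p : Eucl 4) 0 ^ 2 + (p : Eucl 4) 1 ^ 2)) - Real.pi / 4

/-- The conditions on the profile `ζ : (-π/4, π/4) → ℝ`; values outside this interval are
irrelevant. -/
structure IsProfile (r : ℝ) (ζ : ℝ → ℝ) : Prop where
  smooth : ContDiffOn ℝ ∞ ζ (Set.Ioo (-(Real.pi / 4)) (Real.pi / 4))
  even : ∀ t ∈ Set.Ioo (-(Real.pi / 4)) (Real.pi / 4), ζ (-t) = ζ t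
  zero : ζ 0 = 1
  decreasing : AntitoneOn ζ (Set.Ioo 0 r)
  vanish : ζ r = 0
  neg : ∀ t ∈ Set.Ioo r (2 * r), ζ t < 0
  support : ∀ t ∈ Set.Ico (2 * r) (Real.pi / 4), ζ t = 0
  mean : ∫ s in (0 : ℝ)..(2 * r), ζ s = 0

/-- `φ(t) = ∫₀ᵗ (∫₀ˢ ζ(x) dx) ds`. -/
def conformalExponent (ζ : ℝ → ℝ) (t : ℝ) : ℝ :=
  ∫ s in (0 : ℝ)..t, ∫ x in (0 : ℝ)..s, ζ x

end StableTori

end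

/-! Everything is expressed through the quadratic form h = |z₁|² - |z₂|² (`cliffordForm`) instead of
the distance t. On the sphere h = sin 2t, so φ(t) = Ψ(h) with Ψ(k) = φ(arcsin k / 2). Since φ is
constant for |t| ≥ 2r and 2r < π/4, Ψ is smooth on the whole line, including near h = ±1, where t
itself is not smooth. Hence e^{2φ(t)} g is a smooth metric.

Ricci curvature: each point p is the centre of its own stereographic chart, in which the metric is
e^{2ψ}|dy|². The conformal change formula over flat space (`ricciCoeff_conformalMatrix`) needs only
the first and second derivatives of ψ at the origin, and these are explicit because h is quadratic.
The result is `ricci_stereo`. Split a tangent vector into its part along the gradient of h and the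
rest τ, tangent to the level sets of t. The Ricci form has no cross terms (`ricciForm_eq`): the
normal coefficient is 2 - 2φ'' + 2 tan(2t) φ', and the tangential part is (2 - φ'' + 3 tan(2t) φ' -
φ'²)|τ|² up to an error of at most 2|Ψ'||τ|². As φ'' = ζ ≤ 1, |φ'| ≤ r and tφ' ≥ 0, the tangential
part is positive for small r. The normal coefficient vanishes at t = 0, where ζ = 1 and φ' = 0, and
is positive elsewhere: tan(2t) φ' > 0 for 0 < |t| < 2r, and ζ = φ' = 0 beyond
(`profileRicci_lower_bound`).

Along the torus φ = φ' = 0, so the induced metric, the normal and the second fundamental form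
diag(-1, 1) are those of the round metric, while φ''(0) = 1 reduces Ric(N, N) from 2 to 0. The
potential of the Jacobi operator therefore drops from 4 to 2. The torus is a flat square of side L =
√2 π, and its first nonzero Laplace eigenvalue is (2π/L)² = 2, exactly this potential. Stability on
functions of mean zero is the Poincaré inequality `cellIntegral_sq_le`, proved from the
one-dimensional Wirtinger inequality, and only the constants have a negative Jacobi eigenvalue
(`eigenfunction_const`). -/

noncomputable section

namespace StableTori

/-! ### Conformally flat metrics -/

section ConformallyFlat

variable {n : ℕ}

lemma pderiv_eq_of_hasFDerivAt {f : Eucl n → ℝ} {f' : Eucl n →L[ℝ] ℝ} {y : Eucl n}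
    (h : HasFDerivAt f f' y) (i : Fin n) : pderiv i f y = f' (stdVec i) := by
  rw [pderiv, h.fderiv]

lemma pderiv_add {f g : Eucl n → ℝ} {y : Eucl n} (hf : DifferentiableAt ℝ f y)
    (hg : DifferentiableAt ℝ g y) (i : Fin n) :
    pderiv i (fun z => f z + g z) y = pderiv i f y + pderiv i g y := by
  have h : HasFDerivAt (fun z => f z + g z) _ y := hf.hasFDerivAt.add hg.hasFDerivAt
  rw [pderiv_eq_of_hasFDerivAt h]
  rfl

lemma pderiv_sub {f g : Eucl n → ℝ} {y : Eucl n} (hf : DifferentiableAt ℝ f y)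
    (hg : DifferentiableAt ℝ g y) (i : Fin n) :
    pderiv i (fun z => f z - g z) y = pderiv i f y - pderiv i g y := by
  have h : HasFDerivAt (fun z => f z - g z) _ y := hf.hasFDerivAt.sub hg.hasFDerivAt
  rw [pderiv_eq_of_hasFDerivAt h]
  rfl

lemma pderiv_mul {f g : Eucl n → ℝ} {y : Eucl n} (hf : DifferentiableAt ℝ f y)
    (hg : DifferentiableAt ℝ g y) (i : Fin n) :
    pderiv i (fun z => f z * g z) y = f y * pderiv i g y + g y * pderiv i f y := by
  have h : HasFDerivAt (fun z => f z * g z) _ y := hf.hasFDerivAt.mul hg.hasFDerivAt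
  rw [pderiv_eq_of_hasFDerivAt h]
  rfl

lemma pderiv_mul_const {f : Eucl n → ℝ} {y : Eucl n} (hf : DifferentiableAt ℝ f y)
    (c : ℝ) (i : Fin n) :
    pderiv i (fun z => f z * c) y = pderiv i f y * c := by
  rw [pderiv_eq_of_hasFDerivAt (hf.hasFDerivAt.mul_const c)]
  simp [pderiv, mul_comm]

@[simp] lemma pderiv_const (c : ℝ) (y : Eucl n) (i : Fin n) :
    pderiv i (fun _ => c) y = 0 := by
  simp [pderiv]

lemma differentiableAt_of_contDiff {E : Type*} [NormedAddCommGroup E] [NormedSpace ℝ E]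
    {f : Eucl n → E} (hf : ContDiff ℝ ∞ f) (y : Eucl n) :
    DifferentiableAt ℝ f y :=
  (hf.differentiable (by simp)).differentiableAt

lemma contDiff_pderiv {f : Eucl n → ℝ} (hf : ContDiff ℝ ∞ f) (i : Fin n) :
    ContDiff ℝ ∞ (pderiv i f) :=
  (hf.fderiv_right (m := ∞) (by simp)).clm_apply contDiff_const

lemma pderiv_pderiv_eq {f : Eucl n → ℝ} (hf : ContDiff ℝ ∞ f) (i j : Fin n) (y : Eucl n) :
    pderiv i (pderiv j f) y = fderiv ℝ (fderiv ℝ f) y (stdVec i) (stdVec j) := by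
  have h : DifferentiableAt ℝ (fderiv ℝ f) y :=
    differentiableAt_of_contDiff (hf.fderiv_right (m := ∞) (by simp)) y
  rw [pderiv_eq_of_hasFDerivAt (f := pderiv j f) (h.hasFDerivAt.clm_apply (hasFDerivAt_const _ _))]
  simp

lemma pderiv_comm {f : Eucl n → ℝ} (hf : ContDiff ℝ ∞ f) (i j : Fin n) (y : Eucl n) :
    pderiv i (pderiv j f) y = pderiv j (pderiv i f) y := by
  rw [pderiv_pderiv_eq hf, pderiv_pderiv_eq hf]
  exact second_derivative_symmetric (f := f) (f' := fderiv ℝ f)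
    (fun z => (differentiableAt_of_contDiff hf z).hasFDerivAt)
    (differentiableAt_of_contDiff (hf.fderiv_right (m := ∞) (by simp)) y).hasFDerivAt _ _

lemma pderiv_exp {f : Eucl n → ℝ} {y : Eucl n} (hf : DifferentiableAt ℝ f y) (i : Fin n) :
    pderiv i (fun z => Real.exp (2 * f z)) y = Real.exp (2 * f y) * (2 * pderiv i f y) := by
  rw [pderiv_eq_of_hasFDerivAt (hf.hasFDerivAt.const_mul 2).exp]
  simp [pderiv]

lemma pderiv_exp_mul {f : Eucl n → ℝ} {y : Eucl n} (hf : DifferentiableAt ℝ f y) (i : Fin n)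
    (c : ℝ) :
    pderiv i (fun z => Real.exp (2 * f z) * c) y = Real.exp (2 * f y) * (2 * pderiv i f y) * c := by
  rw [pderiv_mul_const (by fun_prop), pderiv_exp hf]

/-- The matrix of the conformally flat metric `e^{2ψ} |dy|²`. -/
def conformalMatrix (ψ : Eucl n → ℝ) (y : Eucl n) : Matrix (Fin n) (Fin n) ℝ :=
  Real.exp (2 * ψ y) • 1

lemma christoffel_conformalMatrix {ψ : Eucl n → ℝ} (hψ : ContDiff ℝ ∞ ψ) (k i j : Fin n)
    (y : Eucl n) :
    christoffel (conformalMatrix ψ) k i j y =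
      pderiv i ψ y * (if k = j then 1 else 0) + pderiv j ψ y * (if k = i then 1 else 0)
        - pderiv k ψ y * (if i = j then 1 else 0) := by
  have hd : DifferentiableAt ℝ ψ y := differentiableAt_of_contDiff hψ y
  have hinv : (conformalMatrix ψ y)⁻¹ = Real.exp (-(2 * ψ y)) • 1 := by
    apply Matrix.inv_eq_right_inv
    simp [conformalMatrix, smul_smul, ← Real.exp_add]
  have he : Real.exp (-(2 * ψ y)) * Real.exp (2 * ψ y) = 1 := by
    rw [← Real.exp_add]; simp
  have hG : ∀ l i j, pderiv l (fun z => conformalMatrix ψ z i j) y =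
      Real.exp (2 * ψ y) * (2 * pderiv l ψ y) * (if i = j then 1 else 0) := fun l i j => by
    rw [← pderiv_exp_mul hd]
    simp [conformalMatrix, Matrix.one_apply]
  simp only [christoffel, hinv, hG, Matrix.smul_apply, smul_eq_mul, Matrix.one_apply,
    mul_ite, mul_one, mul_zero, ite_mul, zero_mul, Finset.sum_ite_eq, Finset.mem_univ, if_true]
  rcases eq_or_ne k j with rfl | hkj
  · rcases eq_or_ne k i with rfl | hki
    · simp
      linear_combination (pderiv k ψ y) * he
    · simp [hki, hki.symm]
      linear_combination (pderiv i ψ y) * he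
  · rcases eq_or_ne k i with rfl | hki
    · simp [hkj, hkj.symm]
      linear_combination (pderiv j ψ y) * he
    · rcases eq_or_ne i j with rfl | hij
      · simp [hki, hki.symm]
        linear_combination (pderiv k ψ y) * he
      · simp [hki, hkj, hki.symm, hkj.symm, hij]

/-- The conformal change formula -(n-2)(∇²ψ - dψ⊗dψ) - (Δψ + (n-2)|dψ|²)δ over flat space, at n = 3.
Apart from algebra only the symmetry of second partial derivatives enters, so the nine index pairs
can be checked one by one. -/
lemma ricciCoeff_conformalMatrix {ψ : Eucl 3 → ℝ} (hψ : ContDiff ℝ ∞ ψ) (i j : Fin 3)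
    (y : Eucl 3) :
    ricciCoeff (conformalMatrix ψ) i j y =
      -(pderiv i (pderiv j ψ) y - pderiv i ψ y * pderiv j ψ y)
        - (∑ k, pderiv k (pderiv k ψ) y + ∑ k, pderiv k ψ y ^ 2) * (if i = j then 1 else 0) := by
  have hd : ∀ k, DifferentiableAt ℝ (pderiv k ψ) y := fun k =>
    differentiableAt_of_contDiff (contDiff_pderiv hψ k) y
  have hΓ : ∀ l k i j : Fin 3, pderiv l (christoffel (conformalMatrix ψ) k i j) y =
      pderiv l (pderiv i ψ) y * (if k = j then 1 else 0)
        + pderiv l (pderiv j ψ) y * (if k = i then 1 else 0)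
        - pderiv l (pderiv k ψ) y * (if i = j then 1 else 0) := by
    intro l k i j
    rw [show christoffel (conformalMatrix ψ) k i j = _ from
      funext (christoffel_conformalMatrix hψ k i j)]
    rw [pderiv_sub (by fun_prop) (by fun_prop), pderiv_add (by fun_prop) (by fun_prop),
      pderiv_mul_const (hd _), pderiv_mul_const (hd _), pderiv_mul_const (hd _)]
  have h01 := pderiv_comm hψ 0 1 y
  have h02 := pderiv_comm hψ 0 2 y
  have h12 := pderiv_comm hψ 1 2 y
  simp only [ricciCoeff, hΓ, christoffel_conformalMatrix hψ, Fin.sum_univ_three]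
  fin_cases i <;> fin_cases j <;> simp [h01, h02, h12] <;> ring

end ConformallyFlat

end StableTori

end

noncomputable section

namespace StableTori

/-! ### Inverse stereographic projection and the quadratic form `|z₁|² - |z₂|²` -/

lemma inner_stdVec_right {n : ℕ} (y : Eucl n) (i : Fin n) : inner ℝ y (stdVec i) = y i := by
  simp [stdVec, EuclideanSpace.inner_single_right]

lemma inner_stdVec_stdVec {n : ℕ} (i j : Fin n) :
    inner ℝ (stdVec i : Eucl n) (stdVec j) = if i = j then 1 else 0 := by
  rw [inner_stdVec_right]
  simp [stdVec, eq_comm]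

/-- The linear map `(z₁, z₂) ↦ (z₁, -z₂)` of `ℝ⁴ = ℂ²`. -/
def flipSnd : Eucl 4 →L[ℝ] Eucl 4 :=
  LinearMap.toContinuousLinearMap
    { toFun := fun v => !₂[v 0, v 1, -v 2, -v 3]
      map_add' := fun v w => by
        ext i; fin_cases i <;> simp <;> ring
      map_smul' := fun c v => by
        ext i; fin_cases i <;> simp }

lemma flipSnd_apply (v : Eucl 4) : flipSnd v = !₂[v 0, v 1, -v 2, -v 3] := rfl

lemma flipSnd_flipSnd (v : Eucl 4) : flipSnd (flipSnd v) = v := by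
  ext i; fin_cases i <;> simp [flipSnd_apply]

lemma inner_eucl4 (v w : Eucl 4) :
    inner ℝ v w = v 0 * w 0 + v 1 * w 1 + v 2 * w 2 + v 3 * w 3 := by
  simp [PiLp.inner_apply, Fin.sum_univ_four]; ring

lemma inner_flipSnd (v w : Eucl 4) :
    inner ℝ (flipSnd v) w = v 0 * w 0 + v 1 * w 1 - v 2 * w 2 - v 3 * w 3 := by
  rw [inner_eucl4]; simp [flipSnd_apply]; ring

lemma inner_flipSnd_left (v w : Eucl 4) :
    inner ℝ (flipSnd v) w = inner ℝ v (flipSnd w) := by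
  rw [real_inner_comm _ v, inner_flipSnd, inner_flipSnd]; ring

/-- The quadratic form `|z₁|² - |z₂|²`. -/
def cliffordForm (v : Eucl 4) : ℝ := inner ℝ (flipSnd v) v

lemma contDiff_cliffordForm : ContDiff ℝ ∞ cliffordForm :=
  flipSnd.contDiff.inner ℝ contDiff_id

/-- Inverse stereographic projection from `-p`, where `J` identifies `ℝ³` with the orthogonal
complement of `p`. -/
def invStereo (J : Eucl 3 →ₗᵢ[ℝ] Eucl 4) (p : Eucl 4) (y : Eucl 3) : Eucl 4 :=
  (‖y‖ ^ 2 + 4)⁻¹ • ((4 : ℝ) • J y + (4 - ‖y‖ ^ 2) • p)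

/-- The derivative of `invStereo` at `y` in direction `a`. -/
def invStereoDeriv (J : Eucl 3 →ₗᵢ[ℝ] Eucl 4) (p : Eucl 4) (y a : Eucl 3) : Eucl 4 :=
  (‖y‖ ^ 2 + 4)⁻¹ • ((4 : ℝ) • J a - (2 * inner ℝ y a) • p)
    - (2 * inner ℝ y a * ((‖y‖ ^ 2 + 4)⁻¹) ^ 2) • ((4 : ℝ) • J y + (4 - ‖y‖ ^ 2) • p)

section

variable {J : Eucl 3 →ₗᵢ[ℝ] Eucl 4} {p : Eucl 4}

@[simp] lemma invStereo_zero : invStereo J p 0 = p := by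
  simp [invStereo, smul_smul]

@[simp] lemma invStereoDeriv_zero (a : Eucl 3) : invStereoDeriv J p 0 a = J a := by
  simp [invStereoDeriv, smul_smul]

lemma hasFDerivAt_normSq (y : Eucl 3) :
    HasFDerivAt (fun z : Eucl 3 => ‖z‖ ^ 2) ((2 : ℝ) • innerSL ℝ y) y := by
  refine (hasStrictFDerivAt_norm_sq y).hasFDerivAt.congr_fderiv ?_
  ext1 a
  simp

lemma hasFDerivAt_inv_normSq (y : Eucl 3) :
    HasFDerivAt (fun z : Eucl 3 => (‖z‖ ^ 2 + 4)⁻¹)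
      (-(((‖y‖ ^ 2 + 4)⁻¹) ^ 2 • ((2 : ℝ) • innerSL ℝ y))) y := by
  have hy : ‖y‖ ^ 2 + 4 ≠ 0 := by positivity
  have h := (hasDerivAt_inv hy).comp_hasFDerivAt y ((hasFDerivAt_normSq y).add_const 4)
  refine HasFDerivAt.congr_fderiv (f := fun z : Eucl 3 => (‖z‖ ^ 2 + 4)⁻¹) h ?_
  ext1 a
  simp

lemma contDiff_invStereo : ContDiff ℝ ∞ (invStereo J p) := by
  have h : ContDiff ℝ ∞ (fun y : Eucl 3 => ‖y‖ ^ 2) := contDiff_norm_sq ℝ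
  have h2 : ContDiff ℝ ∞ J := J.contDiff
  have h3 : ContDiff ℝ ∞ (fun y : Eucl 3 => (‖y‖ ^ 2 + 4)⁻¹) :=
    (h.add contDiff_const).inv (fun y => by positivity)
  unfold invStereo
  fun_prop

lemma hasFDerivAt_invStereo (y : Eucl 3) :
    HasFDerivAt (invStereo J p) (fderiv ℝ (invStereo J p) y) y :=
  (differentiableAt_of_contDiff contDiff_invStereo y).hasFDerivAt

lemma fderiv_invStereo (y a : Eucl 3) :
    fderiv ℝ (invStereo J p) y a = invStereoDeriv J p y a := by
  have h1 : HasFDerivAt (fun z => (4 : ℝ) • J z) ((4 : ℝ) • J.toContinuousLinearMap) y :=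
    (J.toContinuousLinearMap.hasFDerivAt).const_smul (4 : ℝ)
  have h := (hasFDerivAt_inv_normSq y).smul
    (h1.add (((hasFDerivAt_normSq y).const_sub 4).smul_const p))
  have h' : HasFDerivAt (invStereo J p) _ y := h
  rw [h'.fderiv]
  simp only [invStereoDeriv, add_apply, smul_apply,
    ContinuousLinearMap.smulRight_apply, neg_apply, innerSL_apply_apply,
    Pi.add_apply, smul_eq_mul, LinearIsometry.coe_toContinuousLinearMap]
  module

/-- To second order at the origin, inverse stereographic projection is p + J y - ½|y|² p: its second
derivative -⟨a, b⟩ p points along p. This term makes the Hessian of h on the sphere differ from that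
of the quadratic form on ℝ⁴. -/
lemma hasFDerivAt_invStereoDeriv (a : Eucl 3) :
    HasFDerivAt (fun z => invStereoDeriv J p z a) (-((innerSL ℝ a).smulRight p)) 0 := by
  have hi : HasFDerivAt (fun z : Eucl 3 => 2 * inner ℝ z a) ((2 : ℝ) • innerSL ℝ a) 0 := by
    have : HasFDerivAt (fun z : Eucl 3 => inner ℝ a z) (innerSL ℝ a) 0 :=
      (innerSL ℝ a).hasFDerivAt
    simpa [real_inner_comm] using this.const_mul 2
  have h1 : HasFDerivAt (fun z => (4 : ℝ) • J z) ((4 : ℝ) • J.toContinuousLinearMap) 0 :=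
    (J.toContinuousLinearMap.hasFDerivAt).const_smul (4 : ℝ)
  have hv := h1.add (((hasFDerivAt_normSq (0 : Eucl 3)).const_sub 4).smul_const p)
  have hN := hasFDerivAt_inv_normSq 0
  have hA := hN.smul ((hi.smul_const p).const_sub ((4 : ℝ) • J a))
  have hB := (hi.mul (hN.pow 2)).smul hv
  have h : HasFDerivAt (fun z => invStereoDeriv J p z a) _ 0 := hA.sub hB
  refine h.congr_fderiv ?_
  ext1 b
  simp
  module

/-- Conformality of stereographic projection. It turns every metric conformal to the round one into
a conformally flat metric in the chart. -/
lemma inner_invStereoDeriv (hp : ‖p‖ = 1) (hJ : ∀ y, inner ℝ (J y) p = 0) (y a b : Eucl 3) :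
    inner ℝ (invStereoDeriv J p y a) (invStereoDeriv J p y b) =
      16 * ((‖y‖ ^ 2 + 4)⁻¹) ^ 2 * inner ℝ a b := by
  have hJ' : ∀ y, inner ℝ p (J y) = 0 := fun y => by rw [real_inner_comm, hJ]
  have hpp : inner ℝ p p = (1 : ℝ) := by simp [hp]
  have hN : (‖y‖ ^ 2 + 4)⁻¹ * (‖y‖ ^ 2 + 4) = 1 := inv_mul_cancel₀ (by positivity)
  simp only [invStereoDeriv, inner_sub_left, inner_sub_right, inner_add_left, inner_add_right,
    inner_smul_left, inner_smul_right, J.inner_map_map, hJ, hJ', hpp, real_inner_self_eq_norm_sq]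
  rw [real_inner_comm y a]
  simp only [conj_trivial]
  linear_combination (-8 * inner ℝ y a * inner ℝ y b * ((‖y‖ ^ 2 + 4)⁻¹) ^ 2
    + 4 * inner ℝ y a * inner ℝ y b * ((‖y‖ ^ 2 + 4)⁻¹) ^ 2 *
      ((‖y‖ ^ 2 + 4)⁻¹ * (‖y‖ ^ 2 + 4) + 1)) * hN

/-- The logarithm of the conformal factor of `e^{2Ψ(h)} g` in stereographic coordinates, where `g`
is the round metric and `h = |z₁|² - |z₂|²`. -/
def stereoExponent (J : Eucl 3 →ₗᵢ[ℝ] Eucl 4) (p : Eucl 4) (Ψ : ℝ → ℝ) (y : Eucl 3) : ℝ :=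
  Ψ (cliffordForm (invStereo J p y)) + Real.log 4 - Real.log (‖y‖ ^ 2 + 4)

variable {Ψ : ℝ → ℝ}

lemma exp_stereoExponent (y : Eucl 3) : Real.exp (2 * stereoExponent J p Ψ y) =
    Real.exp (2 * Ψ (cliffordForm (invStereo J p y))) * (16 * ((‖y‖ ^ 2 + 4)⁻¹) ^ 2) := by
  have h : 0 < ‖y‖ ^ 2 + 4 := by positivity
  rw [stereoExponent, show ∀ a b c : ℝ, 2 * (a + b - c) = 2 * a + (b + b) + (-c + -c) by
    intros; ring, Real.exp_add, Real.exp_add, Real.exp_add, Real.exp_add,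
    Real.exp_log (by norm_num), Real.exp_neg, Real.exp_log h]
  ring

lemma contDiff_stereoExponent (hΨ : ContDiff ℝ ∞ Ψ) : ContDiff ℝ ∞ (stereoExponent J p Ψ) := by
  have h : ContDiff ℝ ∞ (fun y : Eucl 3 => ‖y‖ ^ 2) := contDiff_norm_sq ℝ
  exact ((hΨ.comp (contDiff_cliffordForm.comp contDiff_invStereo)).add contDiff_const).sub
    ((h.add contDiff_const).log (fun y => by positivity))

lemma pderiv_stereoExponent (hΨ : ContDiff ℝ ∞ Ψ) (j : Fin 3) (y : Eucl 3) :
    pderiv j (stereoExponent J p Ψ) y =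
      deriv Ψ (cliffordForm (invStereo J p y)) *
        (2 * inner ℝ (flipSnd (invStereo J p y)) (invStereoDeriv J p y (stdVec j)))
      - (‖y‖ ^ 2 + 4)⁻¹ * (2 * inner ℝ y (stdVec j)) := by
  have hS := hasFDerivAt_invStereo (J := J) (p := p) y
  have h1 : HasFDerivAt (fun z => cliffordForm (invStereo J p z)) _ y :=
    (flipSnd.hasFDerivAt.comp y hS).inner ℝ hS
  have h2 := ((hΨ.differentiable (by simp)).differentiableAt
    (x := cliffordForm (invStereo J p y))).hasDerivAt.comp_hasFDerivAt y h1
  have h3 : HasFDerivAt (stereoExponent J p Ψ) _ y :=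
    (h2.add_const (Real.log 4)).sub
      (((hasFDerivAt_normSq y).add_const 4).log (by positivity))
  rw [pderiv_eq_of_hasFDerivAt h3]
  simp [fderiv_invStereo, fderivInnerCLM_apply, -mul_eq_mul_left_iff]
  rw [inner_flipSnd_left (invStereoDeriv J p y (stdVec j)), real_inner_comm (flipSnd _)]
  ring

lemma pderiv_stereoExponent_zero (hΨ : ContDiff ℝ ∞ Ψ) (j : Fin 3) :
    pderiv j (stereoExponent J p Ψ) 0 =
      deriv Ψ (cliffordForm p) * (2 * inner ℝ (flipSnd p) (J (stdVec j))) := by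
  simp [pderiv_stereoExponent hΨ]

/-- Three contributions: Ψ'' dh⊗dh, Ψ' times the Hessian of h (whose -2h(p)δ comes from the second
derivative -⟨a, b⟩ p of the chart), and -½δ from the round factor -log(|y|² + 4). -/
lemma pderiv_pderiv_stereoExponent_zero (hΨ : ContDiff ℝ ∞ Ψ) (i j : Fin 3) :
    pderiv i (pderiv j (stereoExponent J p Ψ)) 0 =
      deriv (deriv Ψ) (cliffordForm p) * (2 * inner ℝ (flipSnd p) (J (stdVec i)))
          * (2 * inner ℝ (flipSnd p) (J (stdVec j)))
        + deriv Ψ (cliffordForm p) * (2 * inner ℝ (flipSnd (J (stdVec i))) (J (stdVec j))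
          - 2 * cliffordForm p * (if i = j then 1 else 0))
        - 1 / 2 * (if i = j then 1 else 0) := by
  have hS := hasFDerivAt_invStereo (J := J) (p := p) 0
  have hSj := hasFDerivAt_invStereoDeriv (J := J) (p := p) (stdVec j)
  have h1 : HasFDerivAt (fun z => cliffordForm (invStereo J p z)) _ 0 :=
    (flipSnd.hasFDerivAt.comp 0 hS).inner ℝ hS
  have hΨ' : ContDiff ℝ ∞ (deriv Ψ) := (contDiff_infty_iff_deriv.1 hΨ).2
  have h2 := ((hΨ'.differentiable (by simp)).differentiableAt
    (x := cliffordForm (invStereo J p 0))).hasDerivAt.comp_hasFDerivAt 0 h1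
  have h3 := ((flipSnd.hasFDerivAt.comp 0 hS).inner ℝ hSj).const_mul (2 : ℝ)
  have h4 : HasFDerivAt (fun z : Eucl 3 => inner ℝ z (stdVec j)) (innerSL ℝ (stdVec j)) 0 := by
    simpa [real_inner_comm] using (innerSL ℝ (stdVec j : Eucl 3)).hasFDerivAt (x := 0)
  have h5 := (h2.mul h3).sub ((hasFDerivAt_inv_normSq 0).mul (h4.const_mul (2 : ℝ)))
  have h6 := h5.congr_of_eventuallyEq (f₁ := pderiv j (stereoExponent J p Ψ))
    (.of_eq (funext (pderiv_stereoExponent hΨ j)))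
  rw [pderiv_eq_of_hasFDerivAt h6]
  simp [fderiv_invStereo, fderivInnerCLM_apply, inner_stdVec_stdVec]
  rw [inner_flipSnd_left (J (stdVec i)) p, real_inner_comm (flipSnd p)]
  rcases eq_or_ne i j with rfl | hij
  · simp [cliffordForm]; ring
  · simp [hij, hij.symm]; ring

end

end StableTori

end

noncomputable section

namespace StableTori

/-! ### The Ricci tensor of `e^{2Ψ(h)} g` -/

section

variable {J : Eucl 3 →ₗᵢ[ℝ] Eucl 4} {p : Eucl 4} {Ψ : ℝ → ℝ}

lemma eq_sum_stdVec {n : ℕ} (a : Eucl n) : a = ∑ i, a i • stdVec i := by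
  have h := ((EuclideanSpace.basisFun (Fin n) ℝ).sum_repr a).symm
  simpa [stdVec] using h

lemma orthonormal_stereoFrame (hp : ‖p‖ = 1) (hJ : ∀ y, inner ℝ (J y) p = 0) :
    Orthonormal ℝ ![J (stdVec 0), J (stdVec 1), J (stdVec 2), p] := by
  have hJ' : ∀ y, inner ℝ p (J y) = 0 := fun y => by rw [real_inner_comm, hJ]
  have hpp : inner ℝ p p = (1 : ℝ) := by simp [hp]
  rw [orthonormal_iff_ite]
  intro i j
  fin_cases i <;> fin_cases j <;>
    simp [hJ, hJ', hpp, inner_stdVec_stdVec, -inner_self_eq_norm_sq_to_K]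

/-- The orthonormal basis of `ℝ⁴` formed by `p` and the image of the standard basis of `ℝ³`. -/
def stereoFrame (hp : ‖p‖ = 1) (hJ : ∀ y, inner ℝ (J y) p = 0) :
    OrthonormalBasis (Fin 4) ℝ (Eucl 4) :=
  (basisOfOrthonormalOfCardEqFinrank (orthonormal_stereoFrame hp hJ) (by simp)).toOrthonormalBasis
    (by simpa using orthonormal_stereoFrame hp hJ)

lemma coe_stereoFrame (hp : ‖p‖ = 1) (hJ : ∀ y, inner ℝ (J y) p = 0) :
    ⇑(stereoFrame hp hJ) = ![J (stdVec 0), J (stdVec 1), J (stdVec 2), p] := by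
  simp [stereoFrame]

lemma norm_flipSnd_sq (p : Eucl 4) : inner ℝ (flipSnd p) (flipSnd p) = inner ℝ p p := by
  rw [inner_flipSnd_left, flipSnd_flipSnd]

/-- `flipSnd p` is a unit vector whose component along p is h(p), so Parseval in `stereoFrame`
applies. In geometric terms, |∇h|² = 4(1 - h²). -/
lemma sum_inner_flipSnd_sq (hp : ‖p‖ = 1) (hJ : ∀ y, inner ℝ (J y) p = 0) :
    ∑ k, inner ℝ (flipSnd p) (J (stdVec k)) ^ 2 = 1 - cliffordForm p ^ 2 := by
  have h := (stereoFrame hp hJ).sum_inner_mul_inner (flipSnd p) (flipSnd p)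
  have hpp : inner ℝ p p = (1 : ℝ) := by simp [hp]
  rw [norm_flipSnd_sq, hpp, coe_stereoFrame, Fin.sum_univ_four] at h
  simp only [Matrix.cons_val, real_inner_comm (flipSnd p)] at h
  rw [Fin.sum_univ_three, cliffordForm]
  linarith

/-- `flipSnd` has trace zero, and its diagonal entry at p is h(p). This yields the Laplacian of h on
the sphere. -/
lemma sum_inner_flipSnd_self (hp : ‖p‖ = 1) (hJ : ∀ y, inner ℝ (J y) p = 0) :
    ∑ k, inner ℝ (flipSnd (J (stdVec k))) (J (stdVec k)) = -cliffordForm p := by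
  have h := LinearMap.trace_eq_sum_inner (flipSnd : Eucl 4 →ₗ[ℝ] Eucl 4) (stereoFrame hp hJ)
  have h0 := LinearMap.trace_eq_sum_inner (flipSnd : Eucl 4 →ₗ[ℝ] Eucl 4)
    (EuclideanSpace.basisFun (Fin 4) ℝ)
  rw [h0, coe_stereoFrame, Fin.sum_univ_four, Fin.sum_univ_four] at h
  simp only [Matrix.cons_val, ContinuousLinearMap.coe_coe, ← inner_flipSnd_left, inner_flipSnd] at h
  rw [Fin.sum_univ_three, cliffordForm]
  simp only [inner_flipSnd]
  simp at h
  linarith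

/-- The right side involves the frame only through the vector `J a` of ℝ⁴, so it becomes an
expression free of coordinates once `J a` is identified with a tangent vector at p. -/
lemma ricci_stereo (hp : ‖p‖ = 1) (hJ : ∀ y, inner ℝ (J y) p = 0) (hΨ : ContDiff ℝ ∞ Ψ)
    (a : Eucl 3) :
    ∑ i, ∑ j, ricciCoeff (conformalMatrix (stereoExponent J p Ψ)) i j 0 * a i * a j =
      2 * ‖J a‖ ^ 2
        + 4 * (deriv Ψ (cliffordForm p) ^ 2 - deriv (deriv Ψ) (cliffordForm p))
          * inner ℝ (flipSnd p) (J a) ^ 2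
        - 2 * deriv Ψ (cliffordForm p) * (cliffordForm (J a) - cliffordForm p * ‖J a‖ ^ 2)
        - (4 * (deriv (deriv Ψ) (cliffordForm p) + deriv Ψ (cliffordForm p) ^ 2)
            * (1 - cliffordForm p ^ 2) - 8 * cliffordForm p * deriv Ψ (cliffordForm p))
          * ‖J a‖ ^ 2 := by
  have hC := contDiff_stereoExponent (J := J) (p := p) hΨ
  have h1 := sum_inner_flipSnd_sq hp hJ
  have h2 := sum_inner_flipSnd_self hp hJ
  have hJa : J a = a 0 • J (stdVec 0) + a 1 • J (stdVec 1) + a 2 • J (stdVec 2) := by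
    conv_lhs => rw [eq_sum_stdVec a]
    simp [Fin.sum_univ_three]
  have hn : ‖J a‖ ^ 2 = a 0 ^ 2 + a 1 ^ 2 + a 2 ^ 2 := by
    rw [J.norm_map, EuclideanSpace.norm_sq_eq]; simp [Fin.sum_univ_three]
  have hb : inner ℝ (flipSnd p) (J a) = a 0 * inner ℝ (flipSnd p) (J (stdVec 0))
      + a 1 * inner ℝ (flipSnd p) (J (stdVec 1)) + a 2 * inner ℝ (flipSnd p) (J (stdVec 2)) := by
    rw [hJa]; simp [inner_add_right, inner_smul_right]
  have hs : ∀ i j, inner ℝ (flipSnd (J (stdVec i))) (J (stdVec j)) =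
      inner ℝ (flipSnd (J (stdVec j))) (J (stdVec i)) := fun i j => by
    rw [inner_flipSnd_left, real_inner_comm]
  have hq : cliffordForm (J a) = ∑ i, ∑ j,
      a i * a j * inner ℝ (flipSnd (J (stdVec i))) (J (stdVec j)) := by
    rw [cliffordForm, hJa]
    simp [inner_add_right, inner_smul_right, inner_add_left, inner_smul_left, Fin.sum_univ_three]
    ring
  have hL : ∑ k, pderiv k (pderiv k (stereoExponent J p Ψ)) 0 =
      4 * deriv (deriv Ψ) (cliffordForm p) * (1 - cliffordForm p ^ 2)
        - 8 * cliffordForm p * deriv Ψ (cliffordForm p) - 3 / 2 := by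
    simp only [pderiv_pderiv_stereoExponent_zero hΨ]
    rw [← h1]
    rw [Fin.sum_univ_three] at h2
    simp only [Fin.sum_univ_three, if_true]
    linear_combination 2 * deriv Ψ (cliffordForm p) * h2
  have hG : ∑ k, pderiv k (stereoExponent J p Ψ) 0 ^ 2 =
      4 * deriv Ψ (cliffordForm p) ^ 2 * (1 - cliffordForm p ^ 2) := by
    simp only [pderiv_stereoExponent_zero hΨ]
    rw [← h1]
    simp only [Fin.sum_univ_three]
    ring
  simp only [ricciCoeff_conformalMatrix hC, hL, hG]
  simp only [pderiv_stereoExponent_zero hΨ, pderiv_pderiv_stereoExponent_zero hΨ]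
  rw [hq, hb, hn]
  simp only [Fin.sum_univ_three]
  simp
  ring

end

end StableTori

end

noncomputable section

namespace StableTori

/-! ### Profiles -/

open intervalIntegral Set

/-- A profile which is defined and smooth on the whole line. -/
structure IsGlobalProfile (r : ℝ) (ζ : ℝ → ℝ) : Prop where
  smooth : ContDiff ℝ ∞ ζ
  even : ∀ t, ζ (-t) = ζ t
  zero : ζ 0 = 1
  decreasing : AntitoneOn ζ (Ioo 0 r)
  vanish : ζ r = 0
  neg : ∀ t ∈ Ioo r (2 * r), ζ t < 0
  support : ∀ t, 2 * r ≤ t → ζ t = 0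
  mean : ∫ s in (0 : ℝ)..(2 * r), ζ s = 0

lemma IsGlobalProfile.isProfile {r : ℝ} {ζ : ℝ → ℝ} (h : IsGlobalProfile r ζ) :
    IsProfile r ζ where
  smooth := h.smooth.contDiffOn
  even t _ := h.even t
  zero := h.zero
  decreasing := h.decreasing
  vanish := h.vanish
  neg := h.neg
  support t ht := h.support t ht.1
  mean := h.mean

lemma uIcc_zero_subset {a s : ℝ} (hs : s ∈ Ioo (-a) a) : uIcc 0 s ⊆ Ioo (-a) a :=
  ordConnected_Ioo.uIcc_subset ⟨by linarith [hs.1, hs.2], by linarith [hs.1, hs.2]⟩ hs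

/-- Extension by zero is smooth because ζ already vanishes for 2r ≤ |t| < π/4, a nonempty range as r
< π/8. -/
lemma IsProfile.exists_global {r : ℝ} {ζ : ℝ → ℝ} (hr : r ∈ Ioo 0 (Real.pi / 8))
    (h : IsProfile r ζ) :
    ∃ ζ', IsGlobalProfile r ζ' ∧
      ∀ t ∈ Icc (-(Real.pi / 4)) (Real.pi / 4), conformalExponent ζ t = conformalExponent ζ' t := by
  obtain ⟨hr0, hr1⟩ := hr
  set I := Ioo (-(Real.pi / 4)) (Real.pi / 4) with hI
  classical
  let ζ' := I.indicator ζ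
  have heq : ∀ t ∈ I, ζ' t = ζ t := fun t ht => indicator_of_mem ht ζ
  have hout : ∀ t, t ∉ I → ζ' t = 0 := fun t ht => indicator_of_notMem ht ζ
  have heven : ∀ t, ζ' (-t) = ζ' t := by
    intro t
    by_cases ht : t ∈ I
    · have ht' : -t ∈ I := ⟨by linarith [ht.2], by linarith [ht.1]⟩
      rw [heq t ht, heq _ ht', h.even t ht]
    · have ht' : -t ∉ I := fun h' => ht ⟨by linarith [h'.2], by linarith [h'.1]⟩
      rw [hout t ht, hout _ ht']
  have hsupp : ∀ t, 2 * r ≤ t → ζ' t = 0 := by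
    intro t ht
    by_cases ht' : t ∈ I
    · rw [heq t ht', h.support t ⟨ht, ht'.2⟩]
    · exact hout t ht'
  have hmem : ∀ t, 0 ≤ t → t ≤ 2 * r → t ∈ I := fun t h0 h1 =>
    ⟨by linarith [Real.pi_pos], by linarith⟩
  have hsmooth : ContDiff ℝ ∞ ζ' := by
    rw [contDiff_iff_contDiffAt]
    intro t
    by_cases ht : t ∈ I
    · refine (h.smooth.contDiffAt (isOpen_Ioo.mem_nhds ht)).congr_of_eventuallyEq ?_
      filter_upwards [isOpen_Ioo.mem_nhds ht] with s hs using heq s hs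
    · have : 2 * r < |t| := by
        by_contra! hlt
        exact ht ⟨by linarith [(abs_le.1 hlt).1], by linarith [(abs_le.1 hlt).2]⟩
      refine (contDiffAt_const (c := (0 : ℝ))).congr_of_eventuallyEq ?_
      filter_upwards [continuous_abs.continuousAt.eventually (lt_mem_nhds this)] with s hs
      rcases lt_abs.1 hs with h1 | h1
      · exact hsupp s h1.le
      · rw [← heven]; exact hsupp _ h1.le
  refine ⟨ζ', ⟨hsmooth, heven, ?_, ?_, ?_, ?_, hsupp, ?_⟩, ?_⟩
  · rw [heq 0 (hmem 0 le_rfl (by linarith)), h.zero]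
  · intro s hs t ht hst
    rw [heq s (hmem s hs.1.le (by linarith [hs.2])), heq t (hmem t ht.1.le (by linarith [ht.2]))]
    exact h.decreasing hs ht hst
  · rw [heq r (hmem r hr0.le (by linarith)), h.vanish]
  · intro t ht
    rw [heq t (hmem t (by linarith [ht.1]) ht.2.le)]
    exact h.neg t ht
  · refine Eq.trans ?_ h.mean
    refine integral_congr fun t ht => ?_
    rw [uIcc_of_le (by linarith)] at ht
    exact heq t (hmem t ht.1 ht.2)
  · intro t ht
    refine integral_congr_ae ?_
    -- For s = ±π/4 the inner interval reaches an endpoint where the value of ζ is arbitrary; these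
    -- two values of s form a null set of the outer integral.
    have h1 : ∀ᵐ s : ℝ, s ≠ -(Real.pi / 4) := MeasureTheory.Measure.ae_ne _ _
    have h2 : ∀ᵐ s : ℝ, s ≠ Real.pi / 4 := MeasureTheory.Measure.ae_ne _ _
    filter_upwards [h1, h2] with s hs1 hs2 hs
    have hs3 : s ∈ Icc (-(Real.pi / 4)) (Real.pi / 4) :=
      ordConnected_Icc.uIcc_subset ⟨by linarith [Real.pi_pos], by linarith [Real.pi_pos]⟩ ht
        (uIoc_subset_uIcc hs)
    have hs4 : s ∈ I := ⟨lt_of_le_of_ne hs3.1 hs1.symm, lt_of_le_of_ne hs3.2 hs2⟩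
    exact integral_congr fun x hx => (heq x (uIcc_zero_subset hs4 hx)).symm

/-- The primitive `∫₀ˢ ζ` of a profile. -/
def profileIntegral (ζ : ℝ → ℝ) (s : ℝ) : ℝ := ∫ x in (0 : ℝ)..s, ζ x

namespace IsGlobalProfile

variable {r : ℝ} {ζ : ℝ → ℝ}

lemma intervalIntegrable (h : IsGlobalProfile r ζ) (a b : ℝ) :
    IntervalIntegrable ζ MeasureTheory.volume a b :=
  h.smooth.continuous.intervalIntegrable a b

lemma hasDerivAt_profileIntegral (h : IsGlobalProfile r ζ) (s : ℝ) :
    HasDerivAt (profileIntegral ζ) (ζ s) s :=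
  h.smooth.continuous.integral_hasStrictDerivAt 0 s |>.hasDerivAt

lemma contDiff_profileIntegral (h : IsGlobalProfile r ζ) : ContDiff ℝ ∞ (profileIntegral ζ) := by
  rw [contDiff_infty_iff_deriv]
  refine ⟨fun s => (h.hasDerivAt_profileIntegral s).differentiableAt, ?_⟩
  rw [funext fun s => (h.hasDerivAt_profileIntegral s).deriv]
  exact h.smooth

lemma hasDerivAt_conformalExponent (h : IsGlobalProfile r ζ) (s : ℝ) :
    HasDerivAt (conformalExponent ζ) (profileIntegral ζ s) s :=
  h.contDiff_profileIntegral.continuous.integral_hasStrictDerivAt 0 s |>.hasDerivAt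

lemma contDiff_conformalExponent (h : IsGlobalProfile r ζ) :
    ContDiff ℝ ∞ (conformalExponent ζ) := by
  rw [contDiff_infty_iff_deriv]
  refine ⟨fun s => (h.hasDerivAt_conformalExponent s).differentiableAt, ?_⟩
  rw [funext fun s => (h.hasDerivAt_conformalExponent s).deriv]
  exact h.contDiff_profileIntegral

lemma profileIntegral_neg (h : IsGlobalProfile r ζ) (s : ℝ) :
    profileIntegral ζ (-s) = -profileIntegral ζ s := by
  have h1 := integral_comp_neg (a := 0) (b := s) ζ
  simp only [h.even, neg_zero] at h1
  rw [profileIntegral, profileIntegral, h1, integral_symm]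

lemma profileIntegral_sub (h : IsGlobalProfile r ζ) (s t : ℝ) :
    profileIntegral ζ t - profileIntegral ζ s = ∫ x in s..t, ζ x :=
  integral_interval_sub_left (h.intervalIntegrable 0 t) (h.intervalIntegrable 0 s)

lemma profileIntegral_of_le (h : IsGlobalProfile r ζ) {s : ℝ} (hs : 2 * r ≤ s) :
    profileIntegral ζ s = 0 := by
  have h1 := h.profileIntegral_sub (2 * r) s
  have h2 : ∫ x in (2 * r)..s, ζ x = 0 := by
    rw [integral_congr (g := fun _ => 0)]
    · simp
    · intro x hx
      rw [uIcc_of_le hs] at hx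
      exact h.support x hx.1
  have h3 : profileIntegral ζ (2 * r) = 0 := h.mean
  linarith

lemma profileIntegral_of_le_abs (h : IsGlobalProfile r ζ) {s : ℝ} (hs : 2 * r ≤ |s|) :
    profileIntegral ζ s = 0 := by
  rcases le_abs.1 hs with h1 | h1
  · exact h.profileIntegral_of_le h1
  · rw [← neg_neg s, h.profileIntegral_neg, h.profileIntegral_of_le h1, neg_zero]

lemma apply_of_le_abs (h : IsGlobalProfile r ζ) {s : ℝ} (hs : 2 * r ≤ |s|) : ζ s = 0 := by
  rcases le_abs.1 hs with h1 | h1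
  · exact h.support s h1
  · rw [← h.even, h.support _ h1]

/-- Monotonicity passes to the closed interval by continuity: both points are moved towards each
other by l(t - s), where l < 1/2 keeps their order, and then l → 0. -/
lemma antitoneOn_Icc (h : IsGlobalProfile r ζ) : AntitoneOn ζ (Icc 0 r) := by
  intro s hs t ht hst
  rcases hst.eq_or_lt with rfl | hlt
  · exact le_rfl
  have hc := h.smooth.continuous
  have h1 : Filter.Tendsto (fun l : ℝ => ζ (s + l * (t - s))) (nhdsWithin 0 (Ioi 0))
      (nhds (ζ s)) := by
    have : Continuous (fun l : ℝ => ζ (s + l * (t - s))) := by fun_prop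
    simpa using (this.tendsto 0).mono_left nhdsWithin_le_nhds
  have h2 : Filter.Tendsto (fun l : ℝ => ζ (t - l * (t - s))) (nhdsWithin 0 (Ioi 0))
      (nhds (ζ t)) := by
    have : Continuous (fun l : ℝ => ζ (t - l * (t - s))) := by fun_prop
    simpa using (this.tendsto 0).mono_left nhdsWithin_le_nhds
  refine le_of_tendsto_of_tendsto h2 h1 ?_
  filter_upwards [Ioo_mem_nhdsGT (show (0 : ℝ) < 1 / 2 by norm_num)] with l hl
  have h3 : 0 < l * (t - s) := mul_pos hl.1 (by linarith)
  have h4 : l * (t - s) < 1 / 2 * (t - s) := mul_lt_mul_of_pos_right hl.2 (by linarith)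
  exact h.decreasing ⟨by linarith [hs.1], by linarith [ht.2]⟩
    ⟨by linarith [hs.1], by linarith [ht.2]⟩ (by linarith)

lemma nonneg_of_le (h : IsGlobalProfile r ζ) (hr : 0 < r) {s : ℝ} (hs : s ∈ Icc 0 r) :
    0 ≤ ζ s := by
  rw [← h.vanish]
  exact h.antitoneOn_Icc hs ⟨hr.le, le_rfl⟩ hs.2

lemma le_one_of_nonneg (h : IsGlobalProfile r ζ) (hr : 0 < r) {s : ℝ} (hs : 0 ≤ s) :
    ζ s ≤ 1 := by
  rcases le_or_gt s r with h1 | h1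
  · rw [← h.zero]
    exact h.antitoneOn_Icc ⟨le_rfl, hr.le⟩ ⟨hs, h1⟩ hs
  · rcases lt_or_ge s (2 * r) with h2 | h2
    · exact (h.neg s ⟨h1, h2⟩).le.trans zero_le_one
    · rw [h.support s h2]; exact zero_le_one

lemma le_one (h : IsGlobalProfile r ζ) (hr : 0 < r) (s : ℝ) : ζ s ≤ 1 := by
  rcases le_total 0 s with h1 | h1
  · exact h.le_one_of_nonneg hr h1
  · rw [← h.even]; exact h.le_one_of_nonneg hr (by linarith)

lemma nonpos_of_le (h : IsGlobalProfile r ζ) {s : ℝ} (hs : r ≤ s) : ζ s ≤ 0 := by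
  rcases hs.eq_or_lt with rfl | h1
  · exact h.vanish.le
  · rcases lt_or_ge s (2 * r) with h2 | h2
    · exact (h.neg s ⟨h1, h2⟩).le
    · exact (h.support s h2).le

/-- Up to r the integrand is nonnegative with value 1 at 0. Beyond r the mean-zero condition
rewrites the primitive as -∫ₛ^{2r} ζ, and ζ is negative there. -/
lemma profileIntegral_pos (h : IsGlobalProfile r ζ) (hr : 0 < r) {s : ℝ}
    (hs : s ∈ Ioo 0 (2 * r)) : 0 < profileIntegral ζ s := by
  rcases le_or_gt s r with h1 | h1
  · refine integral_pos hs.1 h.smooth.continuous.continuousOn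
      (fun x hx => h.nonneg_of_le hr ⟨hx.1.le, hx.2.trans h1⟩)
      ⟨0, ⟨le_rfl, hs.1.le⟩, by rw [h.zero]; exact one_pos⟩
  · have h2 := h.profileIntegral_sub s (2 * r)
    rw [h.profileIntegral_of_le le_rfl] at h2
    have h3 : 0 < ∫ x in s..(2 * r), -ζ x :=
      intervalIntegral_pos_of_pos_on (h.intervalIntegrable _ _).neg
        (fun x hx => by linarith [h.neg x ⟨h1.trans hx.1, hx.2⟩]) hs.2
    rw [integral_neg] at h3
    linarith

/-- The primitive grows at rate at most 1 on [0, r] and does not increase afterwards. -/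
lemma profileIntegral_le (h : IsGlobalProfile r ζ) (hr : 0 < r) {s : ℝ}
    (hs : 0 ≤ s) : profileIntegral ζ s ≤ r := by
  have key : ∀ t, 0 ≤ t → t ≤ r → profileIntegral ζ t ≤ r := fun t h0 h1 => by
    have : profileIntegral ζ t ≤ ∫ _ in (0 : ℝ)..t, (1 : ℝ) :=
      integral_mono_on h0 (h.intervalIntegrable _ _) (by simp) fun x _ => h.le_one hr x
    simp at this
    linarith
  rcases le_or_gt s r with h1 | h1
  · exact key s hs h1
  · have h2 := h.profileIntegral_sub r s
    have h3 : ∫ x in r..s, ζ x ≤ ∫ _ in r..s, (0 : ℝ) :=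
      integral_mono_on h1.le (h.intervalIntegrable _ _) (by simp) fun x hx => h.nonpos_of_le hx.1
    have h4 := key r hr.le le_rfl
    simp at h3
    linarith

lemma abs_profileIntegral_le (h : IsGlobalProfile r ζ) (hr : 0 < r) (s : ℝ) :
    |profileIntegral ζ s| ≤ r := by
  have key : ∀ t, 0 ≤ t → |profileIntegral ζ t| ≤ r := fun t ht => by
    rw [abs_of_nonneg]
    · exact h.profileIntegral_le hr ht
    · rcases ht.eq_or_lt with rfl | h0
      · simp [profileIntegral]
      · rcases lt_or_ge t (2 * r) with h2 | h2
        · exact (h.profileIntegral_pos hr ⟨h0, h2⟩).le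
        · exact (h.profileIntegral_of_le h2).ge
  rcases le_total 0 s with h1 | h1
  · exact key s h1
  · rw [← abs_neg, ← h.profileIntegral_neg]; exact key _ (by linarith)

lemma conformalExponent_of_le (h : IsGlobalProfile r ζ) {s : ℝ} (hs : 2 * r ≤ s) :
    conformalExponent ζ s = conformalExponent ζ (2 * r) := by
  have hi : ∀ a b, IntervalIntegrable (profileIntegral ζ) MeasureTheory.volume a b :=
    fun a b => h.contDiff_profileIntegral.continuous.intervalIntegrable a b
  have h1 : conformalExponent ζ s - conformalExponent ζ (2 * r) =
      ∫ x in (2 * r)..s, profileIntegral ζ x := integral_interval_sub_left (hi 0 s) (hi 0 (2 * r))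
  rw [integral_congr (g := fun _ => 0)] at h1
  · simp at h1; linarith
  · intro x hx
    rw [uIcc_of_le hs] at hx
    exact h.profileIntegral_of_le hx.1

lemma conformalExponent_neg (h : IsGlobalProfile r ζ) (s : ℝ) :
    conformalExponent ζ (-s) = conformalExponent ζ s := by
  have h1 := integral_comp_neg (a := 0) (b := s) (profileIntegral ζ)
  simp only [h.profileIntegral_neg, neg_zero, integral_neg] at h1
  change ∫ x in (0 : ℝ)..(-s), profileIntegral ζ x = ∫ x in (0 : ℝ)..s, profileIntegral ζ x
  rw [integral_symm, ← h1, neg_neg]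

end IsGlobalProfile

end StableTori

end

noncomputable section

namespace StableTori

open Set

/-! ### The conformal exponent as a function of `|z₁|² - |z₂|²` -/

/-- The function `Ψ` with `φ(t) = Ψ(sin 2t)`. -/
def quadricExponent (ζ : ℝ → ℝ) (k : ℝ) : ℝ := conformalExponent ζ (Real.arcsin k / 2)

lemma quadricExponent_zero (ζ : ℝ → ℝ) : quadricExponent ζ 0 = 0 := by
  simp [quadricExponent, conformalExponent]

namespace IsGlobalProfile

variable {r : ℝ} {ζ : ℝ → ℝ}

lemma quadricExponent_neg (h : IsGlobalProfile r ζ) (k : ℝ) :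
    quadricExponent ζ (-k) = quadricExponent ζ k := by
  rw [quadricExponent, Real.arcsin_neg, neg_div, h.conformalExponent_neg, quadricExponent]

/-- The circles z₁ = 0 and z₂ = 0 lie at h = ±1, where arcsin is not differentiable. As 2r < π/4,
the exponent is already constant near them; since `Real.arcsin` is constant outside [-1, 1], this
holds on a full neighbourhood. -/
lemma quadricExponent_eventually_const (h : IsGlobalProfile r ζ) (hr : r < Real.pi / 8) {k : ℝ}
    (hk : 1 ≤ |k|) : quadricExponent ζ =ᶠ[nhds k] fun _ => conformalExponent ζ (2 * r) := by
  have key : ∀ k : ℝ, 1 ≤ k → ∀ᶠ x in nhds k,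
      quadricExponent ζ x = conformalExponent ζ (2 * r) := fun k hk => by
    have h1 : 2 * r < Real.arcsin k / 2 := by
      rw [Real.arcsin_of_one_le hk]; linarith
    have h2 : ContinuousAt (fun x => Real.arcsin x / 2) k :=
      (Real.continuous_arcsin.div_const 2).continuousAt
    filter_upwards [h2.eventually (lt_mem_nhds h1)] with x hx
    exact h.conformalExponent_of_le hx.le
  rcases le_abs.1 hk with h1 | h1
  · exact key k h1
  · have h2 := (key _ h1)
    have h3 : Filter.Tendsto (fun x : ℝ => -x) (nhds k) (nhds (-k)) := continuous_neg.tendsto k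
    filter_upwards [h3.eventually h2] with x hx
    rw [← hx, h.quadricExponent_neg]

lemma contDiff_quadricExponent (h : IsGlobalProfile r ζ) (hr : r < Real.pi / 8) :
    ContDiff ℝ ∞ (quadricExponent ζ) := by
  rw [contDiff_iff_contDiffAt]
  intro k
  rcases lt_or_ge |k| 1 with h1 | h1
  · have h2 := abs_lt.1 h1
    exact h.contDiff_conformalExponent.contDiffAt.comp k
      ((Real.contDiffAt_arcsin h2.1.ne' h2.2.ne).div_const 2)
  · exact contDiffAt_const.congr_of_eventuallyEq (h.quadricExponent_eventually_const hr h1)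

lemma deriv_quadricExponent_of_one_le (h : IsGlobalProfile r ζ) (hr : r < Real.pi / 8) {k : ℝ}
    (hk : 1 ≤ |k|) : deriv (quadricExponent ζ) k = 0 := by
  rw [(h.quadricExponent_eventually_const hr hk).deriv_eq, deriv_const]

lemma deriv_deriv_quadricExponent_of_one_le (h : IsGlobalProfile r ζ) (hr : r < Real.pi / 8)
    {k : ℝ} (hk : 1 ≤ |k|) : deriv (deriv (quadricExponent ζ)) k = 0 := by
  rw [(h.quadricExponent_eventually_const hr hk).deriv.deriv_eq]
  simp

lemma deriv_quadricExponent (h : IsGlobalProfile r ζ) {k : ℝ} (hk : k ∈ Ioo (-1 : ℝ) 1) :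
    deriv (quadricExponent ζ) k =
      profileIntegral ζ (Real.arcsin k / 2) * (1 / Real.sqrt (1 - k ^ 2) / 2) :=
  ((h.hasDerivAt_conformalExponent _).comp k
    ((Real.hasDerivAt_arcsin hk.1.ne' hk.2.ne).div_const 2)).deriv

/-- Differentiating φ(t) = Ψ(sin 2t) twice gives φ'' = 4 cos²(2t) Ψ'' - 4 sin(2t) Ψ', and φ'' = ζ.
-/
lemma deriv_deriv_quadricExponent (h : IsGlobalProfile r ζ) {k : ℝ} (hk : k ∈ Ioo (-1 : ℝ) 1) :
    4 * (1 - k ^ 2) * deriv (deriv (quadricExponent ζ)) k =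
      ζ (Real.arcsin k / 2) + 4 * k * deriv (quadricExponent ζ) k := by
  have hpos : 0 < 1 - k ^ 2 := by nlinarith [hk.1, hk.2]
  have h1 : deriv (quadricExponent ζ) =ᶠ[nhds k] fun k =>
      profileIntegral ζ (Real.arcsin k / 2) * ((Real.sqrt (1 - k ^ 2))⁻¹ / 2) := by
    filter_upwards [isOpen_Ioo.mem_nhds hk] with x hx
    rw [h.deriv_quadricExponent hx, one_div]
  have h2 : HasDerivAt (fun k => profileIntegral ζ (Real.arcsin k / 2)) _ k :=
    (h.hasDerivAt_profileIntegral _).comp k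
      ((Real.hasDerivAt_arcsin hk.1.ne' hk.2.ne).div_const 2)
  have h3 : HasDerivAt (fun k : ℝ => 1 - k ^ 2) (-(2 * k)) k := by
    simpa using ((hasDerivAt_id k).pow 2).const_sub 1
  have h4 := ((h3.sqrt hpos.ne').inv (Real.sqrt_pos.2 hpos).ne').div_const 2
  have h5 := h2.mul h4
  have h6 : deriv (deriv (quadricExponent ζ)) k = _ := h1.deriv_eq.trans h5.deriv
  rw [h6, h.deriv_quadricExponent hk]
  have hs := Real.sq_sqrt hpos.le
  have hs0 := (Real.sqrt_pos.2 hpos).ne'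
  simp only [Pi.inv_apply]
  generalize Real.sqrt (1 - k ^ 2) = s at *
  rw [← hs]
  field_simp
  ring

end IsGlobalProfile

/-! ### Positivity of the Ricci tensor -/

/-- The Ricci tensor of `e^{2Ψ(h)} g` at a point with `h = k`, evaluated on a tangent vector `w`
with `n = |w|²`, `b = ½ dh(w)` and `q = h(w)`. Here `d` and `e` are the first and the second
derivative of `Ψ` at `k`. -/
def ricciForm (k d e n b q : ℝ) : ℝ :=
  2 * n + 4 * (d ^ 2 - e) * b ^ 2 - 2 * d * (q - k * n)
    - (4 * (e + d ^ 2) * (1 - k ^ 2) - 8 * k * d) * n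

/-- The component of `w` orthogonal to `p` and to the gradient of `h` at `p`. -/
def tangentialPart (p w : Eucl 4) : Eucl 4 :=
  w - (inner ℝ (flipSnd p) w / (1 - cliffordForm p ^ 2)) • (flipSnd p - cliffordForm p • p)

lemma abs_cliffordForm_le (v : Eucl 4) : |cliffordForm v| ≤ ‖v‖ ^ 2 := by
  have h := abs_real_inner_le_norm (flipSnd v) v
  have h2 : ‖flipSnd v‖ = ‖v‖ := by
    rw [← sq_eq_sq₀ (norm_nonneg _) (norm_nonneg _), ← real_inner_self_eq_norm_sq, norm_flipSnd_sq,
      real_inner_self_eq_norm_sq]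
  rwa [h2, ← sq] at h

section

variable {p w : Eucl 4}

/-- Pythagoras: `flipSnd p - cliffordForm p • p` is half the gradient of h on the sphere, of squared
length 1 - h(p)². -/
lemma norm_tangentialPart_sq (hp : ‖p‖ = 1) (hw : inner ℝ p w = 0)
    (hk : cliffordForm p ^ 2 < 1) :
    ‖tangentialPart p w‖ ^ 2 =
      ‖w‖ ^ 2 - inner ℝ (flipSnd p) w ^ 2 / (1 - cliffordForm p ^ 2) := by
  have hpp : inner ℝ p p = (1 : ℝ) := by simp [hp]
  have hw' : inner ℝ w p = 0 := by rw [real_inner_comm, hw]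
  have hs : 1 - cliffordForm p ^ 2 ≠ 0 := by linarith
  rw [← real_inner_self_eq_norm_sq, ← real_inner_self_eq_norm_sq, tangentialPart]
  simp only [inner_sub_left, inner_sub_right, inner_smul_left, inner_smul_right, norm_flipSnd_sq,
    hpp, hw, hw', conj_trivial, real_inner_comm (flipSnd p) w, real_inner_comm (flipSnd p) p]
  rw [show inner ℝ (flipSnd p) p = cliffordForm p from rfl]
  field_simp
  ring

/-- The form h takes the value -h(p) on the unit gradient direction, and its polar form pairs this
direction trivially with the tangential part, because `flipSnd` maps the gradient into the span of p
and `flipSnd p`. -/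
lemma cliffordForm_tangentialPart (hp : ‖p‖ = 1) (hw : inner ℝ p w = 0)
    (hk : cliffordForm p ^ 2 < 1) :
    cliffordForm (tangentialPart p w) =
      cliffordForm w + cliffordForm p * (inner ℝ (flipSnd p) w ^ 2 / (1 - cliffordForm p ^ 2)) := by
  have hpp : inner ℝ p p = (1 : ℝ) := by simp [hp]
  have hw' : inner ℝ w p = 0 := by rw [real_inner_comm, hw]
  have hs : 1 - cliffordForm p ^ 2 ≠ 0 := by linarith
  have hf : inner ℝ (flipSnd w) (flipSnd p) = 0 := by rw [inner_flipSnd_left, flipSnd_flipSnd, hw']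
  rw [cliffordForm, tangentialPart]
  simp only [inner_sub_left, inner_sub_right, inner_smul_left, inner_smul_right, norm_flipSnd_sq,
    map_sub, map_smul, flipSnd_flipSnd,
    hpp, hw, hf, conj_trivial, inner_flipSnd_left w p, real_inner_comm (flipSnd p) w,
    real_inner_comm (flipSnd p) p]
  rw [show inner ℝ (flipSnd p) p = cliffordForm p from rfl,
    show inner ℝ (flipSnd w) w = cliffordForm w from rfl]
  field_simp
  ring

/-- The Ricci form splits without cross terms into the gradient direction of h and its complement.
The parameters z and Z stand for φ'' and φ'; the hypotheses `he` and `hd` are the chain rule for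
φ(t) = Ψ(sin 2t). -/
lemma ricciForm_eq (hp : ‖p‖ = 1) (hw : inner ℝ p w = 0) (hk : cliffordForm p ^ 2 < 1)
    {d e z Z : ℝ} (he : 4 * (1 - cliffordForm p ^ 2) * e = z + 4 * cliffordForm p * d)
    (hd : 4 * (1 - cliffordForm p ^ 2) * d ^ 2 = Z ^ 2) :
    ricciForm (cliffordForm p) d e (‖w‖ ^ 2) (inner ℝ (flipSnd p) w) (cliffordForm w) =
      (2 - 2 * z + 4 * cliffordForm p * d)
          * (inner ℝ (flipSnd p) w ^ 2 / (1 - cliffordForm p ^ 2))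
        + (2 - z + 6 * cliffordForm p * d - Z ^ 2) * ‖tangentialPart p w‖ ^ 2
        - 2 * d * cliffordForm (tangentialPart p w) := by
  have hs : 1 - cliffordForm p ^ 2 ≠ 0 := by linarith
  rw [cliffordForm_tangentialPart hp hw hk, norm_tangentialPart_sq hp hw hk, ricciForm]
  have hb : inner ℝ (flipSnd p) w ^ 2 =
      (inner ℝ (flipSnd p) w ^ 2 / (1 - cliffordForm p ^ 2)) * (1 - cliffordForm p ^ 2) := by
    field_simp
  rw [hb, mul_div_assoc, div_self hs]
  generalize inner ℝ (flipSnd p) w ^ 2 / (1 - cliffordForm p ^ 2) = β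
  linear_combination (β - ‖w‖ ^ 2) * hd - (β + ‖w‖ ^ 2) * he

namespace IsGlobalProfile

variable {r : ℝ} {ζ : ℝ → ℝ}

/-- The value at `w` of the Ricci tensor at `p` of the metric `e^{2φ(t)} g`. -/
def _root_.StableTori.profileRicci (ζ : ℝ → ℝ) (p w : Eucl 4) : ℝ :=
  ricciForm (cliffordForm p) (deriv (quadricExponent ζ) (cliffordForm p))
    (deriv (deriv (quadricExponent ζ)) (cliffordForm p)) (‖w‖ ^ 2) (inner ℝ (flipSnd p) w)
    (cliffordForm w)

lemma profileRicci_of_one_le (h : IsGlobalProfile r ζ) (hr : r < Real.pi / 8)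
    (hk : 1 ≤ |cliffordForm p|) : profileRicci ζ p w = 2 * ‖w‖ ^ 2 := by
  rw [profileRicci, h.deriv_quadricExponent_of_one_le hr hk,
    h.deriv_deriv_quadricExponent_of_one_le hr hk, ricciForm]
  ring

/-- A is the exact coefficient in the normal direction, which degenerates on the torus; B is a
uniform bound for all tangential directions. -/
lemma profileRicci_lower_bound (h : IsGlobalProfile r ζ) (hr0 : 0 < r) (hr : r < 1 / 4)
    (hp : ‖p‖ = 1) (hw : inner ℝ p w = 0) (hk : |cliffordForm p| < 1) :
    ∃ A B : ℝ, (0 < B ∧ (cliffordForm p = 0 → A = 0) ∧ (cliffordForm p ≠ 0 → 0 < A)) ∧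
      A * (inner ℝ (flipSnd p) w ^ 2 / (1 - cliffordForm p ^ 2)) + B * ‖tangentialPart p w‖ ^ 2
        ≤ profileRicci ζ p w ∧
      (tangentialPart p w = 0 → profileRicci ζ p w =
        A * (inner ℝ (flipSnd p) w ^ 2 / (1 - cliffordForm p ^ 2))) := by
  have hk1 := abs_lt.1 hk
  have hksq : cliffordForm p ^ 2 < 1 := by rw [sq_lt_one_iff_abs_lt_one]; exact hk
  have hq := abs_cliffordForm_le (tangentialPart p w)
  have he := h.deriv_deriv_quadricExponent hk1
  have hd := h.deriv_quadricExponent hk1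
  have heq := ricciForm_eq hp hw hksq (d := deriv (quadricExponent ζ) (cliffordForm p))
    (Z := profileIntegral ζ (Real.arcsin (cliffordForm p) / 2)) he (by
      rw [hd]
      have h0 : 0 < 1 - cliffordForm p ^ 2 := by linarith
      have hs := Real.sq_sqrt h0.le
      have hs0 := (Real.sqrt_pos.2 h0).ne'
      generalize Real.sqrt (1 - cliffordForm p ^ 2) = s at *
      rw [← hs]
      field_simp
      ring)
  rw [← profileRicci] at heq
  have hZ := h.abs_profileIntegral_le hr0 (Real.arcsin (cliffordForm p) / 2)
  have hz := h.le_one hr0 (Real.arcsin (cliffordForm p) / 2)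
  have hsin : cliffordForm p = Real.sin (2 * (Real.arcsin (cliffordForm p) / 2)) := by
    rw [mul_div_cancel₀ _ two_ne_zero, Real.sin_arcsin hk1.1.le hk1.2.le]
  have hc : Real.sqrt (1 - cliffordForm p ^ 2) =
      Real.cos (2 * (Real.arcsin (cliffordForm p) / 2)) := by
    rw [mul_div_cancel₀ _ two_ne_zero, Real.cos_arcsin]
  have hcpos : 0 < Real.sqrt (1 - cliffordForm p ^ 2) := Real.sqrt_pos.2 (by linarith)
  have htb := Real.neg_pi_div_two_le_arcsin (cliffordForm p)
  have htb' := Real.arcsin_le_pi_div_two (cliffordForm p)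
  set k := cliffordForm p
  set d := deriv (quadricExponent ζ) k
  set t := Real.arcsin k / 2 with ht
  set Z := profileIntegral ζ t
  set c := Real.sqrt (1 - k ^ 2)
  -- This is φ'(t) = 2 cos(2t) Ψ'(sin 2t).
  have hZd : Z = 2 * c * d := by rw [hd]; field_simp
  -- Both k = sin 2t and Z = φ'(t) are odd in t; for 0 < t < 2r both are positive, and Z vanishes
  -- from 2r on.
  have hkZ : 0 ≤ k * Z ∧ (k ≠ 0 → |t| < 2 * r → 0 < k * Z) := by
    rcases lt_trichotomy k 0 with hk0 | hk0 | hk0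
    · have ht0 : t < 0 := by
        have := Real.arcsin_lt_zero.2 hk0
        linarith
      have hneg : Z = -profileIntegral ζ (-t) := by rw [h.profileIntegral_neg, neg_neg]
      rcases lt_or_ge |t| (2 * r) with h1 | h1
      · have := h.profileIntegral_pos hr0 (s := -t) ⟨by linarith, by rwa [abs_of_neg ht0] at h1⟩
        have hpos : 0 < k * Z := mul_pos_of_neg_of_neg hk0 (by linarith)
        exact ⟨hpos.le, fun _ _ => hpos⟩
      · have : Z = 0 := h.profileIntegral_of_le_abs h1
        exact ⟨by rw [this, mul_zero], fun _ h2 => absurd h2 h1.not_gt⟩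
    · exact ⟨by rw [hk0, zero_mul], fun h1 => absurd hk0 h1⟩
    · have ht0 : 0 < t := by
        have := Real.arcsin_pos.2 hk0
        linarith
      rcases lt_or_ge |t| (2 * r) with h1 | h1
      · have := h.profileIntegral_pos hr0 (s := t) ⟨ht0, by rwa [abs_of_pos ht0] at h1⟩
        have hpos : 0 < k * Z := mul_pos hk0 this
        exact ⟨hpos.le, fun _ _ => hpos⟩
      · have : Z = 0 := h.profileIntegral_of_le_abs h1
        exact ⟨by rw [this, mul_zero], fun _ h2 => absurd h2 h1.not_gt⟩
  have hkd : 0 ≤ k * d ∧ (k ≠ 0 → |t| < 2 * r → 0 < k * d) := by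
    have hrel : k * Z = 2 * c * (k * d) := by rw [hZd]; ring
    rw [hrel] at hkZ
    exact ⟨nonneg_of_mul_nonneg_right hkZ.1 (by positivity),
      fun h1 h2 => (mul_pos_iff_of_pos_left (by positivity)).1 (hkZ.2 h1 h2)⟩
  -- Where φ' ≠ 0 one has |2t| < 4r < 1, so cos 2t ≥ 1/2 and |d| = |Z| / (2 cos 2t) ≤ |Z| ≤ r.
  have hdr : |d| ≤ r := by
    rcases lt_or_ge |t| (2 * r) with h1 | h1
    · have h2 : |2 * t| ≤ 1 := by rw [abs_mul, abs_two]; linarith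
      have h3 := Real.one_sub_sq_div_two_le_cos (x := 2 * t)
      have h4 : (2 * t) ^ 2 ≤ 1 := by rwa [sq_le_one_iff_abs_le_one]
      have h5 : 1 / 2 ≤ c := by rw [hc]; linarith
      have h6 : |Z| = 2 * c * |d| := by
        rw [hZd, abs_mul, abs_of_pos (by positivity : 0 < 2 * c)]
      nlinarith [abs_nonneg d]
    · have h2 : Z = 0 := h.profileIntegral_of_le_abs h1
      have h3 : d = 0 := by
        rw [h2] at hZd
        exact (mul_eq_zero.1 hZd.symm).resolve_left (by positivity)
      rw [h3, abs_zero]; exact hr0.le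
  have hZ2 : Z ^ 2 ≤ r ^ 2 := by rw [← sq_abs Z]; gcongr
  have hr2 : r ^ 2 ≤ (1 / 4) ^ 2 := by gcongr
  have hassoc : ∀ a : ℝ, a * k * d = a * (k * d) := fun a => mul_assoc a k d
  -- Here r < 1/4 is used: 2 - ζ + 6kd - Z² - 2r ≥ 1 - 1/16 - 1/2, which exceeds 1/4.
  refine ⟨2 - 2 * ζ t + 4 * k * d, 1 / 4, ⟨by norm_num, ?_, ?_⟩, ?_, ?_⟩
  · intro hk0
    rw [ht, hk0, Real.arcsin_zero, zero_div, h.zero]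
    ring
  -- As ζ is only weakly decreasing it may equal 1 off the torus as well; strict positivity then
  -- comes from kd > 0, and beyond 2r from ζ = 0.
  · intro hk0
    rcases lt_or_ge |t| (2 * r) with h1 | h1
    · have := hkd.2 hk0 h1
      rw [hassoc]
      linarith
    · rw [h.apply_of_le_abs h1, hassoc]
      linarith [hkd.1]
  · rw [heq]
    have h1 : d * cliffordForm (tangentialPart p w) ≤ r * ‖tangentialPart p w‖ ^ 2 := by
      calc _ ≤ |d * cliffordForm (tangentialPart p w)| := le_abs_self _
        _ = |d| * |cliffordForm (tangentialPart p w)| := abs_mul _ _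
        _ ≤ _ := by gcongr
    have h2 : 0 ≤ (2 - ζ t + 6 * k * d - Z ^ 2 - 2 * r - 1 / 4) * ‖tangentialPart p w‖ ^ 2 := by
      refine mul_nonneg ?_ (by positivity)
      rw [hassoc]
      linarith [hkd.1]
    have h3 : (2 - ζ t + 6 * k * d - Z ^ 2) * ‖tangentialPart p w‖ ^ 2 =
        (2 - ζ t + 6 * k * d - Z ^ 2 - 2 * r - 1 / 4) * ‖tangentialPart p w‖ ^ 2
          + 2 * (r * ‖tangentialPart p w‖ ^ 2) + 1 / 4 * ‖tangentialPart p w‖ ^ 2 := by ring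
    rw [h3, mul_assoc 2 d]
    linarith
  · intro h0
    rw [heq, h0]
    simp [cliffordForm]

end IsGlobalProfile

end

end StableTori

end

noncomputable section

namespace StableTori

open Set

/-! ### Sign and kernel of the Ricci form -/

section

variable {p w : Eucl 4}

lemma norm_sq_eq_tangentialPart (hp : ‖p‖ = 1) (hw : inner ℝ p w = 0)
    (hk : |cliffordForm p| < 1) :
    ‖w‖ ^ 2 = inner ℝ (flipSnd p) w ^ 2 / (1 - cliffordForm p ^ 2) + ‖tangentialPart p w‖ ^ 2 := by
  rw [norm_tangentialPart_sq hp hw ((sq_lt_one_iff_abs_lt_one _).2 hk)]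
  ring

namespace IsGlobalProfile

variable {r : ℝ} {ζ : ℝ → ℝ}

lemma profileRicci_nonneg (h : IsGlobalProfile r ζ) (hr0 : 0 < r) (hr : r < 1 / 4)
    (hp : ‖p‖ = 1) (hw : inner ℝ p w = 0) : 0 ≤ profileRicci ζ p w := by
  rcases lt_or_ge |cliffordForm p| 1 with hk | hk
  · obtain ⟨A, B, ⟨hB, hA0, hA⟩, hle, -⟩ := h.profileRicci_lower_bound hr0 hr hp hw hk
    have hk2 : 0 < 1 - cliffordForm p ^ 2 := by
      linarith [(sq_lt_one_iff_abs_lt_one (cliffordForm p)).2 hk]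
    have hA' : 0 ≤ A := by
      by_cases h0 : cliffordForm p = 0
      · exact (hA0 h0).ge
      · exact (hA h0).le
    refine le_trans ?_ hle
    positivity
  · rw [h.profileRicci_of_one_le (by linarith [Real.pi_gt_three]) hk]
    positivity

lemma profileRicci_pos (h : IsGlobalProfile r ζ) (hr0 : 0 < r) (hr : r < 1 / 4)
    (hp : ‖p‖ = 1) (hw : inner ℝ p w = 0) (h0 : cliffordForm p ≠ 0) (hw0 : w ≠ 0) :
    0 < profileRicci ζ p w := by
  have hwpos : 0 < ‖w‖ ^ 2 := by positivity
  rcases lt_or_ge |cliffordForm p| 1 with hk | hk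
  · obtain ⟨A, B, ⟨hB, -, hA⟩, hle, -⟩ := h.profileRicci_lower_bound hr0 hr hp hw hk
    have hk2 : 0 < 1 - cliffordForm p ^ 2 := by
      linarith [(sq_lt_one_iff_abs_lt_one (cliffordForm p)).2 hk]
    have hA' := hA h0
    refine lt_of_lt_of_le ?_ hle
    have hsum := norm_sq_eq_tangentialPart hp hw hk
    have h1 : 0 ≤ inner ℝ (flipSnd p) w ^ 2 / (1 - cliffordForm p ^ 2) := by positivity
    rcases h1.eq_or_lt with h2 | h2
    · have : 0 < ‖tangentialPart p w‖ ^ 2 := by linarith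
      rw [← h2]; positivity
    · positivity
  · rw [h.profileRicci_of_one_le (by linarith [Real.pi_gt_three]) hk]
    positivity

/-- On the torus the normal coefficient is 0, so the form vanishes exactly when the tangential part
does; there `flipSnd p` is itself the unit normal. -/
lemma profileRicci_eq_zero_iff (h : IsGlobalProfile r ζ) (hr0 : 0 < r) (hr : r < 1 / 4)
    (hp : ‖p‖ = 1) (hw : inner ℝ p w = 0) (h0 : cliffordForm p = 0) :
    profileRicci ζ p w = 0 ↔ ∃ c : ℝ, w = c • flipSnd p := by
  have hk : |cliffordForm p| < 1 := by rw [h0]; simp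
  obtain ⟨A, B, ⟨hB, hA0, -⟩, hle, heq⟩ := h.profileRicci_lower_bound hr0 hr hp hw hk
  rw [hA0 h0, zero_mul] at heq hle
  have ht : tangentialPart p w = w - inner ℝ (flipSnd p) w • flipSnd p := by
    simp [tangentialPart, h0]
  constructor
  · intro h1
    have h2 : tangentialPart p w = 0 := by
      by_contra hne
      have : 0 < B * ‖tangentialPart p w‖ ^ 2 := by positivity
      linarith
    exact ⟨inner ℝ (flipSnd p) w, by rwa [ht, sub_eq_zero] at h2⟩
  · rintro ⟨c, rfl⟩
    apply heq
    rw [ht, inner_smul_right, norm_flipSnd_sq, real_inner_self_eq_norm_sq, hp]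
    simp

end IsGlobalProfile

end

/-! ### Existence of profiles -/

section Existence

lemma expNegInvGlue_lt {x y : ℝ} (hx : 0 < x) (hxy : x < y) :
    expNegInvGlue x < expNegInvGlue y := by
  rw [expNegInvGlue, expNegInvGlue, if_neg hx.not_ge, if_neg (hx.trans hxy).not_ge,
    Real.exp_lt_exp, neg_lt_neg_iff]
  exact inv_strictAnti₀ hx hxy

/-- The nonnegative part of a profile. -/
def innerBump (r t : ℝ) : ℝ := expNegInvGlue (r ^ 2 - t ^ 2) / expNegInvGlue (r ^ 2)

/-- The nonpositive part of a profile, up to a factor. -/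
def outerBump (r t : ℝ) : ℝ := expNegInvGlue ((t ^ 2 - r ^ 2) * ((2 * r) ^ 2 - t ^ 2))

lemma contDiff_innerBump (r : ℝ) : ContDiff ℝ ∞ (innerBump r) := by
  unfold innerBump
  exact (expNegInvGlue.contDiff.comp (by fun_prop)).div_const _

lemma contDiff_outerBump (r : ℝ) : ContDiff ℝ ∞ (outerBump r) := by
  unfold outerBump
  exact expNegInvGlue.contDiff.comp (by fun_prop)

lemma innerBump_of_le {r t : ℝ} (hr : 0 < r) (ht : r ≤ t) : innerBump r t = 0 := by
  rw [innerBump, expNegInvGlue.zero_of_nonpos (by nlinarith), zero_div]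

lemma innerBump_pos {r t : ℝ} (h0 : 0 ≤ t) (ht : t < r) : 0 < innerBump r t :=
  div_pos (expNegInvGlue.pos_of_pos (by nlinarith)) (expNegInvGlue.pos_of_pos (by nlinarith))

lemma outerBump_of_le {r t : ℝ} (hr : 0 < r) (h0 : 0 ≤ t) (ht : t ≤ r) : outerBump r t = 0 :=
  expNegInvGlue.zero_of_nonpos (mul_nonpos_of_nonpos_of_nonneg (by nlinarith) (by nlinarith))

lemma outerBump_of_ge {r t : ℝ} (hr : 0 < r) (ht : 2 * r ≤ t) : outerBump r t = 0 :=
  expNegInvGlue.zero_of_nonpos (mul_nonpos_of_nonneg_of_nonpos (by nlinarith) (by nlinarith))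

lemma outerBump_pos {r t : ℝ} (hr : 0 < r) (ht : t ∈ Ioo r (2 * r)) : 0 < outerBump r t :=
  expNegInvGlue.pos_of_pos (mul_pos (by nlinarith [ht.1]) (by nlinarith [ht.1, ht.2]))

/-- The profile is a bump on |t| < r minus c times a bump on r < |t| < 2r. Both are smooth functions
of t², hence even, and c is the ratio of their integrals, which makes the mean vanish. -/
lemma exists_isGlobalProfile {r : ℝ} (hr : 0 < r) :
    ∃ ζ, IsGlobalProfile r ζ ∧ StrictAntiOn ζ (Ioo 0 r) := by
  have hi : ∀ a b, IntervalIntegrable (innerBump r) MeasureTheory.volume a b :=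
    fun a b => (contDiff_innerBump r).continuous.intervalIntegrable a b
  have ho : ∀ a b, IntervalIntegrable (outerBump r) MeasureTheory.volume a b :=
    fun a b => (contDiff_outerBump r).continuous.intervalIntegrable a b
  have hipos : 0 < ∫ t in (0 : ℝ)..(2 * r), innerBump r t := by
    refine intervalIntegral.integral_pos (by linarith)
      (contDiff_innerBump r).continuous.continuousOn (fun t ht => ?_)
      ⟨0, ⟨le_rfl, by linarith⟩, innerBump_pos le_rfl hr⟩
    exact div_nonneg (expNegInvGlue.nonneg _) (expNegInvGlue.nonneg _)
  have hopos : 0 < ∫ t in (0 : ℝ)..(2 * r), outerBump r t := by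
    refine intervalIntegral.integral_pos (by linarith)
      (contDiff_outerBump r).continuous.continuousOn (fun t ht => expNegInvGlue.nonneg _)
      ⟨3 / 2 * r, ⟨by linarith, by linarith⟩, outerBump_pos hr ⟨by linarith, by linarith⟩⟩
  set c := (∫ t in (0 : ℝ)..(2 * r), innerBump r t) / ∫ t in (0 : ℝ)..(2 * r), outerBump r t
  have hc : 0 < c := div_pos hipos hopos
  have hstrict : StrictAntiOn (fun t => innerBump r t - c * outerBump r t) (Ioo 0 r) := by
    intro s hs t ht hst
    simp only [outerBump_of_le hr hs.1.le hs.2.le, outerBump_of_le hr ht.1.le ht.2.le, mul_zero,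
      sub_zero]
    refine div_lt_div_of_pos_right (expNegInvGlue_lt ?_ ?_) (expNegInvGlue.pos_of_pos (by positivity))
    · nlinarith [ht.1, ht.2]
    · nlinarith [hs.1]
  refine ⟨fun t => innerBump r t - c * outerBump r t, ⟨?_, ?_, ?_, hstrict.antitoneOn, ?_, ?_, ?_, ?_⟩,
    hstrict⟩
  · exact (contDiff_innerBump r).sub (contDiff_const.mul (contDiff_outerBump r))
  · intro t
    simp [innerBump, outerBump]
  · rw [outerBump_of_le hr le_rfl hr.le, innerBump]
    have := (expNegInvGlue.pos_of_pos (show 0 < r ^ 2 by positivity)).ne'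
    simp [this]
  · rw [innerBump_of_le hr le_rfl, outerBump_of_le hr hr.le le_rfl]; simp
  · intro t ht
    have := mul_pos hc (outerBump_pos hr ht)
    rw [innerBump_of_le hr ht.1.le]
    linarith
  · intro t ht
    rw [innerBump_of_le hr (by linarith), outerBump_of_ge hr ht]; simp
  · rw [intervalIntegral.integral_sub (hi _ _) ((ho _ _).const_mul c),
      intervalIntegral.integral_const_mul, div_mul_cancel₀ _ hopos.ne', sub_self]

end Existence

end StableTori

end

noncomputable section

namespace StableTori

/-! ### Metrics on the sphere which are conformal to the round metric -/

/-- The derivative of the inclusion of the sphere. -/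
def sphereDeriv (p : S3) : TangentSpace (𝓡 3) p →L[ℝ] Eucl 4 :=
  mfderiv (𝓡 3) 𝓘(ℝ, Eucl 4) (fun q : S3 => (q : Eucl 4)) p

instance : Fact (Module.finrank ℝ (Eucl 4) = 3 + 1) := ⟨by simp⟩

lemma contMDiff_coe : ContMDiff (𝓡 3) 𝓘(ℝ, Eucl 4) ∞ (fun q : S3 => (q : Eucl 4)) :=
  contMDiff_coe_sphere

lemma sphereDeriv_injective (p : S3) : Function.Injective (sphereDeriv p) :=
  injective_mvfderiv_subtypeVal_sphere p

/-- The round metric on the tangent space at `p`. -/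
def roundInner (p : S3) : TangentSpace (𝓡 3) p →L[ℝ] TangentSpace (𝓡 3) p →L[ℝ] ℝ :=
  (ContinuousLinearMap.precomp ℝ (sphereDeriv p)) ∘L (innerSL ℝ) ∘L sphereDeriv p

lemma roundInner_apply (p : S3) (v w : TangentSpace (𝓡 3) p) :
    roundInner p v w = inner ℝ (sphereDeriv p v) (sphereDeriv p w) := rfl

/-- The pull-back of the inner product of `ℝ⁴` by a linear map. -/
def pullbackInner {n : ℕ} (T : Eucl n →L[ℝ] Eucl 4) : Eucl n →L[ℝ] Eucl n →L[ℝ] ℝ :=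
  (ContinuousLinearMap.precomp ℝ T) ∘L (innerSL ℝ) ∘L T

lemma contDiff_pullbackInner {n : ℕ} : ContDiff ℝ ∞ (pullbackInner (n := n)) := by
  rw [contDiff_clm_apply_iff]
  intro v
  rw [contDiff_clm_apply_iff]
  intro w
  change ContDiff ℝ ∞ (fun T : Eucl n →L[ℝ] Eucl 4 => inner ℝ (T v) (T w))
  exact ContDiff.inner ℝ (by fun_prop) (by fun_prop)

/-- In a trivialization the round metric is the pull-back of the inner product of ℝ⁴ by the
derivative of the inclusion. That derivative is smooth in coordinates, and pulling back depends
smoothly on the linear map. -/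
lemma contMDiff_bilinear {E : S3 → ℝ} (hE : ContMDiff (𝓡 3) 𝓘(ℝ, ℝ) ∞ E) :
    ContMDiff (𝓡 3) ((𝓡 3).prod 𝓘(ℝ, Eucl 3 →L[ℝ] Eucl 3 →L[ℝ] ℝ)) ∞
      (fun p : S3 => Bundle.TotalSpace.mk' (Eucl 3 →L[ℝ] Eucl 3 →L[ℝ] ℝ)
        (E := fun p : S3 => TangentSpace (𝓡 3) p →L[ℝ] TangentSpace (𝓡 3) p →L[ℝ] ℝ) p
        (E p • roundInner p)) := by
  intro p₀
  rw [contMDiffAt_hom_bundle]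
  refine ⟨contMDiffAt_id, ?_⟩
  have hD := (contMDiff_coe p₀).mfderiv_const (m := ∞) (by simp)
  have hflip : ContDiff ℝ ∞ (pullbackInner (n := 3)) := contDiff_pullbackInner
  have h := (hE p₀).smul (hflip.contMDiff.contMDiffAt.comp p₀ hD)
  refine h.congr_of_eventuallyEq ?_
  filter_upwards [(trivializationAt (Eucl 3) (TangentSpace (𝓡 3)) p₀).open_baseSet.mem_nhds
    (FiberBundle.mem_baseSet_trivializationAt' p₀)] with p hp
  ext v w
  rw [inCoordinates_apply_eq₂ hp hp (Set.mem_univ p)]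
  simp [roundInner_apply, inTangentCoordinates, ContinuousLinearMap.inCoordinates]
  left
  rw [← Bundle.Trivialization.symmL_apply (R := ℝ) _ hp, ← Bundle.Trivialization.symmL_apply (R := ℝ) _ hp]
  rfl

lemma isVonNBounded_roundInner {p : S3} {c : ℝ} (hc : 0 < c) :
    Bornology.IsVonNBounded ℝ {v : TangentSpace (𝓡 3) p | (c • roundInner p) v v < 1} := by
  let L : Eucl 3 →L[ℝ] Eucl 4 := sphereDeriv p
  obtain ⟨K, -, hK⟩ := (L : Eucl 3 →ₗ[ℝ] Eucl 4).exists_antilipschitzWith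
    (LinearMap.ker_eq_bot.2 (sphereDeriv_injective p))
  have h : Bornology.IsVonNBounded ℝ {v : Eucl 3 | c * inner ℝ (L v) (L v) < 1} := by
    refine NormedSpace.isVonNBounded_of_isBounded ℝ
      (isBounded_iff_forall_norm_le.2 ⟨K * Real.sqrt c⁻¹, fun v hv => ?_⟩)
    have h1 : ‖v‖ ≤ K * ‖L v‖ := by simpa using hK.le_mul_dist v 0
    have h2 : ‖L v‖ ≤ Real.sqrt c⁻¹ := by
      apply Real.le_sqrt_of_sq_le
      have h3 : c * inner ℝ (L v) (L v) < 1 := hv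
      rw [← real_inner_self_eq_norm_sq, ← one_div, le_div_iff₀ hc]
      linarith
    exact h1.trans (by gcongr)
  exact h

/-- The metric `E g` which is conformal to the round metric `g`. -/
def conformalRoundMetric (E : S3 → ℝ) (hE : ContMDiff (𝓡 3) 𝓘(ℝ, ℝ) ∞ E) (hpos : ∀ p, 0 < E p) :
    RiemMetric 3 S3 where
  inner p := E p • roundInner p
  symm p v w := by
    simp [roundInner_apply, real_inner_comm]
  pos p v hv := by
    have : sphereDeriv p v ≠ 0 := fun h => hv (sphereDeriv_injective p (by rw [h, map_zero]))
    change 0 < E p * inner ℝ (sphereDeriv p v) (sphereDeriv p v)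
    exact mul_pos (hpos p) (real_inner_self_pos.2 this)
  isVonNBounded p := isVonNBounded_roundInner (hpos p)
  contMDiff := contMDiff_bilinear hE

/-- The metric `e^{2Ψ(h)} g`, where `g` is the round metric and `h = |z₁|² - |z₂|²`. -/
def quadricMetric (Ψ : ℝ → ℝ) (hΨ : ContDiff ℝ ∞ Ψ) : RiemMetric 3 S3 :=
  conformalRoundMetric (fun p => Real.exp (2 * Ψ (cliffordForm p)))
    ((Real.contDiff_exp.comp (contDiff_const.mul
      (hΨ.comp contDiff_cliffordForm))).contMDiff.comp contMDiff_coe) (fun _ => Real.exp_pos _)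

lemma quadricMetric_inner {Ψ : ℝ → ℝ} (hΨ : ContDiff ℝ ∞ Ψ) (p : S3)
    (v w : TangentSpace (𝓡 3) p) :
    (quadricMetric Ψ hΨ).inner p v w =
      Real.exp (2 * Ψ (cliffordForm p)) * inner ℝ (sphereDeriv p v) (sphereDeriv p w) := rfl

/-! ### Stereographic charts -/

/-- The isometry of `ℝ³` onto the orthogonal complement of `p` which the preferred chart at `p`
uses. -/
def stereoIso (p : S3) : Eucl 3 →ₗᵢ[ℝ] Eucl 4 :=
  (Submodule.subtypeₗᵢ (ℝ ∙ ((-p : S3) : Eucl 4))ᗮ).comp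
    (OrthonormalBasis.fromOrthogonalSpanSingleton 3
      (ne_zero_of_mem_unit_sphere (-p))).repr.symm.toLinearIsometry

lemma stereoIso_apply (p : S3) (y : Eucl 3) :
    stereoIso p y = ((OrthonormalBasis.fromOrthogonalSpanSingleton 3
      (ne_zero_of_mem_unit_sphere (-p))).repr.symm y : Eucl 4) := rfl

lemma inner_stereoIso (p : S3) (y : Eucl 3) : inner ℝ (stereoIso p y) (p : Eucl 4) = 0 := by
  have h := Submodule.mem_orthogonal_singleton_iff_inner_left.1
    ((OrthonormalBasis.fromOrthogonalSpanSingleton 3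
      (ne_zero_of_mem_unit_sphere (-p))).repr.symm y).2
  rw [← stereoIso_apply] at h
  simpa using h

lemma norm_coe_S3 (p : S3) : ‖(p : Eucl 4)‖ = 1 := norm_eq_of_mem_sphere p

lemma coe_extChartAt_symm (p : S3) (y : Eucl 3) :
    ((extChartAt (𝓡 3) p).symm y : Eucl 4) = invStereo (stereoIso p) p y := by
  have h := stereographic'_symm_apply (n := 3) (-p) y
  have h2 : ((extChartAt (𝓡 3) p).symm y : Eucl 4) = ((stereographic' 3 (-p)).symm y : Eucl 4) := rfl
  have h3 : ‖stereoIso p y‖ = ‖y‖ := (stereoIso p).norm_map y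
  have h4 : ((-p : S3) : Eucl 4) = -(p : Eucl 4) := rfl
  rw [h2, h, invStereo, ← h3]
  simp only [← stereoIso_apply, h4]
  module

lemma extChartAt_self (p : S3) : extChartAt (𝓡 3) p p = 0 := by
  have h : extChartAt (𝓡 3) p p = stereographic' 3 (-p) p := rfl
  have h2 : stereographic' 3 (-p) p = (OrthonormalBasis.fromOrthogonalSpanSingleton 3
      (ne_zero_of_mem_unit_sphere (-p))).repr
      (stereographic (norm_eq_of_mem_sphere (-p)) p) := rfl
  rw [h, h2, stereographic_neg_apply, map_zero]

lemma extChartAt_target_S3 (p : S3) : (extChartAt (𝓡 3) p).target = Set.univ := by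
  have : (chartAt (Eucl 3) p).target = Set.univ := stereographic'_target (n := 3) (-p)
  simp [this]

lemma sphereDeriv_extChartAt_symm (p : S3) (y a : Eucl 3) :
    sphereDeriv ((extChartAt (𝓡 3) p).symm y)
      (mfderiv 𝓘(ℝ, Eucl 3) (𝓡 3) (extChartAt (𝓡 3) p).symm y a) =
      invStereoDeriv (stereoIso p) p y a := by
  have hs : MDifferentiableAt 𝓘(ℝ, Eucl 3) (𝓡 3) (extChartAt (𝓡 3) p).symm y := by
    have h := (contMDiffOn_extChartAt_symm (I := 𝓡 3) (n := ∞) p)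
    rw [extChartAt_target_S3] at h
    exact (h.contMDiffAt Filter.univ_mem).mdifferentiableAt (by simp)
  have hc := (contMDiff_coe ((extChartAt (𝓡 3) p).symm y)).mdifferentiableAt (by simp)
  have h := mfderiv_comp y hc hs
  have h2 : (fun q : S3 => (q : Eucl 4)) ∘ (extChartAt (𝓡 3) p).symm = invStereo (stereoIso p) p :=
    funext (coe_extChartAt_symm p)
  rw [h2, mfderiv_eq_fderiv] at h
  rw [← fderiv_invStereo, h]
  rfl

/-- At its own centre the inverse chart has derivative `stereoIso p`, so chart components are
coordinates in an orthonormal basis of the complement of p. -/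
lemma sphereDeriv_eq_stereoIso (p : S3) (v : TangentSpace (𝓡 3) p) :
    sphereDeriv p v = stereoIso p (chartVec p v) := by
  have hc : MDifferentiableAt (𝓡 3) 𝓘(ℝ, Eucl 3) (extChartAt (𝓡 3) p) p :=
    (contMDiffAt_extChartAt (I := 𝓡 3) (n := ∞)).mdifferentiableAt (by simp)
  have hS : MDifferentiableAt 𝓘(ℝ, Eucl 3) 𝓘(ℝ, Eucl 4) (invStereo (stereoIso p) p)
      (extChartAt (𝓡 3) p p) :=
    (differentiableAt_of_contDiff contDiff_invStereo _).mdifferentiableAt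
  have h := mfderiv_comp p hS hc
  have h2 : (fun q : S3 => (q : Eucl 4)) =ᶠ[nhds p]
      invStereo (stereoIso p) p ∘ extChartAt (𝓡 3) p := by
    filter_upwards [extChartAt_source_mem_nhds (I := 𝓡 3) p] with q hq
    rw [Function.comp_apply, ← coe_extChartAt_symm, (extChartAt (𝓡 3) p).left_inv hq]
  rw [sphereDeriv, h2.mfderiv_eq, h, mfderiv_eq_fderiv, extChartAt_self]
  change fderiv ℝ (invStereo (stereoIso p) p) 0 (chartVec p v) = _
  rw [fderiv_invStereo, invStereoDeriv_zero]

lemma chartMetric_quadricMetric {Ψ : ℝ → ℝ} (hΨ : ContDiff ℝ ∞ Ψ) (p : S3) :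
    chartMetric (quadricMetric Ψ hΨ) p = conformalMatrix (stereoExponent (stereoIso p) p Ψ) := by
  funext y
  ext i j
  simp only [chartMetric, Matrix.of_apply]
  rw [quadricMetric_inner]
  erw [sphereDeriv_extChartAt_symm, sphereDeriv_extChartAt_symm]
  rw [inner_invStereoDeriv (norm_coe_S3 p) (inner_stereoIso p), coe_extChartAt_symm,
    conformalMatrix, exp_stereoExponent, inner_stdVec_stdVec]
  simp [Matrix.one_apply]

lemma ricci_quadricMetric {Ψ : ℝ → ℝ} (hΨ : ContDiff ℝ ∞ Ψ) (p : S3) (v : TangentSpace (𝓡 3) p) :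
    ricci (quadricMetric Ψ hΨ) p v v =
      ricciForm (cliffordForm p) (deriv Ψ (cliffordForm p)) (deriv (deriv Ψ) (cliffordForm p))
        (‖sphereDeriv p v‖ ^ 2) (inner ℝ (flipSnd p) (sphereDeriv p v))
        (cliffordForm (sphereDeriv p v)) := by
  rw [ricci, chartMetric_quadricMetric, extChartAt_self,
    ricci_stereo (norm_coe_S3 p) (inner_stereoIso p) hΨ, sphereDeriv_eq_stereoIso, ricciForm]

end StableTori

end

noncomputable section

namespace StableTori

/-! ### The coordinates around the Clifford torus -/

lemma cliffordForm_eq (v : Eucl 4) : cliffordForm v = v 0 ^ 2 + v 1 ^ 2 - (v 2 ^ 2 + v 3 ^ 2) := by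
  rw [cliffordForm, inner_flipSnd]; ring

lemma normSq_S3 (p : S3) :
    (p : Eucl 4) 0 ^ 2 + (p : Eucl 4) 1 ^ 2 + ((p : Eucl 4) 2 ^ 2 + (p : Eucl 4) 3 ^ 2) = 1 := by
  have h := real_inner_self_eq_norm_sq (p : Eucl 4)
  rw [norm_coe_S3, inner_eucl4] at h
  linarith

lemma mem_cliffordTorus_iff (p : S3) : p ∈ cliffordTorus ↔ cliffordForm p = 0 := by
  have h := normSq_S3 p
  rw [cliffordForm_eq]
  constructor
  · rintro ⟨h1, h2⟩
    rw [h1, h2, sub_self]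
  · intro h1
    exact ⟨by linarith, by linarith⟩

lemma signedDist_bounds (p : S3) :
    signedDist p ∈ Set.Icc (-(Real.pi / 4)) (Real.pi / 4) := by
  have h1 : 0 ≤ Real.arcsin (Real.sqrt ((p : Eucl 4) 0 ^ 2 + (p : Eucl 4) 1 ^ 2)) :=
    Real.arcsin_nonneg.2 (Real.sqrt_nonneg _)
  have h2 := Real.arcsin_le_pi_div_two (Real.sqrt ((p : Eucl 4) 0 ^ 2 + (p : Eucl 4) 1 ^ 2))
  exact ⟨by rw [signedDist]; linarith, by rw [signedDist]; linarith⟩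

lemma sin_signedDist_add (p : S3) :
    Real.sin (signedDist p + Real.pi / 4) = Real.sqrt ((p : Eucl 4) 0 ^ 2 + (p : Eucl 4) 1 ^ 2) := by
  have h := normSq_S3 p
  rw [signedDist, sub_add_cancel, Real.sin_arcsin]
  · linarith [Real.sqrt_nonneg ((p : Eucl 4) 0 ^ 2 + (p : Eucl 4) 1 ^ 2)]
  · rw [Real.sqrt_le_one]
    nlinarith

lemma cos_signedDist_add (p : S3) :
    Real.cos (signedDist p + Real.pi / 4) = Real.sqrt ((p : Eucl 4) 2 ^ 2 + (p : Eucl 4) 3 ^ 2) := by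
  have h := normSq_S3 p
  rw [signedDist, sub_add_cancel, Real.cos_arcsin, Real.sq_sqrt (by positivity)]
  congr 1
  linarith

/-- With |z₁| = sin(t + π/4) and |z₂| = cos(t + π/4), the difference of squares is -cos(2t + π/2).
This replaces t by a polynomial, smooth everywhere. -/
lemma sin_two_signedDist (p : S3) : Real.sin (2 * signedDist p) = cliffordForm p := by
  have h1 : 2 * signedDist p = 2 * (signedDist p + Real.pi / 4) - Real.pi / 2 := by ring
  rw [h1, Real.sin_sub_pi_div_two, Real.cos_two_mul', sin_signedDist_add, cos_signedDist_add,
    Real.sq_sqrt (by positivity), Real.sq_sqrt (by positivity), cliffordForm_eq]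
  ring

lemma signedDist_eq_arcsin (p : S3) : signedDist p = Real.arcsin (cliffordForm p) / 2 := by
  have h := signedDist_bounds p
  rw [← sin_two_signedDist, Real.arcsin_sin (by linarith [h.1]) (by linarith [h.2])]
  ring

lemma cliffordForm_torusCoord (x : Eucl 2) (t : ℝ) :
    cliffordForm (torusCoord x t) = Real.sin (2 * t) := by
  have h1 : 2 * t = 2 * (t + Real.pi / 4) - Real.pi / 2 := by ring
  rw [h1, Real.sin_sub_pi_div_two, Real.cos_two_mul', cliffordForm_eq]
  simp only [torusCoord, Matrix.cons_val, PiLp.toLp_apply]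
  have h2 := Real.sin_sq_add_cos_sq (Real.sqrt 2 * x 0)
  have h3 := Real.sin_sq_add_cos_sq (Real.sqrt 2 * x 1)
  linear_combination Real.sin (t + Real.pi / 4) ^ 2 * h2 - Real.cos (t + Real.pi / 4) ^ 2 * h3

lemma signedDist_torusCoord (x : Eucl 2) {t : ℝ}
    (ht : t ∈ Set.Ioo (-(Real.pi / 4)) (Real.pi / 4)) : signedDist (torusCoord x t) = t := by
  rw [signedDist_eq_arcsin, cliffordForm_torusCoord,
    Real.arcsin_sin (by linarith [ht.1]) (by linarith [ht.2])]
  ring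

lemma cliffordForm_cliffordMap (x : Eucl 2) : cliffordForm (cliffordMap x) = 0 := by
  rw [cliffordMap, cliffordForm_torusCoord]; simp

lemma exists_cos_sin {a b : ℝ} (h : a ^ 2 + b ^ 2 = 1) :
    ∃ θ : ℝ, a = Real.cos θ ∧ b = Real.sin θ := by
  have hn : ‖(⟨a, b⟩ : ℂ)‖ = 1 := by
    rw [Complex.norm_def, Complex.normSq_mk, ← sq, ← sq, h, Real.sqrt_one]
  have h0 : (⟨a, b⟩ : ℂ) ≠ 0 := norm_ne_zero_iff.1 (by rw [hn]; exact one_ne_zero)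
  exact ⟨Complex.arg ⟨a, b⟩, by rw [Complex.cos_arg h0, hn, div_one],
    by rw [Complex.sin_arg, hn, div_one]⟩

lemma exists_polar (a b : ℝ) :
    ∃ θ : ℝ, a = Real.sqrt (a ^ 2 + b ^ 2) * Real.cos θ ∧
      b = Real.sqrt (a ^ 2 + b ^ 2) * Real.sin θ := by
  rcases eq_or_ne (Real.sqrt (a ^ 2 + b ^ 2)) 0 with h | h
  · have h2 : a ^ 2 + b ^ 2 = 0 := (Real.sqrt_eq_zero (by positivity)).1 h
    refine ⟨0, ?_, ?_⟩
    · rw [h]; nlinarith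
    · rw [h]; nlinarith
  · have hs := Real.sq_sqrt (show 0 ≤ a ^ 2 + b ^ 2 by positivity)
    obtain ⟨θ, h1, h2⟩ := exists_cos_sin
      (a := a / Real.sqrt (a ^ 2 + b ^ 2)) (b := b / Real.sqrt (a ^ 2 + b ^ 2)) (by
        rw [div_pow, div_pow, ← add_div, hs]
        refine div_self ?_
        rw [← hs]
        positivity)
    exact ⟨θ, by rw [← h1]; field_simp, by rw [← h2]; field_simp⟩

lemma exists_torusCoord (p : S3) : ∃ x : Eucl 2, torusCoord x (signedDist p) = p := by
  obtain ⟨θ, h0, h1⟩ := exists_polar ((p : Eucl 4) 0) ((p : Eucl 4) 1)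
  obtain ⟨φ, h2, h3⟩ := exists_polar ((p : Eucl 4) 2) ((p : Eucl 4) 3)
  refine ⟨!₂[θ / Real.sqrt 2, φ / Real.sqrt 2], ?_⟩
  have hθ : Real.sqrt 2 * (θ / Real.sqrt 2) = θ := by field_simp
  have hφ : Real.sqrt 2 * (φ / Real.sqrt 2) = φ := by field_simp
  apply Subtype.ext
  ext i
  simp only [torusCoord, sin_signedDist_add, cos_signedDist_add]
  fin_cases i
  · simpa [hθ] using h0.symm
  · simpa [hθ] using h1.symm
  · simpa [hφ] using h2.symm
  · simpa [hφ] using h3.symm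

lemma range_cliffordMap : Set.range cliffordMap = cliffordTorus := by
  ext p
  rw [mem_cliffordTorus_iff]
  constructor
  · rintro ⟨x, rfl⟩
    exact cliffordForm_cliffordMap x
  · intro h
    obtain ⟨x, hx⟩ := exists_torusCoord p
    rw [signedDist_eq_arcsin, h, Real.arcsin_zero, zero_div] at hx
    exact ⟨x, hx⟩

lemma torusCoord_eq_iff {x y : Eucl 2} {t : ℝ} (hs : Real.sin (t + Real.pi / 4) ≠ 0)
    (hc : Real.cos (t + Real.pi / 4) ≠ 0) : torusCoord x t = torusCoord y t ↔
      ∀ i, Real.cos (Real.sqrt 2 * x i) = Real.cos (Real.sqrt 2 * y i) ∧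
        Real.sin (Real.sqrt 2 * x i) = Real.sin (Real.sqrt 2 * y i) := by
  rw [Fin.forall_fin_two, Subtype.ext_iff, PiLp.ext_iff]
  simp [torusCoord, Fin.forall_fin_succ, hs, hc]
  tauto

lemma cos_sin_eq_iff (a b : ℝ) : (Real.cos a = Real.cos b ∧ Real.sin a = Real.sin b) ↔
    ∃ m : ℤ, b = a + m * (2 * Real.pi) := by
  constructor
  · rintro ⟨h1, h2⟩
    obtain ⟨k, hk⟩ := Real.Angle.angle_eq_iff_two_pi_dvd_sub.1 (Real.Angle.cos_sin_inj h1 h2)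
    exact ⟨-k, by push_cast; linarith⟩
  · rintro ⟨m, rfl⟩
    simp

lemma sin_pi_div_four_ne : Real.sin (0 + Real.pi / 4) ≠ 0 := by
  rw [zero_add, Real.sin_pi_div_four]; positivity

lemma cos_pi_div_four_ne : Real.cos (0 + Real.pi / 4) ≠ 0 := by
  rw [zero_add, Real.cos_pi_div_four]; positivity

lemma sqrt_two_period (a : ℝ) (m : ℤ) :
    Real.sqrt 2 * (a + m * (Real.sqrt 2 * Real.pi)) = Real.sqrt 2 * a + m * (2 * Real.pi) := by
  have h : Real.sqrt 2 * Real.sqrt 2 = 2 := Real.mul_self_sqrt (by norm_num)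
  linear_combination m * Real.pi * h

lemma cliffordMap_eq_iff (x y : Eucl 2) : cliffordMap x = cliffordMap y ↔
    ∀ i, ∃ m : ℤ, y i = x i + m * cliffordPeriods i := by
  rw [cliffordMap, cliffordMap, torusCoord_eq_iff sin_pi_div_four_ne cos_pi_div_four_ne]
  refine forall_congr' fun i => ?_
  rw [cos_sin_eq_iff]
  refine exists_congr fun m => ?_
  have h0 : Real.sqrt 2 ≠ 0 := by positivity
  rw [← sqrt_two_period, mul_right_inj' h0, cliffordPeriods]

lemma torusCoord_add_period (x : Eucl 2) (i : Fin 2) :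
    torusCoord (x + cliffordPeriods i • stdVec i) = torusCoord x := by
  have h := sqrt_two_period (x i) 1
  rw [Int.cast_one, one_mul, one_mul] at h
  funext t
  apply Subtype.ext
  ext k
  fin_cases i <;> fin_cases k <;> simp [torusCoord, cliffordPeriods, stdVec] <;>
    simp_all

/-! ### The distance to the Clifford torus -/

/-- Cauchy–Schwarz in each factor ℂ bounds the inner product by (|z₁| + |z₂|)/√2, which is cos t by
the addition formula. -/
lemma inner_le_cos_signedDist (p q : S3) (hq : q ∈ cliffordTorus) :
    inner ℝ (p : Eucl 4) (q : Eucl 4) ≤ Real.cos (signedDist p) := by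
  have h1 : signedDist p = signedDist p + Real.pi / 4 - Real.pi / 4 := by ring
  rw [h1, Real.cos_sub, sin_signedDist_add, cos_signedDist_add, Real.cos_pi_div_four,
    Real.sin_pi_div_four, inner_eucl4]
  have cs : ∀ a b c d : ℝ, c ^ 2 + d ^ 2 = 1 / 2 →
      a * c + b * d ≤ Real.sqrt (a ^ 2 + b ^ 2) * (Real.sqrt 2 / 2) := by
    intro a b c d hcd
    have h2 : Real.sqrt 2 / 2 = Real.sqrt (1 / 2) := by
      rw [Real.sqrt_div' _ (by norm_num)]
      have : Real.sqrt 2 * Real.sqrt 2 = 2 := Real.mul_self_sqrt (by norm_num)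
      field_simp
      simp
    rw [h2, ← Real.sqrt_mul (by positivity)]
    apply Real.le_sqrt_of_sq_le
    nlinarith [sq_nonneg (a * d - b * c)]
  have h3 := cs ((p : Eucl 4) 0) ((p : Eucl 4) 1) _ _ hq.1
  have h4 := cs ((p : Eucl 4) 2) ((p : Eucl 4) 3) _ _ hq.2
  linarith

lemma inner_torusCoord (x : Eucl 2) (s t : ℝ) :
    inner ℝ (torusCoord x s : Eucl 4) (torusCoord x t : Eucl 4) = Real.cos (s - t) := by
  have h : s - t = (s + Real.pi / 4) - (t + Real.pi / 4) := by ring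
  rw [h, Real.cos_sub, inner_eucl4]
  simp only [torusCoord, Matrix.cons_val, PiLp.toLp_apply]
  have h2 := Real.sin_sq_add_cos_sq (Real.sqrt 2 * x 0)
  have h3 := Real.sin_sq_add_cos_sq (Real.sqrt 2 * x 1)
  linear_combination Real.sin (s + Real.pi / 4) * Real.sin (t + Real.pi / 4) * h2
    + Real.cos (s + Real.pi / 4) * Real.cos (t + Real.pi / 4) * h3

lemma isLeast_angle_cliffordTorus (p : S3) : IsLeast
    ((fun q : S3 => InnerProductGeometry.angle (p : Eucl 4) (q : Eucl 4)) '' cliffordTorus)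
    |signedDist p| := by
  have hb := signedDist_bounds p
  have habs : |signedDist p| ≤ Real.pi := abs_le.2
    ⟨by linarith [hb.1, Real.pi_pos], by linarith [hb.2, Real.pi_pos]⟩
  have hang : ∀ q : S3, InnerProductGeometry.angle (p : Eucl 4) (q : Eucl 4) =
      Real.arccos (inner ℝ (p : Eucl 4) (q : Eucl 4)) := fun q => by
    rw [InnerProductGeometry.angle, norm_coe_S3, norm_coe_S3, mul_one, div_one]
  have harc : |signedDist p| = Real.arccos (Real.cos (signedDist p)) := by
    rw [← Real.cos_abs, Real.arccos_cos (abs_nonneg _) habs]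
  constructor
  · obtain ⟨x, hx⟩ := exists_torusCoord p
    refine ⟨cliffordMap x, by rw [← range_cliffordMap]; exact ⟨x, rfl⟩, ?_⟩
    -- The nearest point of the torus has the same two angles: t ↦ Φ(x, t) is a great circle of unit
    -- speed.
    have h := inner_torusCoord x (signedDist p) 0
    rw [hx, sub_zero] at h
    simp only [hang]
    rw [cliffordMap, h, harc]
  · rintro _ ⟨q, hq, rfl⟩
    simp only [hang]
    rw [harc]
    exact Real.antitone_arccos (inner_le_cos_signedDist p q hq)

end StableTori

end

noncomputable section

namespace StableTori

/-! ### Differential geometry of the Clifford torus -/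

/-- The coordinates `torusCoord` as a map into `ℝ⁴`. -/
def torusVec (z : Eucl 2 × ℝ) : Eucl 4 :=
  !₂[Real.sin (z.2 + Real.pi / 4) * Real.cos (Real.sqrt 2 * z.1 0),
      Real.sin (z.2 + Real.pi / 4) * Real.sin (Real.sqrt 2 * z.1 0),
      Real.cos (z.2 + Real.pi / 4) * Real.cos (Real.sqrt 2 * z.1 1),
      Real.cos (z.2 + Real.pi / 4) * Real.sin (Real.sqrt 2 * z.1 1)]

lemma contDiff_torusVec : ContDiff ℝ ∞ torusVec := by
  rw [contDiff_euclidean]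
  intro i
  fin_cases i <;> simp [torusVec] <;> fun_prop

lemma contMDiff_torusCoord :
    ContMDiff 𝓘(ℝ, Eucl 2 × ℝ) (𝓡 3) ∞ (fun z : Eucl 2 × ℝ => torusCoord z.1 z.2) :=
  contDiff_torusVec.contMDiff.codRestrict_sphere (n := 3) (fun z => (torusCoord z.1 z.2).2)

/-- The Clifford torus as a map into `ℝ⁴`. -/
def cliffordVec (x : Eucl 2) : Eucl 4 := torusVec (x, 0)

lemma contDiff_cliffordVec : ContDiff ℝ ∞ cliffordVec :=
  contDiff_torusVec.comp (by fun_prop)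

lemma contMDiff_cliffordMap : ContMDiff 𝓘(ℝ, Eucl 2) (𝓡 3) ∞ cliffordMap :=
  contDiff_cliffordVec.contMDiff.codRestrict_sphere (n := 3) (fun x => (cliffordMap x).2)

lemma coe_cliffordMap (x : Eucl 2) : (cliffordMap x : Eucl 4) = cliffordVec x := rfl

lemma cliffordVec_eq (x : Eucl 2) : cliffordVec x =
    !₂[Real.sqrt 2 / 2 * Real.cos (Real.sqrt 2 * x 0), Real.sqrt 2 / 2 * Real.sin (Real.sqrt 2 * x 0),
      Real.sqrt 2 / 2 * Real.cos (Real.sqrt 2 * x 1),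
      Real.sqrt 2 / 2 * Real.sin (Real.sqrt 2 * x 1)] := by
  simp [cliffordVec, torusVec]

lemma sphereDeriv_mfderiv_cliffordMap (x a : Eucl 2) :
    sphereDeriv (cliffordMap x) (mfderiv 𝓘(ℝ, Eucl 2) (𝓡 3) cliffordMap x a) =
      fderiv ℝ cliffordVec x a := by
  have hX := (contMDiff_cliffordMap x).mdifferentiableAt (by simp)
  have hc := (contMDiff_coe (cliffordMap x)).mdifferentiableAt (by simp)
  have h := mfderiv_comp x hc hX
  have h2 : (fun q : S3 => (q : Eucl 4)) ∘ cliffordMap = cliffordVec := rfl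
  rw [h2, mfderiv_eq_fderiv] at h
  rw [h]
  rfl

lemma fderiv_euclidean_apply {E : Type*} [NormedAddCommGroup E] [NormedSpace ℝ E] {n : ℕ}
    {f : E → Eucl n} {x : E} (hf : DifferentiableAt ℝ f x) (a : E) (k : Fin n) :
    fderiv ℝ f x a k = fderiv ℝ (fun z => f z k) x a := by
  have h : HasFDerivAt (fun z => f z k) _ x :=
    (EuclideanSpace.proj k : Eucl n →L[ℝ] ℝ).hasFDerivAt.comp x hf.hasFDerivAt
  rw [h.fderiv]
  rfl

lemma hasFDerivAt_coord {n : ℕ} (c : ℝ) (i : Fin n) (x : Eucl n) :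
    HasFDerivAt (fun z : Eucl n => c * z i)
      (c • (EuclideanSpace.proj i : Eucl n →L[ℝ] ℝ)) x :=
  (EuclideanSpace.proj i : Eucl n →L[ℝ] ℝ).hasFDerivAt.const_mul c

lemma fderiv_cliffordVec (x a : Eucl 2) : fderiv ℝ cliffordVec x a =
    !₂[-Real.sin (Real.sqrt 2 * x 0) * a 0, Real.cos (Real.sqrt 2 * x 0) * a 0,
      -Real.sin (Real.sqrt 2 * x 1) * a 1, Real.cos (Real.sqrt 2 * x 1) * a 1] := by
  have h2 : Real.sqrt 2 * Real.sqrt 2 = 2 := Real.mul_self_sqrt (by norm_num)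
  have hc : ∀ i, fderiv ℝ (fun z : Eucl 2 => Real.sqrt 2 / 2 * Real.cos (Real.sqrt 2 * z i)) x a =
      -Real.sin (Real.sqrt 2 * x i) * a i := fun i => by
    rw [((hasFDerivAt_coord _ i x).cos.const_mul _).fderiv]
    simp
    linear_combination Real.sin (Real.sqrt 2 * x i) * a i / 2 * h2
  have hs : ∀ i, fderiv ℝ (fun z : Eucl 2 => Real.sqrt 2 / 2 * Real.sin (Real.sqrt 2 * z i)) x a =
      Real.cos (Real.sqrt 2 * x i) * a i := fun i => by
    rw [((hasFDerivAt_coord _ i x).sin.const_mul _).fderiv]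
    simp
    linear_combination Real.cos (Real.sqrt 2 * x i) * a i / 2 * h2
  have hd := (differentiableAt_of_contDiff contDiff_cliffordVec x)
  ext k
  rw [fderiv_euclidean_apply hd]
  simp only [cliffordVec_eq]
  fin_cases k
  · exact hc 0
  · exact hs 0
  · exact hc 1
  · exact hs 1

lemma inner_fderiv_cliffordVec (x a b : Eucl 2) :
    inner ℝ (fderiv ℝ cliffordVec x a) (fderiv ℝ cliffordVec x b) = a 0 * b 0 + a 1 * b 1 := by
  rw [fderiv_cliffordVec, fderiv_cliffordVec, inner_eucl4]
  simp only [Matrix.cons_val]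
  have h2 := Real.sin_sq_add_cos_sq (Real.sqrt 2 * x 0)
  have h3 := Real.sin_sq_add_cos_sq (Real.sqrt 2 * x 1)
  linear_combination a 0 * b 0 * h2 + a 1 * b 1 * h3

/-- Differentiation in t turns (sin, cos) into (cos, -sin), and at π/4 sine and cosine agree, so
only the sign of z₂ changes. -/
lemma sphereDeriv_cliffordNormal (x : Eucl 2) :
    sphereDeriv (cliffordMap x) (cliffordNormal x) = flipSnd (cliffordMap x) := by
  have h0 : ContDiff ℝ ∞ (fun t : ℝ => (x, t)) := by fun_prop
  have hT : ContMDiff 𝓘(ℝ, ℝ) (𝓡 3) ∞ (torusCoord x) :=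
    (contDiff_torusVec.comp h0).contMDiff.codRestrict_sphere (n := 3) (fun t => (torusCoord x t).2)
  have hX := (hT 0).mdifferentiableAt (by simp)
  have hc := (contMDiff_coe (cliffordMap x)).mdifferentiableAt (by simp)
  have h := mfderiv_comp (0 : ℝ) hc hX
  have h2 : (fun q : S3 => (q : Eucl 4)) ∘ torusCoord x = fun t => torusVec (x, t) := rfl
  rw [h2, mfderiv_eq_fderiv] at h
  have h3 : sphereDeriv (cliffordMap x) (cliffordNormal x) =
      fderiv ℝ (fun t => torusVec (x, t)) 0 (1 : ℝ) := by
    rw [h]; rfl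
  rw [h3]
  have hd : DifferentiableAt ℝ (fun t => torusVec (x, t)) 0 :=
    ((contDiff_torusVec.comp h0).differentiable (by simp)).differentiableAt
  ext k
  rw [fderiv_euclidean_apply hd, fderiv_apply_one_eq_deriv, coe_cliffordMap, cliffordVec_eq,
    flipSnd_apply]
  fin_cases k <;> simp [torusVec]

lemma eq_zero_of_mfderiv_cliffordMap (x a : Eucl 2)
    (ha : mfderiv 𝓘(ℝ, Eucl 2) (𝓡 3) cliffordMap x a = 0) : a = 0 := by
  have h := inner_fderiv_cliffordVec x a a
  rw [← sphereDeriv_mfderiv_cliffordMap, ha, map_zero, inner_zero_left] at h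
  have h0 : a 0 = 0 := by nlinarith
  have h1 : a 1 = 0 := by nlinarith
  ext i
  fin_cases i
  · exact h0
  · exact h1

lemma inner_flipSnd_fderiv_cliffordVec (x a : Eucl 2) :
    inner ℝ (flipSnd (cliffordMap x)) (fderiv ℝ cliffordVec x a) = 0 := by
  rw [fderiv_cliffordVec, coe_cliffordMap, cliffordVec_eq, inner_flipSnd]
  simp only [Matrix.cons_val]
  ring

lemma isImmersedTorus_cliffordMap : IsImmersedTorus (n := 3) cliffordPeriods cliffordMap where
  periods_pos _ := mul_pos (by positivity) Real.pi_pos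
  smooth := contMDiff_cliffordMap
  periodic x i := by rw [cliffordMap, torusCoord_add_period, cliffordMap]
  immersion x := by
    rw [injective_iff_map_eq_zero]
    exact eq_zero_of_mfderiv_cliffordMap x

/-- The normal field is the tangent map of (x, t) ↦ Φ(x, t) applied to the constant field ∂/∂t along
t = 0. -/
lemma contMDiff_cliffordNormal : ContMDiff 𝓘(ℝ, Eucl 2) (𝓡 3).tangent ∞
    (fun x => (⟨cliffordMap x, cliffordNormal x⟩ : TangentBundle (𝓡 3) S3)) := by
  let T : Eucl 2 × ℝ → S3 := fun z => torusCoord z.1 z.2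
  have hT := contMDiff_torusCoord.contMDiff_tangentMap (m := ∞) (by simp)
  have hs : ContMDiff 𝓘(ℝ, Eucl 2) 𝓘(ℝ, Eucl 2 × ℝ).tangent ∞
      (fun x : Eucl 2 => (⟨(x, 0), ((0 : Eucl 2), (1 : ℝ))⟩ :
        TangentBundle 𝓘(ℝ, Eucl 2 × ℝ) (Eucl 2 × ℝ))) := by
    have h : ContDiff ℝ ∞ (fun x : Eucl 2 => (x, (0 : ℝ))) := by fun_prop
    have hV := (contMDiff_vectorSpace_iff_contDiff (𝕜 := ℝ) (n := ∞)
      (V := fun _ : Eucl 2 × ℝ => ((0 : Eucl 2), (1 : ℝ)))).2 contDiff_const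
    exact hV.comp h.contMDiff
  have h := hT.comp hs
  refine h.congr fun x => ?_
  have hd : MDifferentiableAt 𝓘(ℝ, Eucl 2 × ℝ) (𝓡 3) T (x, 0) :=
    (contMDiff_torusCoord (x, 0)).mdifferentiableAt (by simp)
  have hi : MDifferentiableAt 𝓘(ℝ, ℝ) 𝓘(ℝ, Eucl 2 × ℝ) (fun t : ℝ => (x, t)) 0 :=
    (show DifferentiableAt ℝ (fun t : ℝ => (x, t)) 0 by fun_prop).mdifferentiableAt
  have hcomp := mfderiv_comp (0 : ℝ) hd hi
  have h1 : T ∘ (fun t : ℝ => (x, t)) = torusCoord x := rfl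
  have h2 : fderiv ℝ (fun t : ℝ => (x, t)) 0 (1 : ℝ) = ((0 : Eucl 2), (1 : ℝ)) := by
    rw [(hasFDerivAt_prodMk_right x (0 : ℝ)).fderiv]
    simp
  rw [h1, mfderiv_eq_fderiv] at hcomp
  have h3 : cliffordNormal x =
      mfderiv 𝓘(ℝ, Eucl 2 × ℝ) (𝓡 3) T (x, 0) ((0 : Eucl 2), (1 : ℝ)) := by
    rw [cliffordNormal, hcomp, ← h2]
    rfl
  rw [h3]
  rfl

lemma isUnitNormal_cliffordNormal {Ψ : ℝ → ℝ} (hΨ : ContDiff ℝ ∞ Ψ) (h0 : Ψ 0 = 0) :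
    IsUnitNormal (quadricMetric Ψ hΨ) cliffordPeriods cliffordMap cliffordNormal where
  smooth := contMDiff_cliffordNormal
  periodic x i := by
    -- The fibre containing the normal changes with the base point, so periodicity is transported
    -- through equality of the whole curves t ↦ Φ(x, t).
    have h : ∀ f f' : ℝ → S3, f = f' →
        (⟨f 0, mfderiv 𝓘(ℝ, ℝ) (𝓡 3) f 0 (1 : ℝ)⟩ : TangentBundle (𝓡 3) S3) =
          ⟨f' 0, mfderiv 𝓘(ℝ, ℝ) (𝓡 3) f' 0 (1 : ℝ)⟩ := by
      rintro f _ rfl; rfl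
    exact h _ _ (torusCoord_add_period x i)
  unit x := by
    rw [quadricMetric_inner, cliffordForm_cliffordMap, h0, sphereDeriv_cliffordNormal,
      norm_flipSnd_sq, real_inner_self_eq_norm_sq, norm_coe_S3]
    simp
  normal x a := by
    have h := inner_flipSnd_fderiv_cliffordVec x a
    rw [← sphereDeriv_mfderiv_cliffordMap x a] at h
    rw [quadricMetric_inner, sphereDeriv_cliffordNormal]
    exact mul_eq_zero_of_right _ h

lemma inducedMetric_cliffordMap {Ψ : ℝ → ℝ} (hΨ : ContDiff ℝ ∞ Ψ) (h0 : Ψ 0 = 0) (x : Eucl 2) :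
    inducedMetric (quadricMetric Ψ hΨ) cliffordMap x = 1 := by
  ext i j
  rw [inducedMetric, Matrix.of_apply, quadricMetric_inner, cliffordForm_cliffordMap, h0,
    sphereDeriv_mfderiv_cliffordMap, sphereDeriv_mfderiv_cliffordMap, inner_fderiv_cliffordVec]
  fin_cases i <;> fin_cases j <;> simp [stdVec]

end StableTori

end

noncomputable section

namespace StableTori

/-! ### The second fundamental form of the Clifford torus -/

lemma extChartAt_apply (p q : S3) (k : Fin 3) :
    extChartAt (𝓡 3) p q k =
      2 / (1 + inner ℝ (p : Eucl 4) (q : Eucl 4)) * inner ℝ (stereoIso p (stdVec k)) (q : Eucl 4) := by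
  set b := OrthonormalBasis.fromOrthogonalSpanSingleton (𝕜 := ℝ) 3 (ne_zero_of_mem_unit_sphere (-p)) with hb
  have h : extChartAt (𝓡 3) p q = b.repr (stereographic (norm_eq_of_mem_sphere (-p)) q) := rfl
  have h1 : ((b k : (ℝ ∙ ((-p : S3) : Eucl 4))ᗮ) : Eucl 4) = stereoIso p (stdVec k) := by
    rw [stereoIso_apply, stdVec, ← hb, OrthonormalBasis.repr_symm_single]
  rw [h, stereographic_apply, map_smul, PiLp.smul_apply, OrthonormalBasis.repr_apply_apply,
    Submodule.inner_orthogonalProjectionOnto_eq_of_mem_left, h1, smul_eq_mul]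
  congr 2
  have h4 : ((-p : S3) : Eucl 4) = -(p : Eucl 4) := rfl
  rw [h4, inner_neg_left, sub_neg_eq_add]

lemma pderiv_congr {n : ℕ} {f g : Eucl n → ℝ} {y : Eucl n} (h : f =ᶠ[nhds y] g) (i : Fin n) :
    pderiv i f y = pderiv i g y := by
  rw [pderiv, pderiv, h.fderiv_eq]

/-- This serves to discard the factor 2/(1 + ⟨p, q⟩) of the stereographic chart, which equals 1 to
first order along the torus at its centre. -/
lemma pderiv_pderiv_mul {n : ℕ} {u w : Eucl n → ℝ} {x : Eucl n} (hu : ContDiffAt ℝ ∞ u x)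
    (hw : ContDiff ℝ ∞ w) (hu0 : u x = 1) (hu1 : ∀ i, pderiv i u x = 0) (hw0 : w x = 0)
    (i j : Fin n) :
    pderiv i (pderiv j (fun z => u z * w z)) x = pderiv i (pderiv j w) x := by
  have hu' : ContDiffAt ℝ ∞ (pderiv j u) x :=
    (hu.fderiv_right (m := ∞) (by simp)).clm_apply contDiffAt_const
  have hdu := hu.differentiableAt (by simp)
  have hdu' := hu'.differentiableAt (by simp)
  have hdw := differentiableAt_of_contDiff hw
  have hdw' := differentiableAt_of_contDiff (contDiff_pderiv hw j)
  have h1 : pderiv j (fun z => u z * w z) =ᶠ[nhds x]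
      fun z => u z * pderiv j w z + w z * pderiv j u z := by
    have h2 := (hu.of_le (show (1 : WithTop ℕ∞) ≤ ∞ by simp)).eventually (by simp)
    filter_upwards [h2] with z hz
    exact pderiv_mul (hz.differentiableAt (by simp)) (hdw z) j
  rw [pderiv_congr h1, pderiv_add (f := fun z => u z * pderiv j w z) (g := fun z => w z * pderiv j u z)
      (hdu.mul (hdw' x)) ((hdw x).mul hdu'),
    pderiv_mul hdu (hdw' x), pderiv_mul (hdw x) hdu', hu0, hu1, hu1, hw0]
  ring

lemma chartVec_cliffordNormal (x : Eucl 2) :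
    stereoIso (cliffordMap x) (chartVec (cliffordMap x) (cliffordNormal x)) =
      flipSnd (cliffordMap x) := by
  rw [← sphereDeriv_eq_stereoIso, sphereDeriv_cliffordNormal]

lemma inner_flipSnd_cliffordVec (x z : Eucl 2) :
    inner ℝ (flipSnd (cliffordVec x)) (cliffordVec z) =
      1 / 2 * Real.cos (Real.sqrt 2 * z 0 - Real.sqrt 2 * x 0)
        - 1 / 2 * Real.cos (Real.sqrt 2 * z 1 - Real.sqrt 2 * x 1) := by
  have h2 : Real.sqrt 2 * Real.sqrt 2 = 2 := Real.mul_self_sqrt (by norm_num)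
  rw [inner_flipSnd, cliffordVec_eq, cliffordVec_eq, Real.cos_sub, Real.cos_sub]
  simp only [Matrix.cons_val]
  linear_combination (Real.cos (Real.sqrt 2 * x 0) * Real.cos (Real.sqrt 2 * z 0)
    + Real.sin (Real.sqrt 2 * x 0) * Real.sin (Real.sqrt 2 * z 0)
    - Real.cos (Real.sqrt 2 * x 1) * Real.cos (Real.sqrt 2 * z 1)
    - Real.sin (Real.sqrt 2 * x 1) * Real.sin (Real.sqrt 2 * z 1)) / 4 * h2

lemma inner_cliffordVec_fderiv (x a : Eucl 2) :
    inner ℝ (cliffordVec x) (fderiv ℝ cliffordVec x a) = 0 := by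
  rw [fderiv_cliffordVec, cliffordVec_eq, inner_eucl4]
  simp only [Matrix.cons_val]
  ring

lemma pderiv_pderiv_inner_flipSnd (x : Eucl 2) (i j : Fin 2) :
    pderiv i (pderiv j (fun z => inner ℝ (flipSnd (cliffordVec x)) (cliffordVec z))) x =
      !![-1, 0; 0, 1] i j := by
  have h2 : Real.sqrt 2 * Real.sqrt 2 = 2 := Real.mul_self_sqrt (by norm_num)
  have hc : ∀ k z, HasFDerivAt (fun z : Eucl 2 => 1 / 2 * Real.cos (Real.sqrt 2 * z k - Real.sqrt 2 * x k))
      _ z := fun k z => ((hasFDerivAt_coord (Real.sqrt 2) k z).sub_const _).cos.const_mul (1 / 2)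
  have hs : ∀ k z, HasFDerivAt (fun z : Eucl 2 => Real.sin (Real.sqrt 2 * z k - Real.sqrt 2 * x k))
      _ z := fun k z => ((hasFDerivAt_coord (Real.sqrt 2) k z).sub_const _).sin
  have h1 : pderiv j (fun z => inner ℝ (flipSnd (cliffordVec x)) (cliffordVec z)) = fun z =>
      Real.sin (Real.sqrt 2 * z 0 - Real.sqrt 2 * x 0) * (-(Real.sqrt 2 / 2) * if j = 0 then 1 else 0)
        + Real.sin (Real.sqrt 2 * z 1 - Real.sqrt 2 * x 1)
          * (Real.sqrt 2 / 2 * if j = 1 then 1 else 0) := by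
    funext z
    simp only [inner_flipSnd_cliffordVec]
    rw [pderiv_sub (hc 0 z).differentiableAt (hc 1 z).differentiableAt,
      pderiv_eq_of_hasFDerivAt (hc 0 z), pderiv_eq_of_hasFDerivAt (hc 1 z)]
    fin_cases j <;> simp [stdVec] <;> ring
  rw [h1, pderiv_add ((hs 0 x).differentiableAt.mul_const _) ((hs 1 x).differentiableAt.mul_const _),
    pderiv_mul_const (hs 0 x).differentiableAt, pderiv_mul_const (hs 1 x).differentiableAt,
    pderiv_eq_of_hasFDerivAt (hs 0 x), pderiv_eq_of_hasFDerivAt (hs 1 x)]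
  fin_cases i <;> fin_cases j <;> simp [stdVec] <;> linarith

/-- At the centre of the chart the metric is the identity and, as Ψ'(0) = 0, all Christoffel symbols
vanish. What remains is the Hessian at z = x of the height function z ↦ ⟨N(x), X(z)⟩ in ℝ⁴. -/
lemma secondFundamentalForm_cliffordMap {Ψ : ℝ → ℝ} (hΨ : ContDiff ℝ ∞ Ψ) (h0 : Ψ 0 = 0)
    (h1 : deriv Ψ 0 = 0) (x : Eucl 2) :
    secondFundamentalForm (quadricMetric Ψ hΨ) cliffordMap cliffordNormal x = !![-1, 0; 0, 1] := by
  set p := cliffordMap x with hp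
  have hk : cliffordForm p = 0 := cliffordForm_cliffordMap x
  have hG : conformalMatrix (stereoExponent (stereoIso p) p Ψ) 0 = 1 := by
    rw [conformalMatrix, exp_stereoExponent, invStereo_zero, hk, h0]
    norm_num
  have hΓ : ∀ k a b, christoffel (conformalMatrix (stereoExponent (stereoIso p) p Ψ)) k a b 0 = 0 := by
    intro k a b
    rw [christoffel_conformalMatrix (contDiff_stereoExponent hΨ)]
    simp [pderiv_stereoExponent_zero hΨ, hk, h1]
  have hξ : ∀ k i j, pderiv i (pderiv j (fun z => extChartAt (𝓡 3) p (cliffordMap z) k)) x =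
      pderiv i (pderiv j (fun z => inner ℝ (stereoIso p (stdVec k)) (cliffordVec z))) x := by
    intro k i j
    have hpp : inner ℝ (cliffordVec x) (cliffordVec x) = (1 : ℝ) := by
      rw [← coe_cliffordMap, real_inner_self_eq_norm_sq, norm_coe_S3, one_pow]
    have hin : ContDiff ℝ ∞ (fun z => 1 + inner ℝ (cliffordVec x) (cliffordVec z)) :=
      contDiff_const.add (contDiff_const.inner ℝ contDiff_cliffordVec)
    have hu : ContDiffAt ℝ ∞ (fun z => 2 / (1 + inner ℝ (cliffordVec x) (cliffordVec z))) x :=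
      contDiffAt_const.div hin.contDiffAt (by rw [hpp]; norm_num)
    have hw : ContDiff ℝ ∞ (fun z => inner ℝ (stereoIso p (stdVec k)) (cliffordVec z)) :=
      contDiff_const.inner ℝ contDiff_cliffordVec
    simp only [extChartAt_apply, coe_cliffordMap, hp]
    refine pderiv_pderiv_mul hu hw (by rw [hpp]; norm_num) ?_ (inner_stereoIso p _) i j
    intro l
    have hd := (differentiableAt_of_contDiff contDiff_cliffordVec x).hasFDerivAt
    have h2 := ((hasFDerivAt_const (cliffordVec x) x).inner ℝ hd).const_add 1
    have h3 : HasFDerivAt (fun z => 2 / (1 + inner ℝ (cliffordVec x) (cliffordVec z))) _ x :=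
      (((hasDerivAt_inv (show 1 + inner ℝ (cliffordVec x) (cliffordVec x) ≠ 0 by
        rw [hpp]; norm_num)).comp_hasFDerivAt x h2).const_mul 2)
    rw [pderiv_eq_of_hasFDerivAt h3]
    simp [fderivInnerCLM_apply, inner_cliffordVec_fderiv]
  set n := chartVec p (cliffordNormal x) with hn
  set w : Fin 3 → Eucl 2 → ℝ := fun k z => inner ℝ (stereoIso p (stdVec k)) (cliffordVec z)
  have hw : ∀ k, ContDiff ℝ ∞ (w k) := fun k => contDiff_const.inner ℝ contDiff_cliffordVec
  have hd := fun k => differentiableAt_of_contDiff (hw k)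
  have hd' := fun k j => differentiableAt_of_contDiff (contDiff_pderiv (hw k) j)
  -- Contracting the chart components with those of the normal reassembles the height function.
  have hsum : (fun z => inner ℝ (flipSnd (cliffordVec x)) (cliffordVec z)) =
      fun z => w 0 z * n 0 + w 1 z * n 1 + w 2 z * n 2 := by
    funext z
    have h2 : flipSnd (cliffordVec x) = n 0 • stereoIso p (stdVec 0) + n 1 • stereoIso p (stdVec 1)
        + n 2 • stereoIso p (stdVec 2) := by
      rw [← coe_cliffordMap, ← chartVec_cliffordNormal, ← hp, ← hn]
      conv_lhs => rw [eq_sum_stdVec n]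
      simp [Fin.sum_univ_three]
    rw [h2]
    simp only [inner_add_left, inner_smul_left, conj_trivial, w]
    ring
  ext i j
  have hj : pderiv j (fun z => inner ℝ (flipSnd (cliffordVec x)) (cliffordVec z)) =
      fun z => pderiv j (w 0) z * n 0 + pderiv j (w 1) z * n 1 + pderiv j (w 2) z * n 2 := by
    funext z
    rw [hsum, pderiv_add (f := fun z => w 0 z * n 0 + w 1 z * n 1) (g := fun z => w 2 z * n 2)
      (((hd 0 z).mul_const _).add ((hd 1 z).mul_const _)) ((hd 2 z).mul_const _),
      pderiv_add ((hd 0 z).mul_const _) ((hd 1 z).mul_const _),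
      pderiv_mul_const (hd 0 z), pderiv_mul_const (hd 1 z), pderiv_mul_const (hd 2 z)]
  rw [← pderiv_pderiv_inner_flipSnd x i j, hj,
    pderiv_add (f := fun z => pderiv j (w 0) z * n 0 + pderiv j (w 1) z * n 1)
      (g := fun z => pderiv j (w 2) z * n 2)
      (((hd' 0 j x).mul_const _).add ((hd' 1 j x).mul_const _)) ((hd' 2 j x).mul_const _),
    pderiv_add ((hd' 0 j x).mul_const _) ((hd' 1 j x).mul_const _),
    pderiv_mul_const (hd' 0 j x), pderiv_mul_const (hd' 1 j x), pderiv_mul_const (hd' 2 j x)]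
  simp only [secondFundamentalForm, Matrix.of_apply, ← hp, chartMetric_quadricMetric,
    extChartAt_self, hG, hΓ, hξ]
  simp [Fin.sum_univ_three, Matrix.one_apply, w]
  rfl

lemma meanCurvature_cliffordMap {Ψ : ℝ → ℝ} (hΨ : ContDiff ℝ ∞ Ψ) (h0 : Ψ 0 = 0)
    (h1 : deriv Ψ 0 = 0) (x : Eucl 2) :
    meanCurvature (quadricMetric Ψ hΨ) cliffordMap cliffordNormal x = 0 := by
  rw [meanCurvature, inducedMetric_cliffordMap hΨ h0, secondFundamentalForm_cliffordMap hΨ h0 h1]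
  simp [Fin.sum_univ_two]

lemma normSqSecondFF_cliffordMap {Ψ : ℝ → ℝ} (hΨ : ContDiff ℝ ∞ Ψ) (h0 : Ψ 0 = 0)
    (h1 : deriv Ψ 0 = 0) (x : Eucl 2) :
    normSqSecondFF (quadricMetric Ψ hΨ) cliffordMap cliffordNormal x = 2 := by
  rw [normSqSecondFF, inducedMetric_cliffordMap hΨ h0, secondFundamentalForm_cliffordMap hΨ h0 h1]
  simp [Fin.sum_univ_two]
  norm_num

end StableTori

end

noncomputable section

namespace StableTori

open MeasureTheory intervalIntegral

/-! ### Analysis on the flat torus -/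

lemma sq_intervalIntegral_le {L : ℝ} (hL : 0 < L) {f : ℝ → ℝ} (hf : Continuous f) :
    (∫ x in (0 : ℝ)..L, f x) ^ 2 ≤ L * ∫ x in (0 : ℝ)..L, f x ^ 2 := by
  set m := ∫ x in (0 : ℝ)..L, f x with hm
  have h1 : 0 ≤ ∫ x in (0 : ℝ)..L, (L * f x - m) ^ 2 :=
    integral_nonneg hL.le fun x _ => sq_nonneg _
  have h2 : ∫ x in (0 : ℝ)..L, (L * f x - m) ^ 2 =
      L * (L * (∫ x in (0 : ℝ)..L, f x ^ 2) - m ^ 2) := by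
    have : ∀ x, (L * f x - m) ^ 2 = L ^ 2 * f x ^ 2 - 2 * L * m * f x + m ^ 2 := fun x => by ring
    simp only [this]
    rw [intervalIntegral.integral_add (by apply Continuous.intervalIntegrable; fun_prop)
        (by apply Continuous.intervalIntegrable; fun_prop),
      intervalIntegral.integral_sub (by apply Continuous.intervalIntegrable; fun_prop)
        (by apply Continuous.intervalIntegrable; fun_prop),
      intervalIntegral.integral_const_mul, intervalIntegral.integral_const_mul,
      intervalIntegral.integral_const, ← hm, smul_eq_mul]
    ring
  rw [h2] at h1
  linarith [nonneg_of_mul_nonneg_right h1 hL]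

/-- **Wirtinger's inequality** for periodic functions. -/
lemma wirtinger {L : ℝ} (hL : 0 < L) {f f' : ℝ → ℝ} (hf : ∀ x, HasDerivAt f (f' x) x)
    (hf' : Continuous f') (hper : f L = f 0) :
    (2 * Real.pi / L) ^ 2 * ((∫ x in (0 : ℝ)..L, f x ^ 2) - (∫ x in (0 : ℝ)..L, f x) ^ 2 / L) ≤
      ∫ x in (0 : ℝ)..L, f' x ^ 2 := by
  have hfc : Continuous f := continuous_iff_continuousAt.2 fun x => (hf x).continuousAt
  have hmem : ∀ h : ℝ → ℝ, Continuous h →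
      MemLp (fun x => (h x : ℂ)) 2 (volume.restrict (Set.Ioc 0 L)) := by
    intro h hh
    have hc := Complex.continuous_ofReal.comp hh
    obtain ⟨C, hC⟩ := (isCompact_Icc (a := 0) (b := L)).exists_bound_of_continuousOn hc.continuousOn
    exact MemLp.of_bound hc.aestronglyMeasurable C
      ((ae_restrict_iff' measurableSet_Ioc).2 (ae_of_all _ fun x hx =>
        hC x (Set.Ioc_subset_Icc_self hx)))
  have hs := hasSum_sq_fourierCoeffOn hL (hmem f hfc)
  have hs' := hasSum_sq_fourierCoeffOn hL (hmem f' hf')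
  have h0 : ‖fourierCoeffOn hL (fun x => (f x : ℂ)) 0‖ ^ 2 =
      ((∫ x in (0 : ℝ)..L, f x) / L) ^ 2 := by
    rw [fourierCoeffOn_eq_integral]
    simp only [neg_zero, fourier_zero, one_smul, sub_zero, intervalIntegral.integral_ofReal]
    rw [norm_smul, Complex.norm_real, ← norm_mul, Real.norm_eq_abs, sq_abs]
    ring
  -- Removing the zeroth mode from Parseval's sum for f is what subtracts the squared mean. The
  -- remaining modes are compared one by one with those of f'.
  have hsu := (hs.update 0 0).mul_left ((2 * Real.pi / L) ^ 2)
  have hle := hasSum_le (fun n => ?_) hsu hs'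
  · simp only [h0, Complex.norm_real, Real.norm_eq_abs, sq_abs, sub_zero, smul_eq_mul, zero_sub]
      at hle
    rw [← mul_le_mul_iff_of_pos_left (inv_pos.2 hL)]
    refine le_trans (le_of_eq ?_) hle
    field_simp
    ring
  · by_cases hn : n = 0
    · subst hn
      simp
    · have hn' : (n : ℝ) ≠ 0 := by exact_mod_cast hn
      -- Since f L = f 0 the boundary term vanishes, and the n-th coefficient of f' is that of f
      -- times 2πn/L up to a unit; |n| ≥ 1 then suffices.
      rw [Function.update_of_ne hn, fourierCoeffOn_of_hasDerivAt hL hn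
        (fun x _ => (hf x).ofReal_comp) ((Complex.continuous_ofReal.comp hf').intervalIntegrable _ _)]
      have h1 : (1 : ℝ) ≤ |(n : ℝ)| := by
        exact_mod_cast Int.one_le_abs hn
      simp only [hper, sub_self, mul_zero, zero_sub, norm_mul, norm_neg, norm_div, norm_one,
        Complex.norm_real, Complex.norm_I, Complex.norm_intCast, Complex.ofReal_zero, sub_zero,
        Complex.norm_ofNat, Real.norm_eq_abs, abs_of_pos hL, abs_of_pos Real.pi_pos, mul_one]
      rw [← mul_pow]
      refine pow_le_pow_left₀ (by positivity) ?_ 2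
      have : 2 * Real.pi / L * (1 / (2 * Real.pi * |(n : ℝ)|) *
          (L * ‖fourierCoeffOn hL (fun x => (f' x : ℂ)) n‖)) =
          ‖fourierCoeffOn hL (fun x => (f' x : ℂ)) n‖ / |(n : ℝ)| := by
        have := Real.pi_pos
        field_simp
      rw [this]
      exact div_le_self (norm_nonneg _) h1

lemma continuous_vec2 : Continuous fun p : ℝ × ℝ => (!₂[p.1, p.2] : Eucl 2) := by
  refine (PiLp.continuous_toLp 2 _).comp (continuous_pi fun i => ?_)
  fin_cases i
  · exact continuous_fst
  · exact continuous_snd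

lemma hasDerivAt_comp_vec2_left {f : Eucl 2 → ℝ} {s t : ℝ} (hf : DifferentiableAt ℝ f !₂[s, t]) :
    HasDerivAt (fun s => f !₂[s, t]) (pderiv 0 f !₂[s, t]) s := by
  have h : HasDerivAt (fun s : ℝ => (!₂[s, t] : Eucl 2)) (stdVec 0) s := by
    have h2 : (fun s : ℝ => (!₂[s, t] : Eucl 2)) = fun s => s • stdVec 0 + !₂[0, t] := by
      funext s
      ext i
      fin_cases i <;> simp [stdVec]
    rw [h2]
    simpa using ((hasDerivAt_id s).smul_const (stdVec 0 : Eucl 2)).add_const (!₂[0, t] : Eucl 2)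
  exact hf.hasFDerivAt.comp_hasDerivAt s h

lemma hasDerivAt_comp_vec2_right {f : Eucl 2 → ℝ} {s t : ℝ} (hf : DifferentiableAt ℝ f !₂[s, t]) :
    HasDerivAt (fun t => f !₂[s, t]) (pderiv 1 f !₂[s, t]) t := by
  have h : HasDerivAt (fun t : ℝ => (!₂[s, t] : Eucl 2)) (stdVec 1) t := by
    have h2 : (fun t : ℝ => (!₂[s, t] : Eucl 2)) = fun t => t • stdVec 1 + !₂[s, 0] := by
      funext t
      ext i
      fin_cases i <;> simp [stdVec]
    rw [h2]
    simpa using ((hasDerivAt_id t).smul_const (stdVec 1 : Eucl 2)).add_const (!₂[s, 0] : Eucl 2)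
  exact hf.hasFDerivAt.comp_hasDerivAt t h

/-- The integral over the square `[0, L) × [0, L)`. -/
def cellIntegral (L : ℝ) (f : Eucl 2 → ℝ) : ℝ :=
  ∫ x in {x : Eucl 2 | ∀ i, x i ∈ Set.Ico 0 L}, f x

lemma integrableOn_vec2 {f : Eucl 2 → ℝ} (hf : Continuous f) (L : ℝ) :
    IntegrableOn (fun p : ℝ × ℝ => f !₂[p.1, p.2]) (Set.Icc 0 L ×ˢ Set.Icc 0 L) volume :=
  (hf.comp continuous_vec2).continuousOn.integrableOn_compact (isCompact_Icc.prod isCompact_Icc)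

lemma cellIntegral_eq_left {L : ℝ} (hL : 0 < L) {f : Eucl 2 → ℝ} (hf : Continuous f) :
    cellIntegral L f = ∫ s in (0 : ℝ)..L, ∫ t in (0 : ℝ)..L, f !₂[s, t] := by
  have he := (PiLp.volume_preserving_toLp (Fin 2)).comp (volume_preserving_finTwoArrow ℝ).symm
  have hemb : MeasurableEmbedding (WithLp.toLp 2 ∘ (MeasurableEquiv.finTwoArrow (α := ℝ)).symm) :=
    (MeasurableEquiv.toLp 2 (Fin 2 → ℝ)).measurableEmbedding.comp
      (MeasurableEquiv.finTwoArrow (α := ℝ)).symm.measurableEmbedding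
  rw [cellIntegral, ← he.setIntegral_preimage_emb hemb]
  have hset : (WithLp.toLp 2 ∘ (MeasurableEquiv.finTwoArrow (α := ℝ)).symm) ⁻¹'
      {x : Eucl 2 | ∀ i, x i ∈ Set.Ico 0 L} = Set.Ico 0 L ×ˢ Set.Ico 0 L := by
    ext p
    simp [Fin.forall_fin_two, MeasurableEquiv.finTwoArrow]
  have hfun : ∀ p : ℝ × ℝ, (WithLp.toLp 2 ∘ (MeasurableEquiv.finTwoArrow (α := ℝ)).symm) p =
      !₂[p.1, p.2] := fun p => rfl
  simp only [hset, hfun]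
  rw [Measure.volume_eq_prod, setIntegral_prod _
    ((integrableOn_vec2 hf L).mono_set
      (Set.prod_mono Set.Ico_subset_Icc_self Set.Ico_subset_Icc_self)),
    intervalIntegral.integral_of_le hL.le, ← integral_Ico_eq_integral_Ioc]
  refine integral_congr_ae (ae_of_all _ fun s => ?_)
  simp only
  rw [intervalIntegral.integral_of_le hL.le, ← integral_Ico_eq_integral_Ioc]

lemma cellIntegral_eq_right {L : ℝ} (hL : 0 < L) {f : Eucl 2 → ℝ} (hf : Continuous f) :
    cellIntegral L f = ∫ t in (0 : ℝ)..L, ∫ s in (0 : ℝ)..L, f !₂[s, t] := by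
  rw [cellIntegral_eq_left hL hf]
  refine intervalIntegral_intervalIntegral_swap ((integrableOn_vec2 hf L).mono_set ?_)
  rw [Set.uIoc_of_le hL.le]
  exact Set.prod_mono Set.Ioc_subset_Icc_self Set.Ioc_subset_Icc_self

lemma integrableOn_cell {f : Eucl 2 → ℝ} (hf : Continuous f) (L : ℝ) :
    IntegrableOn f {x : Eucl 2 | ∀ i, x i ∈ Set.Ico 0 L} := by
  have hc : IsCompact (WithLp.toLp 2 '' (Set.univ.pi fun _ : Fin 2 => Set.Icc (0 : ℝ) L)) :=
    (isCompact_univ_pi fun _ => isCompact_Icc).image (PiLp.continuous_toLp 2 _)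
  refine (hf.continuousOn.integrableOn_compact hc).mono_set fun x hx => ?_
  exact ⟨WithLp.ofLp x, fun i _ => Set.Ico_subset_Icc_self (hx i), rfl⟩

lemma cellIntegral_add {f g : Eucl 2 → ℝ} (hf : Continuous f) (hg : Continuous g) (L : ℝ) :
    cellIntegral L (fun x => f x + g x) = cellIntegral L f + cellIntegral L g :=
  integral_add (integrableOn_cell hf L) (integrableOn_cell hg L)

lemma cellIntegral_sub {f g : Eucl 2 → ℝ} (hf : Continuous f) (hg : Continuous g) (L : ℝ) :
    cellIntegral L (fun x => f x - g x) = cellIntegral L f - cellIntegral L g :=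
  integral_sub (integrableOn_cell hf L) (integrableOn_cell hg L)

lemma cellIntegral_const_mul (f : Eucl 2 → ℝ) (L c : ℝ) :
    cellIntegral L (fun x => c * f x) = c * cellIntegral L f :=
  MeasureTheory.integral_const_mul c f

lemma IsDoublyPeriodic.vec2_left {L : ℝ} {f : Eucl 2 → ℝ} (h : IsDoublyPeriodic (fun _ => L) f)
    (t : ℝ) : f !₂[L, t] = f !₂[0, t] := by
  rw [← h !₂[0, t] 0]
  congr 1
  ext i
  fin_cases i <;> simp [stdVec]

lemma IsDoublyPeriodic.vec2_right {L : ℝ} {f : Eucl 2 → ℝ} (h : IsDoublyPeriodic (fun _ => L) f)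
    (s : ℝ) : f !₂[s, L] = f !₂[s, 0] := by
  rw [← h !₂[s, 0] 1]
  congr 1
  ext i
  fin_cases i <;> simp [stdVec]

lemma IsTorusFunction.pderiv {P : Fin 2 → ℝ} {u : Eucl 2 → ℝ} (h : IsTorusFunction P u)
    (i : Fin 2) : IsTorusFunction P (pderiv i u) := by
  refine ⟨contDiff_pderiv h.1 i, fun x j => ?_⟩
  have : (fun y => u (y + P j • stdVec j)) = u := funext fun y => h.2 y j
  rw [StableTori.pderiv, ← fderiv_comp_add_right, this, StableTori.pderiv]

lemma IsTorusFunction.mul {P : Fin 2 → ℝ} {u v : Eucl 2 → ℝ} (hu : IsTorusFunction P u)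
    (hv : IsTorusFunction P v) : IsTorusFunction P (fun x => u x * v x) :=
  ⟨hu.1.mul hv.1, fun x j => by simp only [hu.2 x j, hv.2 x j]⟩

lemma cellIntegral_pderiv {L : ℝ} (hL : 0 < L) {u : Eucl 2 → ℝ}
    (h : IsTorusFunction (fun _ => L) u) (i : Fin 2) : cellIntegral L (pderiv i u) = 0 := by
  have hc : Continuous (pderiv i u) := (contDiff_pderiv h.1 i).continuous
  fin_cases i
  · rw [cellIntegral_eq_right hL hc]
    have : ∀ t, ∫ s in (0 : ℝ)..L, pderiv 0 u !₂[s, t] = 0 := fun t => by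
      rw [integral_eq_sub_of_hasDerivAt
        (fun s _ => hasDerivAt_comp_vec2_left (differentiableAt_of_contDiff h.1 _))
        ((hc.comp (continuous_vec2.comp
          (Continuous.prodMk_left t))).intervalIntegrable _ _), h.2.vec2_left, sub_self]
    simp [this]
  · rw [cellIntegral_eq_left hL hc]
    have : ∀ s, ∫ t in (0 : ℝ)..L, pderiv 1 u !₂[s, t] = 0 := fun s => by
      rw [integral_eq_sub_of_hasDerivAt
        (fun t _ => hasDerivAt_comp_vec2_right (differentiableAt_of_contDiff h.1 _))
        ((hc.comp (continuous_vec2.comp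
          (Continuous.prodMk_right s))).intervalIntegrable _ _), h.2.vec2_right, sub_self]
    simp [this]

lemma hasDerivAt_integral_vec2 {u : Eucl 2 → ℝ} (hu : ContDiff ℝ ∞ u) (L t : ℝ) :
    HasDerivAt (fun t => ∫ s in (0 : ℝ)..L, u !₂[s, t])
      (∫ s in (0 : ℝ)..L, pderiv 1 u !₂[s, t]) t := by
  have hc : Continuous (pderiv 1 u) := (contDiff_pderiv hu 1).continuous
  have hs : ∀ {f : Eucl 2 → ℝ}, Continuous f → ∀ t : ℝ, Continuous fun s => f !₂[s, t] :=
    fun hf t => hf.comp (continuous_vec2.comp (Continuous.prodMk_left t))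
  obtain ⟨C, hC⟩ := (isCompact_uIcc (a := (0 : ℝ)) (b := L)).prod
    (isCompact_closedBall t 1) |>.exists_bound_of_continuousOn
      (f := fun p : ℝ × ℝ => pderiv 1 u !₂[p.1, p.2]) (hc.comp continuous_vec2).continuousOn
  exact (intervalIntegral.hasDerivAt_integral_of_dominated_loc_of_deriv_le
    (F := fun t s => u !₂[s, t]) (F' := fun t s => pderiv 1 u !₂[s, t]) (bound := fun _ => C)
    (Metric.closedBall_mem_nhds t one_pos)
    (Filter.Eventually.of_forall fun t => (hs hu.continuous t).aestronglyMeasurable)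
    ((hs hu.continuous t).intervalIntegrable _ _)
    (hs hc t).aestronglyMeasurable
    (ae_of_all _ fun s hs t ht => hC (s, t) ⟨Set.uIoc_subset_uIcc hs, ht⟩)
    intervalIntegrable_const
    (ae_of_all _ fun s _ t _ => hasDerivAt_comp_vec2_right (differentiableAt_of_contDiff hu _))).2

/-- **Poincaré inequality** on the square flat torus. -/
lemma cellIntegral_sq_le {L : ℝ} (hL : 0 < L) {u : Eucl 2 → ℝ}
    (h : IsTorusFunction (fun _ => L) u) (h0 : cellIntegral L u = 0) :
    (2 * Real.pi / L) ^ 2 * cellIntegral L (fun x => u x ^ 2) ≤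
      cellIntegral L (fun x => pderiv 0 u x ^ 2 + pderiv 1 u x ^ 2) := by
  have hu := h.1.continuous
  have hc : ∀ i, Continuous (pderiv i u) := fun i => (contDiff_pderiv h.1 i).continuous
  have hs : ∀ {f : Eucl 2 → ℝ}, Continuous f → ∀ t : ℝ, Continuous fun s => f !₂[s, t] :=
    fun hf t => hf.comp (continuous_vec2.comp (Continuous.prodMk_left t))
  have hsq : ∀ {f : Eucl 2 → ℝ}, Continuous f → Continuous fun x => f x ^ 2 := fun hf => hf.pow 2
  have hsq' : ∀ {f : ℝ → ℝ}, Continuous f → Continuous fun x => f x ^ 2 := fun hf => hf.pow 2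
  have hint : ∀ {f : Eucl 2 → ℝ}, Continuous f → Continuous fun t => ∫ s in (0 : ℝ)..L, f !₂[s, t] :=
    fun {f} hf => continuous_parametric_intervalIntegral_of_continuous'
      (f := fun t s => f !₂[s, t]) (hf.comp (continuous_vec2.comp continuous_swap)) 0 L
  -- Split u into its row mean m(t)/L and the deviation from it. Wirtinger in s bounds the deviation
  -- by ∂₀u; Wirtinger for m, with Cauchy–Schwarz for m', bounds the mean by ∂₁u.
  set m : ℝ → ℝ := fun t => ∫ s in (0 : ℝ)..L, u !₂[s, t] with hm
  set m' : ℝ → ℝ := fun t => ∫ s in (0 : ℝ)..L, pderiv 1 u !₂[s, t] with hm'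
  have hmc : Continuous m := hint hu
  have hmc' : Continuous m' := hint (hc 1)
  set k := (2 * Real.pi / L) ^ 2
  have hx : k * (cellIntegral L (fun x => u x ^ 2) - (∫ t in (0 : ℝ)..L, m t ^ 2) / L) ≤
      cellIntegral L (fun x => pderiv 0 u x ^ 2) := by
    rw [cellIntegral_eq_right hL (hsq hu), cellIntegral_eq_right hL (hsq (hc 0)),
      ← intervalIntegral.integral_div, ← intervalIntegral.integral_sub
        ((hint (hsq hu)).intervalIntegrable _ _)
        (((hsq' hmc).div_const L).intervalIntegrable _ _), ← intervalIntegral.integral_const_mul]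
    refine integral_mono_on hL.le ?_ ((hint (hsq (hc 0))).intervalIntegrable _ _) fun t _ => ?_
    · exact (((hint (hsq hu)).sub ((hsq' hmc).div_const L)).const_mul k).intervalIntegrable _ _
    · exact wirtinger hL
        (fun s => hasDerivAt_comp_vec2_left (differentiableAt_of_contDiff h.1 _))
        (hs (hc 0) t) (h.2.vec2_left t)
  have hy : (∫ t in (0 : ℝ)..L, m' t ^ 2) ≤ L * cellIntegral L (fun x => pderiv 1 u x ^ 2) := by
    rw [cellIntegral_eq_right hL (hsq (hc 1)), ← intervalIntegral.integral_const_mul]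
    refine integral_mono_on hL.le ((hsq' hmc').intervalIntegrable _ _)
      (((hint (hsq (hc 1))).const_mul L).intervalIntegrable _ _) fun t _ => ?_
    exact sq_intervalIntegral_le hL (hs (hc 1) t)
  -- The correction term here is the square of the total integral of u, which is zero by `h0`.
  have hz := wirtinger hL (hasDerivAt_integral_vec2 h.1 L) hmc' (by simp only [h.2.vec2_right])
  rw [cellIntegral_eq_right hL hu] at h0
  rw [h0] at hz
  rw [cellIntegral_add (hsq (hc 0)) (hsq (hc 1))]
  have hz' : k * (∫ t in (0 : ℝ)..L, m t ^ 2) ≤ ∫ t in (0 : ℝ)..L, m' t ^ 2 := by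
    simpa using hz
  have h3 : k * ((∫ t in (0 : ℝ)..L, m t ^ 2) / L) ≤ cellIntegral L (fun x => pderiv 1 u x ^ 2) := by
    rw [← mul_div_assoc, div_le_iff₀' hL]
    exact hz'.trans hy
  linarith

end StableTori

end

noncomputable section

namespace StableTori

/-! ### Eigenfunctions on the flat torus -/

open MeasureTheory

lemma laplaceBeltrami_of_eq_one {n : ℕ} {G : Eucl n → Matrix (Fin n) (Fin n) ℝ} (hG : ∀ x, G x = 1)
    (u : Eucl n → ℝ) (x : Eucl n) : laplaceBeltrami G u x = ∑ i, pderiv i (pderiv i u) x := by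
  have h : ∀ i j, pderiv i (fun z => Real.sqrt (G z).det * (G z)⁻¹ i j * pderiv j u z) x =
      if i = j then pderiv i (pderiv i u) x else 0 := by
    intro i j
    simp only [hG, Matrix.det_one, Real.sqrt_one, inv_one, one_mul, Matrix.one_apply]
    split_ifs with hij
    · subst hij
      simp
    · simp [StableTori.pderiv]
  simp only [laplaceBeltrami, h]
  simp [hG]

lemma gradInner_of_eq_one {n : ℕ} {G : Eucl n → Matrix (Fin n) (Fin n) ℝ} (hG : ∀ x, G x = 1)
    (u v : Eucl n → ℝ) (x : Eucl n) : gradInner G u v x = ∑ i, pderiv i u x * pderiv i v x := by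
  simp [gradInner, hG, Matrix.one_apply]

lemma IsDoublyPeriodic.exists_mem_Ico {L : ℝ} (hL : 0 < L) {f : Eucl 2 → ℝ}
    (h : IsDoublyPeriodic (fun _ => L) f) (x : Eucl 2) :
    ∃ s ∈ Set.Ico 0 L, ∃ t ∈ Set.Ico 0 L, f x = f !₂[s, t] := by
  have hs : ∀ t, Function.Periodic (fun s => f !₂[s, t]) L := fun t s => by
    simp only
    rw [← h !₂[s, t] 0]
    congr 1
    ext i
    fin_cases i <;> simp [stdVec]
  have ht : ∀ s, Function.Periodic (fun t => f !₂[s, t]) L := fun s t => by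
    simp only
    rw [← h !₂[s, t] 1]
    congr 1
    ext i
    fin_cases i <;> simp [stdVec]
  obtain ⟨s, hs, h1⟩ := (hs (x 1)).exists_mem_Ico₀ hL (x 0)
  obtain ⟨t, ht, h2⟩ := (ht s).exists_mem_Ico₀ hL (x 1)
  refine ⟨s, hs, t, ht, ?_⟩
  simp only at h1 h2
  rw [← h2, ← h1]
  congr 1
  ext i
  fin_cases i <;> rfl

lemma eq_zero_of_intervalIntegral_eq_zero {L : ℝ} (hL : 0 < L) {f : ℝ → ℝ} (hf : Continuous f)
    (h0 : ∀ x, 0 ≤ f x) (h : ∫ x in (0 : ℝ)..L, f x = 0) {x : ℝ} (hx : x ∈ Set.Ico 0 L) :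
    f x = 0 := by
  by_contra hne
  exact (intervalIntegral.integral_pos hL hf.continuousOn (fun y _ => h0 y)
    ⟨x, Set.Ico_subset_Icc_self hx, lt_of_le_of_ne (h0 x) (Ne.symm hne)⟩).ne' h

lemma eq_zero_of_cellIntegral_eq_zero {L : ℝ} (hL : 0 < L) {f : Eucl 2 → ℝ} (hf : Continuous f)
    (hp : IsDoublyPeriodic (fun _ => L) f) (h0 : ∀ x, 0 ≤ f x) (h : cellIntegral L f = 0)
    (x : Eucl 2) : f x = 0 := by
  obtain ⟨s, hs, t, ht, hx⟩ := hp.exists_mem_Ico hL x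
  rw [cellIntegral_eq_left hL hf] at h
  have hc : Continuous fun s => ∫ t in (0 : ℝ)..L, f !₂[s, t] :=
    intervalIntegral.continuous_parametric_intervalIntegral_of_continuous'
      (f := fun s t => f !₂[s, t]) (hf.comp continuous_vec2) 0 L
  have h1 := eq_zero_of_intervalIntegral_eq_zero hL hc
    (fun s => intervalIntegral.integral_nonneg hL.le fun t _ => h0 _) h hs
  rw [hx]
  exact eq_zero_of_intervalIntegral_eq_zero hL
    (hf.comp (continuous_vec2.comp (Continuous.prodMk_right s))) (fun t => h0 _) h1 ht

/-- An eigenfunction of the square flat torus with an eigenvalue below `(2π/L)²` is constant. -/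
lemma eigenfunction_const {L : ℝ} (hL : 0 < L) {u : Eucl 2 → ℝ} {l : ℝ}
    (h : IsTorusFunction (fun _ => L) u) (hl : l < (2 * Real.pi / L) ^ 2)
    (heq : ∀ x, pderiv 0 (pderiv 0 u) x + pderiv 1 (pderiv 1 u) x + l * u x = 0) :
    ∃ c, ∀ x, u x = c := by
  have hu := h.1.continuous
  have hc : ∀ i, Continuous (pderiv i u) := fun i => (h.pderiv i).1.continuous
  have hcc : ∀ i, Continuous (pderiv i (pderiv i u)) := fun i => ((h.pderiv i).pderiv i).1.continuous
  have hsq : ∀ {f : Eucl 2 → ℝ}, Continuous f → Continuous fun x => f x ^ 2 := fun hf => hf.pow 2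
  -- Integrating the equation over the torus kills the Laplacian, so u has mean zero unless l = 0.
  have hmean : l * cellIntegral L u = 0 := by
    have h1 : (fun x => l * u x) =
        fun x => (-1) * (pderiv 0 (pderiv 0 u) x + pderiv 1 (pderiv 1 u) x) := by
      funext x
      linarith [heq x]
    rw [← cellIntegral_const_mul, h1, cellIntegral_const_mul, cellIntegral_add (hcc 0) (hcc 1),
      cellIntegral_pderiv hL (h.pderiv 0), cellIntegral_pderiv hL (h.pderiv 1)]
    ring
  have hparts : ∀ i, cellIntegral L (fun x => pderiv i u x ^ 2 + u x * pderiv i (pderiv i u) x) = 0 := by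
    intro i
    rw [← cellIntegral_pderiv hL (h.mul (h.pderiv i)) i]
    congr 1
    funext x
    rw [pderiv_mul (differentiableAt_of_contDiff h.1 x)
      (differentiableAt_of_contDiff (h.pderiv i).1 x)]
    ring
  -- Green's formula: the equation is multiplied by u and integrated by parts.
  have henergy : cellIntegral L (fun x => pderiv 0 u x ^ 2 + pderiv 1 u x ^ 2) =
      l * cellIntegral L (fun x => u x ^ 2) := by
    have h1 : (fun x => pderiv 0 u x ^ 2 + pderiv 1 u x ^ 2) = fun x =>
        (pderiv 0 u x ^ 2 + u x * pderiv 0 (pderiv 0 u) x)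
          + (pderiv 1 u x ^ 2 + u x * pderiv 1 (pderiv 1 u) x) + l * u x ^ 2 := by
      funext x
      linear_combination -u x * heq x
    have hp : ∀ i, Continuous fun x => pderiv i u x ^ 2 + u x * pderiv i (pderiv i u) x :=
      fun i => (hsq (hc i)).add (hu.mul (hcc i))
    have hp2 : Continuous fun x => (pderiv 0 u x ^ 2 + u x * pderiv 0 (pderiv 0 u) x)
        + (pderiv 1 u x ^ 2 + u x * pderiv 1 (pderiv 1 u) x) := (hp 0).add (hp 1)
    have hp3 : Continuous fun x => l * u x ^ 2 := (hsq hu).const_mul l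
    rw [h1, cellIntegral_add hp2 hp3, cellIntegral_add (hp 0) (hp 1), hparts, hparts,
      cellIntegral_const_mul]
    ring
  have hper : IsDoublyPeriodic (fun _ => L) (fun x => pderiv 0 u x ^ 2 + pderiv 1 u x ^ 2) :=
    fun x i => by simp only [(h.pderiv 0).2 x i, (h.pderiv 1).2 x i]
  rcases eq_or_ne l 0 with rfl | hl0
  · rw [zero_mul] at henergy
    have hz := eq_zero_of_cellIntegral_eq_zero hL
      (f := fun x => pderiv 0 u x ^ 2 + pderiv 1 u x ^ 2) ((hsq (hc 0)).add (hsq (hc 1))) hper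
      (fun x => by positivity) henergy
    have hfd : ∀ x, fderiv ℝ u x = 0 := by
      intro x
      have h0 : pderiv 0 u x = 0 := by
        nlinarith [hz x, sq_nonneg (pderiv 0 u x), sq_nonneg (pderiv 1 u x)]
      have h1 : pderiv 1 u x = 0 := by
        nlinarith [hz x, sq_nonneg (pderiv 0 u x), sq_nonneg (pderiv 1 u x)]
      ext a
      rw [eq_sum_stdVec a, Fin.sum_univ_two, map_add, map_smul, map_smul]
      change a 0 • pderiv 0 u x + a 1 • pderiv 1 u x = 0
      rw [h0, h1]
      simp
    exact ⟨u 0, fun x => is_const_of_fderiv_eq_zero (h.1.differentiable (by simp)) hfd x 0⟩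
  -- Poincaré gives (2π/L)² ∫u² ≤ l ∫u² with l below (2π/L)², whence u = 0.
  · have hm := (mul_eq_zero.1 hmean).resolve_left hl0
    have hle := cellIntegral_sq_le hL h hm
    rw [henergy] at hle
    have hnn : 0 ≤ cellIntegral L (fun x => u x ^ 2) := integral_nonneg fun x => sq_nonneg _
    have hz : cellIntegral L (fun x => u x ^ 2) = 0 := by nlinarith
    refine ⟨0, fun x => ?_⟩
    exact pow_eq_zero_iff two_ne_zero |>.1 (eq_zero_of_cellIntegral_eq_zero hL (hsq hu)
      (fun x i => by simp only [h.2 x i]) (fun x => sq_nonneg _) hz x)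

/-! ### The Clifford torus for `e^{2Ψ(h)} g` -/

lemma cliffordPeriod_pos : 0 < Real.sqrt 2 * Real.pi := mul_pos (by positivity) Real.pi_pos

lemma two_pi_div_cliffordPeriod : (2 * Real.pi / (Real.sqrt 2 * Real.pi)) ^ 2 = 2 := by
  have h : Real.sqrt 2 ^ 2 = 2 := Real.sq_sqrt (by norm_num)
  have hp := Real.pi_pos
  rw [div_pow, mul_pow, mul_pow, h]
  field_simp

/-- With Ψ'(0) = 0 the normal Ricci curvature on the torus is 2 - 8Ψ''(0), so the value 1/4 is
exactly what makes it vanish. -/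
lemma ricci_cliffordNormal {Ψ : ℝ → ℝ} (hΨ : ContDiff ℝ ∞ Ψ) (h1 : deriv Ψ 0 = 0)
    (h2 : deriv (deriv Ψ) 0 = 1 / 4) (x : Eucl 2) :
    ricci (quadricMetric Ψ hΨ) (cliffordMap x) (cliffordNormal x) (cliffordNormal x) = 0 := by
  have hpp : inner ℝ (cliffordMap x : Eucl 4) (cliffordMap x) = (1 : ℝ) := by
    rw [real_inner_self_eq_norm_sq, norm_coe_S3, one_pow]
  have hq : cliffordForm (flipSnd (cliffordMap x)) = 0 := by
    rw [cliffordForm, flipSnd_flipSnd, real_inner_comm]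
    exact cliffordForm_cliffordMap x
  rw [ricci_quadricMetric, cliffordForm_cliffordMap, h1, h2, sphereDeriv_cliffordNormal, hq,
    ← real_inner_self_eq_norm_sq, norm_flipSnd_sq, hpp, ricciForm]
  norm_num

lemma jacobiPotential_cliffordMap {Ψ : ℝ → ℝ} (hΨ : ContDiff ℝ ∞ Ψ) (h0 : Ψ 0 = 0)
    (h1 : deriv Ψ 0 = 0) (h2 : deriv (deriv Ψ) 0 = 1 / 4) (x : Eucl 2) :
    jacobiPotential (quadricMetric Ψ hΨ) cliffordMap cliffordNormal x = 2 := by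
  rw [jacobiPotential, normSqSecondFF_cliffordMap hΨ h0 h1, ricci_cliffordNormal hΨ h1 h2, add_zero]

lemma jacobiOperator_cliffordMap {Ψ : ℝ → ℝ} (hΨ : ContDiff ℝ ∞ Ψ) (h0 : Ψ 0 = 0)
    (h1 : deriv Ψ 0 = 0) (h2 : deriv (deriv Ψ) 0 = 1 / 4) (u : Eucl 2 → ℝ) (x : Eucl 2) :
    jacobiOperator (quadricMetric Ψ hΨ) cliffordMap cliffordNormal u x =
      pderiv 0 (pderiv 0 u) x + pderiv 1 (pderiv 1 u) x + 2 * u x := by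
  rw [jacobiOperator, jacobiPotential_cliffordMap hΨ h0 h1 h2,
    laplaceBeltrami_of_eq_one (inducedMetric_cliffordMap hΨ h0), Fin.sum_univ_two]

lemma surfaceIntegral_cliffordMap {Ψ : ℝ → ℝ} (hΨ : ContDiff ℝ ∞ Ψ) (h0 : Ψ 0 = 0)
    (f : Eucl 2 → ℝ) : surfaceIntegral (quadricMetric Ψ hΨ) cliffordPeriods cliffordMap f =
      cellIntegral (Real.sqrt 2 * Real.pi) f := by
  simp only [surfaceIntegral, inducedMetric_cliffordMap hΨ h0, Matrix.det_one, Real.sqrt_one,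
    mul_one, cellIntegral, cliffordPeriods]

/-- The potential 2 equals the Poincaré constant (2π/L)² for L = √2 π, so the inequality holds
without any slack. -/
lemma isStableCMC_cliffordMap {Ψ : ℝ → ℝ} (hΨ : ContDiff ℝ ∞ Ψ) (h0 : Ψ 0 = 0)
    (h1 : deriv Ψ 0 = 0) (h2 : deriv (deriv Ψ) 0 = 1 / 4) :
    IsStableCMC (quadricMetric Ψ hΨ) cliffordPeriods cliffordMap cliffordNormal := by
  refine ⟨⟨0, meanCurvature_cliffordMap hΨ h0 h1⟩, fun u hu hmean => ?_⟩
  rw [surfaceIntegral_cliffordMap hΨ h0] at hmean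
  have hle := cellIntegral_sq_le cliffordPeriod_pos hu hmean
  have hc : ∀ i, Continuous fun x => pderiv i u x ^ 2 := fun i => (hu.pderiv i).1.continuous.pow 2
  have hc' : Continuous fun x => u x ^ 2 := hu.1.continuous.pow 2
  have hfun : (fun x => gradInner (inducedMetric (quadricMetric Ψ hΨ) cliffordMap) u u x -
      jacobiPotential (quadricMetric Ψ hΨ) cliffordMap cliffordNormal x * u x * u x) =
      fun x => (pderiv 0 u x ^ 2 + pderiv 1 u x ^ 2) - 2 * u x ^ 2 := by
    funext x
    rw [gradInner_of_eq_one (inducedMetric_cliffordMap hΨ h0), Fin.sum_univ_two,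
      jacobiPotential_cliffordMap hΨ h0 h1 h2]
    ring
  have hg : Continuous fun x => pderiv 0 u x ^ 2 + pderiv 1 u x ^ 2 := (hc 0).add (hc 1)
  rw [two_pi_div_cliffordPeriod] at hle
  rw [indexForm, surfaceIntegral_cliffordMap hΨ h0, hfun,
    cellIntegral_sub hg (hc'.const_mul 2), cellIntegral_const_mul]
  linarith

/-- A Jacobi eigenvalue μ < 0 is a Laplace eigenvalue 2 + μ below 2, which leaves only the
constants; they have μ = -2. -/
lemma index_cliffordMap {Ψ : ℝ → ℝ} (hΨ : ContDiff ℝ ∞ Ψ) (h0 : Ψ 0 = 0)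
    (h1 : deriv Ψ 0 = 0) (h2 : deriv (deriv Ψ) 0 = 1 / 4) :
    index (quadricMetric Ψ hΨ) cliffordPeriods cliffordMap cliffordNormal = 1 := by
  have hspan : Submodule.span ℝ {u : Eucl 2 → ℝ | IsTorusFunction cliffordPeriods u ∧
      ∃ μ : ℝ, μ < 0 ∧ ∀ x, jacobiOperator (quadricMetric Ψ hΨ) cliffordMap cliffordNormal u x
        + μ * u x = 0} = Submodule.span ℝ {(1 : Eucl 2 → ℝ)} := by
    refine le_antisymm (Submodule.span_le.2 ?_) (Submodule.span_le.2 ?_)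
    · rintro u ⟨hu, μ, hμ, heq⟩
      obtain ⟨c, hc⟩ := eigenfunction_const cliffordPeriod_pos (l := 2 + μ) hu
        (by rw [two_pi_div_cliffordPeriod]; linarith) (fun x => by
          have h := heq x
          rw [jacobiOperator_cliffordMap hΨ h0 h1 h2] at h
          linarith)
      exact Submodule.mem_span_singleton.2 ⟨c, funext fun x => by simp [hc x]⟩
    · rw [Set.singleton_subset_iff]
      refine Submodule.subset_span ⟨⟨contDiff_const, fun _ _ => rfl⟩, -2, by norm_num, fun x => ?_⟩
      have hz : ∀ (c : ℝ) (i : Fin 2), pderiv i (fun _ => c) = fun _ => 0 := fun c i =>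
        funext fun y => pderiv_const c y i
      rw [jacobiOperator_cliffordMap hΨ h0 h1 h2]
      simp [show (1 : Eucl 2 → ℝ) = fun _ => 1 from rfl, hz]
  rw [index, hspan, rank_span_set (LinearIndepOn.singleton (v := id) one_ne_zero),
    Cardinal.mk_singleton]

lemma exists_smul_cliffordNormal_iff (x : Eucl 2) (v : TangentSpace (𝓡 3) (cliffordMap x)) :
    (∃ c : ℝ, v = c • cliffordNormal x) ↔
      ∃ c : ℝ, sphereDeriv (cliffordMap x) v = c • flipSnd (cliffordMap x) := by
  refine exists_congr fun c => ?_
  rw [← sphereDeriv_cliffordNormal, ← map_smul, (sphereDeriv_injective _).eq_iff]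

lemma inner_sphereDeriv (p : S3) (v : TangentSpace (𝓡 3) p) :
    inner ℝ (p : Eucl 4) (sphereDeriv p v) = 0 := by
  rw [sphereDeriv_eq_stereoIso, real_inner_comm, inner_stereoIso]

lemma IsGlobalProfile.ricci_eq {r : ℝ} {ζ : ℝ → ℝ} (h : IsGlobalProfile r ζ)
    (hr : r < Real.pi / 8) (p : S3) (v : TangentSpace (𝓡 3) p) :
    ricci (quadricMetric (quadricExponent ζ) (h.contDiff_quadricExponent hr)) p v v =
      profileRicci ζ p (sphereDeriv p v) :=
  ricci_quadricMetric _ p v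

end StableTori

end

/-! ### The main theorem -/

open StableTori in
theorem mainTheorem3 :
    -- admissible profiles exist, even strictly decreasing ones
    (∀ r ∈ Set.Ioo (0 : ℝ) (Real.pi / 8),
      ∃ ζ : ℝ → ℝ, IsProfile r ζ ∧ StrictAntiOn ζ (Set.Ioo 0 r)) ∧
    -- the function `t` is the signed distance to the Clifford torus
    (∀ p : S3, IsLeast
      ((fun q : S3 => InnerProductGeometry.angle (p : Eucl 4) (q : Eucl 4)) '' cliffordTorus)
      |signedDist p|) ∧
    (∀ x, ∀ t ∈ Set.Ioo (-(Real.pi / 4)) (Real.pi / 4), signedDist (torusCoord x t) = t) ∧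
    -- the Clifford torus is an embedded torus
    IsImmersedTorus (n := 3) cliffordPeriods cliffordMap ∧
    Set.range cliffordMap = cliffordTorus ∧
    (∀ x y, cliffordMap x = cliffordMap y ↔
      ∀ i, ∃ m : ℤ, y i = x i + m * cliffordPeriods i) ∧
    ∃ g : RiemMetric 3 S3, IsRound g ∧
      IsUnitNormal g cliffordPeriods cliffordMap cliffordNormal ∧
      IsMinimal g cliffordMap cliffordNormal ∧
      ∃ r₀ : ℝ, 0 < r₀ ∧ ∀ r ∈ Set.Ioo (0 : ℝ) (Real.pi / 8), ∀ ζ : ℝ → ℝ, IsProfile r ζ →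
        ∃ g' : RiemMetric 3 S3,
          -- the conformal metric `g' = e^{2φ(t)} g`
          (∀ (p : S3) (v w : TangentSpace (𝓡 3) p), g'.inner p v w =
            Real.exp (2 * conformalExponent ζ (signedDist p)) * g.inner p v w) ∧
          -- nonnegative Ricci curvature, vanishing only in the direction normal to the torus
          (r < r₀ →
            (∀ (p : S3) (v : TangentSpace (𝓡 3) p), 0 ≤ ricci g' p v v) ∧
            (∀ (p : S3) (v : TangentSpace (𝓡 3) p),
              p ∉ cliffordTorus → v ≠ 0 → 0 < ricci g' p v v) ∧
            (∀ (x : Eucl 2) (v : TangentSpace (𝓡 3) (cliffordMap x)),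
              ricci g' (cliffordMap x) v v = 0 ↔ ∃ c : ℝ, v = c • cliffordNormal x)) ∧
          -- geometry of the Clifford torus for `g'`
          IsUnitNormal g' cliffordPeriods cliffordMap cliffordNormal ∧
          (∀ x, inducedMetric g' cliffordMap x = 1) ∧
          IsMinimal g' cliffordMap cliffordNormal ∧
          (∀ x, normSqSecondFF g' cliffordMap cliffordNormal x = 2) ∧
          (∀ x, ricci g' (cliffordMap x) (cliffordNormal x) (cliffordNormal x) = 0) ∧
          (∀ u, IsTorusFunction cliffordPeriods u → ∀ x,
            jacobiOperator g' cliffordMap cliffordNormal u x =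
              laplaceBeltrami (inducedMetric g' cliffordMap) u x + 2 * u x) ∧
          IsStableCMC g' cliffordPeriods cliffordMap cliffordNormal ∧
          index g' cliffordPeriods cliffordMap cliffordNormal = 1 := by
  have hconst : ContDiff ℝ ∞ (fun _ : ℝ => (0 : ℝ)) := contDiff_const
  -- The round metric is the case Ψ = 0, so the same lemmas cover it; r₀ = 1/4 is the bound required
  -- by `profileRicci_lower_bound`.
  refine ⟨fun r hr => ?_, isLeast_angle_cliffordTorus, fun x t => signedDist_torusCoord x,
    isImmersedTorus_cliffordMap, range_cliffordMap, cliffordMap_eq_iff,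
    quadricMetric _ hconst, fun p v w => ?_, isUnitNormal_cliffordNormal hconst rfl,
    meanCurvature_cliffordMap hconst rfl (by simp), 1 / 4, by norm_num, fun r hr ζ hζ => ?_⟩
  · obtain ⟨ζ, h, hanti⟩ := exists_isGlobalProfile hr.1
    exact ⟨ζ, h.isProfile, hanti⟩
  · rw [quadricMetric_inner, mul_zero, Real.exp_zero, one_mul]
    rfl
  · obtain ⟨ζ', h, hexp⟩ := hζ.exists_global hr
    have h0 := quadricExponent_zero ζ'
    have h1 : deriv (quadricExponent ζ') 0 = 0 := by
      rw [h.deriv_quadricExponent (by norm_num)]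
      simp [profileIntegral]
    -- At k = 0 the identity for Ψ'' reads 4Ψ''(0) = ζ(0) = 1.
    have h2 : deriv (deriv (quadricExponent ζ')) 0 = 1 / 4 := by
      have h3 := h.deriv_deriv_quadricExponent (k := 0) (by norm_num)
      rw [Real.arcsin_zero, zero_div, h.zero] at h3
      linarith
    have hΨ := h.contDiff_quadricExponent hr.2
    refine ⟨quadricMetric _ hΨ, fun p v w => ?_, fun hr' => ⟨fun p v => ?_, fun p v hp hv => ?_,
      fun x v => ?_⟩, isUnitNormal_cliffordNormal hΨ h0, inducedMetric_cliffordMap hΨ h0,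
      meanCurvature_cliffordMap hΨ h0 h1, normSqSecondFF_cliffordMap hΨ h0 h1,
      ricci_cliffordNormal hΨ h1 h2, fun u _ x => ?_, isStableCMC_cliffordMap hΨ h0 h1 h2,
      index_cliffordMap hΨ h0 h1 h2⟩
    · rw [quadricMetric_inner, quadricMetric_inner, mul_zero, Real.exp_zero, one_mul,
        hexp _ (signedDist_bounds p), signedDist_eq_arcsin, quadricExponent]
    · rw [h.ricci_eq hr.2]
      exact h.profileRicci_nonneg hr.1 hr' (norm_coe_S3 p) (inner_sphereDeriv p v)
    · rw [h.ricci_eq hr.2]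
      refine h.profileRicci_pos hr.1 hr' (norm_coe_S3 p) (inner_sphereDeriv p v)
        (fun hp0 => hp ((mem_cliffordTorus_iff p).2 hp0)) fun hv0 => hv ?_
      exact sphereDeriv_injective p (hv0.trans (map_zero _).symm)
    · rw [h.ricci_eq hr.2, exists_smul_cliffordNormal_iff]
      exact h.profileRicci_eq_zero_iff hr.1 hr' (norm_coe_S3 _) (inner_sphereDeriv _ v)
        (cliffordForm_cliffordMap x)
    · rw [jacobiOperator, jacobiPotential_cliffordMap hΨ h0 h1 h2]
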